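/- **Protocol.** Finitely many nodes, some of them corrupted from the beginning, run the checkpointed longest chain protocol in continuous time, all nodes being online. Honest blocks are mined at the points of a Poisson process of rate $(1-\beta)\lambda$, adversarial blocks at the points of an independent Poisson process of rate $\beta\lambda$. Under partial synchrony the adversary chooses a stabilization time $T_{\mathrm{GST}}\ge 0$; honest nodes re-broadcast all they receive, and a message sent or received by an honest node at time $t$ reaches all honest nodes by time $\max(t,T_{\mathrm{GST}})+\Delta$. At every time each honest node holds a longest chain among the chains it has received that contain the last checkpoint it has heard of (ties are broken by the adversary), and honest miners extend the chain they hold and broadcast the new block at once. Adversarial blocks extend any earlier block. Checkpoints are produced by a multi-iteration variant of the Algorand Byzantine agreement among the checkpointers, fewer than one third of whom are corrupted. A *quorum* is a set of votes of at least two thirds of the checkpointers; values are chains, or $\perp$ for next-votes. Every period of every iteration has a leader, and the leaders are independent and uniform among the checkpointers. All checkpointers start period $1$ of iteration $1$ at time $0$; a checkpointer starts period $1$ of iteration $n+1$ a time $e$ after it has seen a quorum of cert-votes of one period of iteration $n$ for one value, and period $p+1$ of an iteration when it sees a quorum of next-votes for one value for period $p$ (this value is its starting value; in period $1$ it is $\perp$),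 unless it has started a later period or has halted the iteration. With the clock reset to $0$ at the start of a period $p$, an honest checkpointer acts as follows. Call the period *open* for it if $p=1$ or it has seen a quorum of next-votes for $\perp$ for period $p-1$. (1) At clock $0$ the leader proposes the chain it holds if the period is open, and otherwise the value $v\ne\perp$ that has a quorum of next-votes for period $p-1$. (2) At clock $2\Delta$ it soft-votes, if the period is open, one value $v$ proposed by the leader that is valid or has a quorum of next-votes for period $p-1$, and otherwise the $v\neq\perp$ that has such a quorum. Here $v$ is valid if its $k$-deep block (the one followed by exactly $k$ blocks) lies in the chain that the checkpointer held when it entered the period and is a proper descendant of all checkpoints of earlier iterations that it knows. (3) Between clock $2\Delta$ and $4\Delta$ (inclusive) it cert-votes a value for which it has seen a quorum of soft-votes of this period. (4) At clock $4\Delta$ it next-votes the value it has cert-voted; if there is none, it next-votes $\perp$ if it has seen a quorum of next-votes for $\perp$ for period $p-1$, and else its starting value. (5) Later, until it leaves the period, it next-votes a value once it has seen a quorum of soft-votes for it in this period, and next-votes $\perp$ if it has not cert-voted and has seen a quorum of next-votes for $\perp$ for period $p-1$. A checkpointer halts an iteration once it has seen a quorum of cert-votes of one period for one value $v$ in it;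 any node that sees such a quorum has heard of the checkpoint of this iteration, which is the $k$-deep block of $v$. Votes are signed, and votes of honest checkpointers cannot be forged. **Properties.** Slot $j$ is the time interval $((j-1)\Delta,j\Delta]$, and $\mathsf{GST}$ denotes the first slot that begins at or after $T_{\mathrm{GST}}$. The *$k$-common prefix property holds after slot $s$* if for any two chains $\mathcal C_1,\mathcal C_2$ held by honest nodes at times $t_1\le t_2$, with $t_1$ in a slot $>s$, the chain $\mathcal C_1$ without its last $k$ blocks is a prefix of $\mathcal C_2$. The *$(k,s)$-chain quality property holds after slot $s$* if in every chain held by an honest node in a slot $>s$, any $k$ consecutive blocks mined in slots $>s$ include an honest block. **Corollary.** Let $0\le\beta<1/2$ and $\lambda,\Delta>0$ be such that $\bar y>\lambda\Delta-\bar y$, where $\bar y=(1-\beta)\lambda\Delta\,e^{-3(1-\beta)\lambda\Delta}$. There are constants $C,c,K,K_0>0$, depending only on $\beta,\lambda,\Delta$, such that the following holds for every $a\in\mathbb N$ and all sufficiently large security parameters $\kappa\ge\kappa_0(a)$. Let the checkpoint depth $k$ satisfy $k\ge K_0\kappa$ (in particular, $k=\Theta(\kappa)$ with a large enough constant), let the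 inter-checkpoint interval satisfy $e\ge K\sqrt\kappa\,\Delta$, and let the execution have duration $T_{\max}\le\kappa^a$. Then, whatever the adversary does, with probability at least $1-e^{-c\sqrt\kappa}$ the $k$-common prefix property and the $(k,C\cdot\mathsf{GST})$-chain quality property hold after slot $C\cdot\mathsf{GST}$ (up to time $T_{\max}$). -/

import Mathlib

open MeasureTheory ProbabilityTheory Filter Topology

universe u v

namespace CLC

/-! ### Blocks, chains and messages -/

/-- A block is the genesis block or is identified by its miner type and its mining time. -/
inductive Block : Type
  | genesis : Block
  | honest (τ : ℝ) : Block
  | adversarial (τ : ℝ) : Block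

/-- Mining time (`0` for the genesis block). -/
def Block.time : Block → ℝ
  | .genesis => 0
  | .honest τ => τ
  | .adversarial τ => τ

/-- The block was mined by an honest node. -/
def Block.IsHonest : Block → Prop
  | .honest _ => True
  | _ => False

/-- A blockchain, listed from the genesis block to the tip. -/
abbrev Chain : Type := List Block

/-- Messages. Iterations `n` and periods `p` of the agreement protocol are numbered from `0`;
`i` is the (signed) sender; the value `none` of a next-vote is the empty value `⊥`. -/
inductive Msg (Node : Type u) : Type u
  | chain (c : Chain) : Msg Node
  | proposal (n p : ℕ) (i : Node) (v : Chain) : Msg Node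
  | soft (n p : ℕ) (i : Node) (v : Chain) : Msg Node
  | cert (n p : ℕ) (i : Node) (v : Chain) : Msg Node
  | next (n p : ℕ) (i : Node) (w : Option Chain) : Msg Node

/-- The blockchain that a message transports, if any. -/
def Msg.carries {Node : Type u} : Msg Node → Option Chain
  | .chain c => some c
  | .proposal _ _ _ v => some v
  | .soft _ _ _ v => some v
  | .cert _ _ _ v => some v
  | .next _ _ _ w => w

/-- The signer of a message, if it is signed. -/
def Msg.sender {Node : Type u} : Msg Node → Option Node
  | .chain _ => none
  | .proposal _ _ i _ => some i
  | .soft _ _ i _ => some i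
  | .cert _ _ i _ => some i
  | .next _ _ i _ => some i

/-! ### Parameters, oracle outputs and runs -/

/-- Parameters of the protocol: the nodes that are not corrupted, the checkpointers, the delay
bound `Δ`, the inter-checkpoint interval `e` and the checkpoint depth `k`. -/
structure Setting (Node : Type u) where
  honest : Set Node
  ckpt : Finset Node
  Δ : ℝ
  e : ℝ
  k : ℕ

/-- One outcome of the oracle: the mining times of honest and of adversarial blocks, and the
leader of each period of each iteration. -/
structure Oracle (Node : Type u) where
  honestTimes : Set ℝ
  advTimes : Set ℝ
  leader : ℕ → ℕ → Node

/-- The data of a run in continuous time. The rules that it has to obey are `Run.Admissible`. -/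
structure Run (Node : Type u) where
  /-- the global stabilization time -/
  gst : ℝ
  /-- the parent of each block -/
  parent : Block → Block
  /-- the honest node that mines the honest block of a given time -/
  miner : ℝ → Node
  /-- the time at which a node first receives a message (`⊤` if never) -/
  recv : Node → Msg Node → WithTop ℝ
  /-- the blockchain that a node holds at a given time -/
  chain : Node → ℝ → Chain
  /-- the time at which a checkpointer starts a period of an iteration (`⊤` if never) -/
  start : Node → ℕ → ℕ → WithTop ℝ
  /-- the starting value of a checkpointer for a period of an iteration -/
  startVal : Node → ℕ → ℕ → Option Chain
  /-- the value that a checkpointer soft-votes in a period of an iteration, if any -/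
  softVal : Node → ℕ → ℕ → Option Chain

section Rules

variable {Node : Type u} (S : Setting Node) (O : Oracle Node) (R : Run Node)

/-- The block exists in this outcome of the mining oracle. -/
def Mined : Block → Prop
  | .genesis => True
  | .honest τ => τ ∈ O.honestTimes
  | .adversarial τ => τ ∈ O.advTimes

/-- `c` is a blockchain all of whose blocks have been mined by time `t`. -/
def ValidChain (t : ℝ) (c : Chain) : Prop :=
  c.head? = some Block.genesis ∧
  c.IsChain (fun a b => b ≠ Block.genesis ∧ R.parent b = a) ∧
  ∀ b ∈ c, Mined O b ∧ (b = Block.genesis ∨ b.time ≤ t)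

/-- Node `h` has received the message `m` by time `t`. -/
def Knows (h : Node) (t : ℝ) (m : Msg Node) : Prop := R.recv h m ≤ (t : WithTop ℝ)

/-- Node `h` has received the blockchain `c` by time `t`. -/
def KnowsChain (h : Node) (t : ℝ) (c : Chain) : Prop :=
  ∃ m, Knows R h t m ∧ m.carries = some c

open Classical in
/-- At least two thirds of the checkpointers satisfy `Q`. -/
def Quorum (Q : Node → Prop) : Prop :=
  2 * S.ckpt.card ≤ 3 * (S.ckpt.filter Q).card

def SoftQuorum (h : Node) (t : ℝ) (n p : ℕ) (v : Chain) : Prop :=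
  Quorum S (fun i => Knows R h t (Msg.soft n p i v))

def CertQuorum (h : Node) (t : ℝ) (n p : ℕ) (v : Chain) : Prop :=
  Quorum S (fun i => Knows R h t (Msg.cert n p i v))

def NextQuorum (h : Node) (t : ℝ) (n p : ℕ) (w : Option Chain) : Prop :=
  Quorum S (fun i => Knows R h t (Msg.next n p i w))

/-- By time `t`, `h` has received a certificate for the output `v` of iteration `n`. -/
def Certified (h : Node) (t : ℝ) (n : ℕ) (v : Chain) : Prop :=
  ∃ p, CertQuorum S R h t n p v

/-- The block that is exactly `k`-deep in `v`, if `v` is long enough. -/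
def ckptBlock (v : Chain) : Option Block := (v.rdrop S.k).getLast?

/-- `c` contains the last checkpoint that `h` has heard of by time `t` (if any). -/
def ExtendsLast (h : Node) (t : ℝ) (c : Chain) : Prop :=
  ∀ n v, Certified S R h t n v → (∀ n' v', Certified S R h t n' v' → n' ≤ n) →
    ∀ B, ckptBlock S v = some B → B ∈ c

/-- `c` is a longest chain known to `h` at time `t` that extends the last checkpoint. -/
def IsCheckpointedLongest (h : Node) (t : ℝ) (c : Chain) : Prop :=
  KnowsChain R h t c ∧ ExtendsLast S R h t c ∧
  ∀ c', KnowsChain R h t c' → ExtendsLast S R h t c' → c'.length ≤ c.length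

/-- Period `p'` of iteration `n'` comes after period `p` of iteration `n`. -/
def Later (n p n' p' : ℕ) : Prop := n < n' ∨ (n = n' ∧ p < p')

/-- Checkpointer `i` has halted iteration `n` before time `t`. -/
def HaltedBefore (i : Node) (n : ℕ) (t : ℝ) : Prop :=
  ∃ u, u < t ∧ ∃ v, Certified S R i u n v

/-- Checkpointer `i` is in period `p` of iteration `n` at time `t`. At the very instant of leaving
a period it can still act in it. -/
def InPeriod (i : Node) (n p : ℕ) (t : ℝ) : Prop :=
  R.start i n p ≤ (t : WithTop ℝ) ∧
  (∀ n' p', Later n p n' p' → ¬ R.start i n' p' < (t : WithTop ℝ)) ∧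
  ¬ HaltedBefore S R i n t

/-- What `i` waits for before it starts period `p` of iteration `n`. -/
def Ready (i : Node) : ℕ → ℕ → ℝ → Prop
  | 0, 0, t => 0 ≤ t
  | n + 1, 0, t => ∃ v, Certified S R i (t - S.e) n v
  | n, q + 1, t => ∃ w, NextQuorum S R i t n q w

/-- By time `t`, `i` has received enough next-votes for `w` for the period before `p`. -/
def PrevNext (i : Node) (t : ℝ) (n p : ℕ) (w : Option Chain) : Prop :=
  ∃ q, p = q + 1 ∧ NextQuorum S R i t n q w

/-- New proposals are admitted: `p` is the first period, or `⊥` has enough next-votes for the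
period before `p`. -/
def Fresh (i : Node) (t : ℝ) (n p : ℕ) : Prop := p = 0 ∨ PrevNext S R i t n p none

/-- The proposed value `v` is VALID for `i` at time `t` in a period of iteration `n` that `i` has
entered at time `s`: its `k`-deep block is in the chain that `i` held at time `s`, and is a
descendant of all earlier checkpoints (`v.rdrop (k + 1)` are the proper ancestors of that block). -/
def ValidValue (i : Node) (s t : ℝ) (n : ℕ) (v : Chain) : Prop :=
  (∃ B, ckptBlock S v = some B ∧ B ∈ R.chain i s) ∧
  ∀ m, m < n → ∀ v', Certified S R i t m v' →
    ∀ B', ckptBlock S v' = some B' → B' ∈ v.rdrop (S.k + 1)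

/-- Step 2 (at clock `2Δ`): `i` may soft-vote `v` in period `p` of iteration `n`. -/
def SoftEligible (i : Node) (n p : ℕ) (v : Chain) : Prop :=
  ∃ s : ℝ, R.start i n p = (s : WithTop ℝ) ∧ InPeriod S R i n p (s + 2 * S.Δ) ∧
    ((Fresh S R i (s + 2 * S.Δ) n p ∧
        Knows R i (s + 2 * S.Δ) (Msg.proposal n p (O.leader n p) v) ∧
        (ValidValue S R i s (s + 2 * S.Δ) n v ∨
          PrevNext S R i (s + 2 * S.Δ) n p (some v))) ∨
      (¬ Fresh S R i (s + 2 * S.Δ) n p ∧ PrevNext S R i (s + 2 * S.Δ) n p (some v)))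

/-- Step 1 (at clock `0`): `i` proposes `v` at time `t`. -/
def Proposes (i : Node) (n p : ℕ) (v : Chain) (t : ℝ) : Prop :=
  O.leader n p = i ∧ R.start i n p = (t : WithTop ℝ) ∧
    ((Fresh S R i t n p ∧ v = R.chain i t) ∨
      (¬ Fresh S R i t n p ∧ PrevNext S R i t n p (some v)))

/-- Step 2: the soft-vote is cast at clock `2Δ`. -/
def SoftVotes (i : Node) (n p : ℕ) (v : Chain) (t : ℝ) : Prop :=
  ∃ s : ℝ, R.start i n p = (s : WithTop ℝ) ∧ t = s + 2 * S.Δ ∧ R.softVal i n p = some v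

/-- Step 3 (clock from `2Δ` to `4Δ`): `i` cert-votes a value with enough soft-votes. -/
def CertVotes (i : Node) (n p : ℕ) (v : Chain) (t : ℝ) : Prop :=
  InPeriod S R i n p t ∧ ∃ s : ℝ, R.start i n p = (s : WithTop ℝ) ∧
    s + 2 * S.Δ ≤ t ∧ t ≤ s + 4 * S.Δ ∧ SoftQuorum S R i t n p v

/-- `i` cert-votes `v` at some time in period `p` of iteration `n`. -/
def HasCertVoted (i : Node) (n p : ℕ) (v : Chain) : Prop := ∃ t, CertVotes S R i n p v t

/-- Step 4 (at clock `4Δ`) and Step 5 (later): `i` next-votes `w`. -/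
def NextVotes (i : Node) (n p : ℕ) (w : Option Chain) (t : ℝ) : Prop :=
  InPeriod S R i n p t ∧ ∃ s : ℝ, R.start i n p = (s : WithTop ℝ) ∧
    ((t = s + 4 * S.Δ ∧
        ((∃ v, HasCertVoted S R i n p v ∧ w = some v) ∨
          ((∀ v, ¬ HasCertVoted S R i n p v) ∧ PrevNext S R i t n p none ∧ w = none) ∨
          ((∀ v, ¬ HasCertVoted S R i n p v) ∧ ¬ PrevNext S R i t n p none ∧
            w = R.startVal i n p))) ∨
      (s + 4 * S.Δ < t ∧
        ((∃ v, SoftQuorum S R i t n p v ∧ w = some v) ∨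
          (PrevNext S R i t n p none ∧ (∀ v, ¬ HasCertVoted S R i n p v) ∧ w = none))))

/-- The protocol makes the honest checkpointer `i` send the signed message `m` at time `t`. -/
def Casts (i : Node) (t : ℝ) : Msg Node → Prop
  | .chain _ => False
  | .proposal n p j v => j = i ∧ Proposes S O R i n p v t
  | .soft n p j v => j = i ∧ SoftVotes S R i n p v t
  | .cert n p j v => j = i ∧ CertVotes S R i n p v t
  | .next n p j w => j = i ∧ NextVotes S R i n p w t

/-- The runs of the checkpointed longest chain protocol under partial synchrony, with all nodes
online. Whatever is not determined by these rules is up to the adversary: the stabilization time,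
message delays, the behaviour of corrupted nodes, the parents of adversarial blocks, the choice of
the honest miner, and all ties. -/
structure Run.Admissible : Prop where
  gst_nonneg : 0 ≤ R.gst
  /-- a block is mined after its parent -/
  parent_mined : ∀ b, b ≠ Block.genesis → Mined O b →
    Mined O (R.parent b) ∧ (R.parent b).time < b.time
  recv_nonneg : ∀ h m, 0 ≤ R.recv h m
  /-- honest nodes only take notice of chains of mined blocks -/
  recv_valid : ∀ h ∈ S.honest, ∀ t c, KnowsChain R h t c → ValidChain O R t c
  /-- everybody knows the genesis block from the beginning -/
  genesis_known : ∀ h ∈ S.honest, Knows R h 0 (Msg.chain [Block.genesis])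
  /-- honest nodes broadcast all they send or receive; this reaches the other honest nodes within
  `Δ`, or by `GST + Δ` if it was sent before `GST` -/
  network : ∀ h ∈ S.honest, ∀ h' ∈ S.honest, ∀ m,
    R.recv h' m ≤ max (R.recv h m) (R.gst : WithTop ℝ) + (S.Δ : WithTop ℝ)
  /-- an honest checkpointer sends every message that the protocol prescribes -/
  own_messages : ∀ i ∈ S.honest, i ∈ S.ckpt → ∀ t m, Casts S O R i t m → Knows R i t m
  /-- signed messages of honest nodes cannot be forged -/
  unforgeable : ∀ h ∈ S.honest, ∀ i ∈ S.honest, ∀ t m, m.sender = some i → Knows R h t m →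
    i ∈ S.ckpt ∧ ∃ t' ≤ t, Casts S O R i t' m
  /-- checkpointed longest chain rule -/
  chain_rule : ∀ h ∈ S.honest, ∀ t, 0 ≤ t → IsCheckpointedLongest S R h t (R.chain h t)
  miner_honest : ∀ τ ∈ O.honestTimes, R.miner τ ∈ S.honest
  /-- an honest block extends the chain that its miner holds just before the mining time, and is
  broadcast at once -/
  mining_rule : ∀ τ ∈ O.honestTimes, ∃ c : Chain,
    (∀ᶠ s in 𝓝[<] τ, R.chain (R.miner τ) s = c) ∧
    c.getLast? = some (R.parent (Block.honest τ)) ∧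
    Knows R (R.miner τ) τ (Msg.chain (c ++ [Block.honest τ]))
  /-- a period is started as soon as `Ready` holds, unless a later one has been started or the
  iteration has been halted -/
  start_rule : ∀ i ∈ S.honest, i ∈ S.ckpt → ∀ (n p : ℕ) (t : ℝ),
    R.start i n p = (t : WithTop ℝ) ↔
      IsLeast {x : ℝ | Ready S R i n p x} t ∧
      (∀ n' p', Later n p n' p' → ¬ R.start i n' p' ≤ (t : WithTop ℝ)) ∧
      ¬ HaltedBefore S R i n t
  /-- the starting value is `⊥` in the first period, and otherwise the value whose next-votes
  started the period -/
  startVal_rule : ∀ i ∈ S.honest, i ∈ S.ckpt → ∀ (n p : ℕ) (t : ℝ),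
    R.start i n p = (t : WithTop ℝ) →
      (p = 0 → R.startVal i n p = none) ∧
      (∀ q, p = q + 1 → NextQuorum S R i t n q (R.startVal i n p))
  /-- one eligible value is soft-voted if there is any -/
  softVal_rule : ∀ i ∈ S.honest, i ∈ S.ckpt → ∀ (n p : ℕ),
    (∀ v, R.softVal i n p = some v → SoftEligible S O R i n p v) ∧
    (R.softVal i n p = none → ∀ v, ¬ SoftEligible S O R i n p v)

/-! ### Security properties -/

/-- The slot that contains time `t`: slot `j` is the interval `((j - 1) Δ, j Δ]`. -/
noncomputable def slot (t : ℝ) : ℕ := ⌈t / S.Δ⌉₊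

/-- The first slot that begins at or after the global stabilization time. -/
noncomputable def gstSlot : ℕ := ⌈R.gst / S.Δ⌉₊ + 1

/-- The `k`-common prefix property after slot `s`, up to time `T`. -/
def CommonPrefixAfter (k : ℕ) (s T : ℝ) : Prop :=
  ∀ h₁ ∈ S.honest, ∀ h₂ ∈ S.honest, ∀ t₁ t₂ : ℝ, s < slot S t₁ → t₁ ≤ t₂ → t₂ ≤ T →
    (R.chain h₁ t₁).rdrop k <+: R.chain h₂ t₂

/-- The `(k, s)`-chain quality property after slot `s'`, up to time `T`: in chains held by honest
nodes, any `k` consecutive blocks mined after slot `s` include an honest block. -/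
def ChainQualityAfter (k : ℕ) (s s' T : ℝ) : Prop :=
  ∀ h ∈ S.honest, ∀ t : ℝ, s' < slot S t → t ≤ T →
    ∀ L : List Block, L <:+: R.chain h t → L.length = k →
      (∀ b ∈ L, b ≠ Block.genesis ∧ s < slot S b.time) → ∃ b ∈ L, b.IsHonest

end Rules

/-! ### Randomness -/

section Probability

variable {Ω : Type v} [MeasurableSpace Ω]

/-- The number of points in the interval `(a, b]`. -/
noncomputable def count (A : Ω → Set ℝ) (a b : ℝ) (ω : Ω) : ℕ := (A ω ∩ Set.Ioc a b).ncard

/-- `A` is the random set of arrival times of a Poisson process of rate `r` on `(0, ∞)`. -/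
structure IsPoissonProcess (μ : Measure Ω) (r : ℝ) (A : Ω → Set ℝ) : Prop where
  pos : ∀ ω, A ω ⊆ Set.Ioi 0
  locallyFinite : ∀ ω t, (A ω ∩ Set.Iic t).Finite
  measurable_count : ∀ a b, Measurable (count A a b)
  law : ∀ a b, 0 ≤ a → a ≤ b →
    μ.map (count A a b) = poissonMeasure (Real.toNNReal (r * (b - a)))
  indep_increments : ∀ x : ℕ → ℝ, 0 ≤ x 0 → Monotone x →
    iIndepFun (fun j => count A (x j) (x (j + 1))) μ

/-- The oracle: honest blocks arrive at rate `(1 - β) lam`, adversarial blocks independently at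
rate `β lam`, and the leaders of the periods are independent and uniform among checkpointers. -/
structure IsOracle {Node : Type u} (μ : Measure Ω) (S : Setting Node) (β lam : ℝ)
    (H A : Ω → Set ℝ) (ld : ℕ × ℕ → Ω → S.ckpt) : Prop where
  honest_poisson : IsPoissonProcess μ ((1 - β) * lam) H
  adv_poisson : IsPoissonProcess μ (β * lam) A
  indep : IndepFun (fun ω (x : ℝ × ℝ) => count H x.1 x.2 ω)
    (fun ω (x : ℝ × ℝ) => count A x.1 x.2 ω) μ
  ld_measurable : ∀ x i, MeasurableSet {ω | ld x ω = i}
  ld_uniform : ∀ x i, μ {ω | ld x ω = i} = (S.ckpt.card : ENNReal)⁻¹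
  ld_indep : iIndepFun (m := fun _ => ⊤) ld μ

/-- The outcome of the oracle at the sample point `ω`. -/
def oracleAt {Node : Type u} {S : Setting Node} (H A : Ω → Set ℝ) (ld : ℕ × ℕ → Ω → S.ckpt)
    (ω : Ω) : Oracle Node where
  honestTimes := H ω
  advTimes := A ω
  leader n p := (ld (n, p) ω : Node)

end Probability

/-- The probability that a slot is a convergence opportunity: one honest block is mined in the
slot and none in the two adjacent slots. -/
noncomputable def ybar (β lam Δ : ℝ) : ℝ :=
  (1 - β) * lam * Δ * Real.exp (-3 * ((1 - β) * lam * Δ))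

end CLC

open CLC

/-! Call an honest block isolated if no other honest block is mined within `Δ` of it. Two isolated
blocks never have the same position in a chain, so if each of them were matched by another block at
its position, at least half of all blocks would not be isolated. Since `ȳ > λΔ - ȳ`, isolated blocks
outnumber all other blocks in every interval of `κ` slots outside an event of exponentially small
probability, and an isolated block that is alone at its position lies in all chains that cover the
interval. This gives common prefix and chain quality, provided that checkpoints do not break the
growth of the honest chains.

Checkpoints can only interfere close to the decision of an iteration. After stabilization an
undecided iteration ends soon after the first period with an honest leader, which comes within
`O(√κ)` periods outside an event of probability `e^{-Ω(√κ)}`, and the certified value then extends a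
chain that was held by an honest node at most `O(√κ Δ)` earlier. As decisions are at least
`e ≥ K √κ Δ` apart, only a small fraction of the isolated blocks is mined close to a decision, and
discarding these preserves the majority. In an interval that ends after a large multiple of
`T_GST`, so does discarding the blocks mined before stabilization. -/

namespace CLC

section Agreement

variable {Node : Type u} {S : Setting Node} {O : Oracle Node} {R : Run Node}

/-- The checkpointers that are not corrupted. -/
def Setting.honestCkpts (S : Setting Node) : Set Node := S.honest ∩ S.ckpt

/-- Fewer than one third of the checkpointers are corrupted. -/
def HonestSupermajority (S : Setting Node) : Prop :=
  3 * {i ∈ (S.ckpt : Set Node) | i ∉ S.honest}.ncard < S.ckpt.card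

/-- The standing assumptions on a single run: it obeys the rules of the protocol, fewer than one
third of the checkpointers are corrupted, and the two time constants are positive. -/
structure Fair (S : Setting Node) (O : Oracle Node) (R : Run Node) : Prop where
  adm : R.Admissible S O
  supermajority : HonestSupermajority S
  Δ_pos : 0 < S.Δ
  e_pos : 0 < S.e

/-- Iteration `n` is decided at time `t`: some honest node has received a certificate for it. -/
def Decided (S : Setting Node) (R : Run Node) (n : ℕ) (t : ℝ) : Prop :=
  ∃ h ∈ S.honest, ∃ v, Certified S R h t n v

/-! ### Quorums -/

theorem Quorum.mono {Q Q' : Node → Prop} (h : Quorum S Q) (hQ : ∀ i, Q i → Q' i) :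
    Quorum S Q' := by
  classical
  exact h.trans (Nat.mul_le_mul_left 3
    (Finset.card_le_card (Finset.monotone_filter_right S.ckpt fun i _ => hQ i)))

open Classical in
theorem HonestSupermajority.card_filter_lt (hS : HonestSupermajority S) :
    3 * (S.ckpt.filter (· ∉ S.honest)).card < S.ckpt.card := by
  rwa [← Set.ncard_coe_finset, Finset.coe_filter]

theorem HonestSupermajority.quorum_inter (hS : HonestSupermajority S) {Q Q' : Node → Prop}
    (hQ : Quorum S Q) (hQ' : Quorum S Q') : ∃ i ∈ S.honestCkpts, Q i ∧ Q' i := by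
  classical
  by_contra! hdisj
  have hbad := hS.card_filter_lt
  have hunion : (S.ckpt.filter Q ∪ S.ckpt.filter Q').card ≤ S.ckpt.card :=
    Finset.card_le_card (Finset.union_subset (Finset.filter_subset _ _) (Finset.filter_subset _ _))
  have hinter : (S.ckpt.filter Q ∩ S.ckpt.filter Q').card ≤
      (S.ckpt.filter (· ∉ S.honest)).card := by
    refine Finset.card_le_card fun i hi => ?_
    simp only [Finset.mem_inter, Finset.mem_filter] at hi ⊢
    exact ⟨hi.1.1, fun hh => hdisj i ⟨hh, hi.1.1⟩ hi.1.2 hi.2.2⟩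
  have hcard := Finset.card_union_add_card_inter (S.ckpt.filter Q) (S.ckpt.filter Q')
  unfold Quorum at hQ hQ'
  omega

theorem HonestSupermajority.exists_of_quorum (hS : HonestSupermajority S) {Q : Node → Prop}
    (hQ : Quorum S Q) : ∃ i ∈ S.honestCkpts, Q i :=
  (hS.quorum_inter hQ hQ).imp fun _ hi => ⟨hi.1, hi.2.1⟩

theorem HonestSupermajority.quorum_of_forall (hS : HonestSupermajority S) {Q : Node → Prop}
    (hQ : ∀ i ∈ S.honestCkpts, Q i) : Quorum S Q := by
  classical
  have hbad := hS.card_filter_lt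
  have hsplit := Finset.card_filter_add_card_filter_not (s := S.ckpt) (· ∈ S.honest)
  have hhonest : (S.ckpt.filter (· ∈ S.honest)).card ≤ (S.ckpt.filter Q).card := by
    refine Finset.card_le_card fun i hi => ?_
    rw [Finset.mem_filter] at hi ⊢
    exact ⟨hi.1, hQ i ⟨hi.2, hi.1⟩⟩
  unfold Quorum
  omega

theorem HonestSupermajority.nonempty (hS : HonestSupermajority S) : S.honestCkpts.Nonempty := by
  obtain ⟨i, hi, -⟩ := hS.exists_of_quorum (Q := fun _ => True)
    (hS.quorum_of_forall fun _ _ => trivial)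
  exact ⟨i, hi⟩

/-! ### Knowledge -/

theorem Knows.mono {h : Node} {t t' : ℝ} {m : Msg Node} (hk : Knows R h t m) (htt : t ≤ t') :
    Knows R h t' m :=
  hk.trans (WithTop.coe_le_coe.2 htt)

theorem SoftQuorum.mono {h : Node} {t t' : ℝ} {n p : ℕ} {v : Chain}
    (hq : SoftQuorum S R h t n p v) (htt : t ≤ t') : SoftQuorum S R h t' n p v :=
  Quorum.mono hq fun _ hi => hi.mono htt

theorem CertQuorum.mono {h : Node} {t t' : ℝ} {n p : ℕ} {v : Chain}
    (hq : CertQuorum S R h t n p v) (htt : t ≤ t') : CertQuorum S R h t' n p v :=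
  Quorum.mono hq fun _ hi => hi.mono htt

theorem NextQuorum.mono {h : Node} {t t' : ℝ} {n p : ℕ} {w : Option Chain}
    (hq : NextQuorum S R h t n p w) (htt : t ≤ t') : NextQuorum S R h t' n p w :=
  Quorum.mono hq fun _ hi => hi.mono htt

theorem PrevNext.mono {h : Node} {t t' : ℝ} {n p : ℕ} {w : Option Chain}
    (hq : PrevNext S R h t n p w) (htt : t ≤ t') : PrevNext S R h t' n p w :=
  hq.imp fun _ ⟨hp, hn⟩ => ⟨hp, hn.mono htt⟩

theorem Certified.mono {h : Node} {t t' : ℝ} {n : ℕ} {v : Chain}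
    (hc : Certified S R h t n v) (htt : t ≤ t') : Certified S R h t' n v :=
  hc.imp fun _ hq => hq.mono htt

theorem Decided.mono {t t' : ℝ} {n : ℕ} (hd : Decided S R n t) (htt : t ≤ t') :
    Decided S R n t' :=
  let ⟨h, hh, v, hv⟩ := hd
  ⟨h, hh, v, hv.mono htt⟩

theorem not_prevNext_zero {i : Node} {t : ℝ} {n : ℕ} {w : Option Chain} :
    ¬ PrevNext S R i t n 0 w :=
  fun ⟨q, hq, _⟩ => Nat.succ_ne_zero q hq.symm

theorem prevNext_succ_iff {i : Node} {t : ℝ} {n p : ℕ} {w : Option Chain} :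
    PrevNext S R i t n (p + 1) w ↔ NextQuorum S R i t n p w :=
  ⟨fun ⟨_, hq, hn⟩ => Nat.succ_injective hq ▸ hn, fun hn => ⟨p, rfl, hn⟩⟩

theorem Knows.relay {h h' : Node} {t t' : ℝ} {m : Msg Node} (hk : Knows R h t m)
    (A : R.Admissible S O) (hh : h ∈ S.honest) (hh' : h' ∈ S.honest) (ht : t + S.Δ ≤ t')
    (hg : R.gst + S.Δ ≤ t') : Knows R h' t' m :=
  calc R.recv h' m
      ≤ max (R.recv h m) (R.gst : WithTop ℝ) + (S.Δ : WithTop ℝ) := A.network h hh h' hh' m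
    _ ≤ ((t' - S.Δ : ℝ) : WithTop ℝ) + (S.Δ : WithTop ℝ) := by
        gcongr
        exact max_le (hk.trans (WithTop.coe_le_coe.2 (by linarith)))
          (WithTop.coe_le_coe.2 (by linarith))
    _ = (t' : WithTop ℝ) := by rw [← WithTop.coe_add, sub_add_cancel]

theorem KnowsChain.relay {h h' : Node} {t t' : ℝ} {c : Chain} (hk : KnowsChain R h t c)
    (A : R.Admissible S O) (hh : h ∈ S.honest) (hh' : h' ∈ S.honest) (ht : t + S.Δ ≤ t')
    (hg : R.gst + S.Δ ≤ t') : KnowsChain R h' t' c :=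
  hk.imp fun _ ⟨hm, hc⟩ => ⟨hm.relay A hh hh' ht hg, hc⟩

theorem SoftQuorum.relay {h h' : Node} {t t' : ℝ} {n p : ℕ} {v : Chain}
    (hq : SoftQuorum S R h t n p v) (A : R.Admissible S O) (hh : h ∈ S.honest)
    (hh' : h' ∈ S.honest) (ht : t + S.Δ ≤ t') (hg : R.gst + S.Δ ≤ t') :
    SoftQuorum S R h' t' n p v :=
  Quorum.mono hq fun _ hi => hi.relay A hh hh' ht hg

theorem NextQuorum.relay {h h' : Node} {t t' : ℝ} {n p : ℕ} {w : Option Chain}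
    (hq : NextQuorum S R h t n p w) (A : R.Admissible S O) (hh : h ∈ S.honest)
    (hh' : h' ∈ S.honest) (ht : t + S.Δ ≤ t') (hg : R.gst + S.Δ ≤ t') :
    NextQuorum S R h' t' n p w :=
  Quorum.mono hq fun _ hi => hi.relay A hh hh' ht hg

theorem PrevNext.relay {h h' : Node} {t t' : ℝ} {n p : ℕ} {w : Option Chain}
    (hq : PrevNext S R h t n p w) (A : R.Admissible S O) (hh : h ∈ S.honest)
    (hh' : h' ∈ S.honest) (ht : t + S.Δ ≤ t') (hg : R.gst + S.Δ ≤ t') :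
    PrevNext S R h' t' n p w :=
  hq.imp fun _ ⟨hp, hn⟩ => ⟨hp, hn.relay A hh hh' ht hg⟩

theorem Certified.relay {h h' : Node} {t t' : ℝ} {n : ℕ} {v : Chain}
    (hc : Certified S R h t n v) (A : R.Admissible S O) (hh : h ∈ S.honest)
    (hh' : h' ∈ S.honest) (ht : t + S.Δ ≤ t') (hg : R.gst + S.Δ ≤ t') :
    Certified S R h' t' n v :=
  hc.imp fun _ hq => Quorum.mono hq fun _ hi => hi.relay A hh hh' ht hg

theorem Decided.relay {h' : Node} {t t' : ℝ} {n : ℕ} (hd : Decided S R n t)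
    (A : R.Admissible S O) (hh' : h' ∈ S.honest) (ht : t + S.Δ ≤ t') (hg : R.gst + S.Δ ≤ t') :
    ∃ v, Certified S R h' t' n v :=
  let ⟨_, hh, v, hv⟩ := hd
  ⟨v, hv.relay A hh hh' ht hg⟩

/-! ### Votes of honest checkpointers -/

theorem Fair.exists_common_caster (F : Fair S O R) {h h' : Node} (hh : h ∈ S.honest)
    (hh' : h' ∈ S.honest) {t t' : ℝ} {m m' : Node → Msg Node} (hm : ∀ i, (m i).sender = some i)
    (hm' : ∀ i, (m' i).sender = some i) (hq : Quorum S fun i => Knows R h t (m i))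
    (hq' : Quorum S fun i => Knows R h' t' (m' i)) :
    ∃ i ∈ S.honestCkpts, (∃ x ≤ t, Casts S O R i x (m i)) ∧ ∃ x ≤ t', Casts S O R i x (m' i) := by
  obtain ⟨i, hi, hk, hk'⟩ := F.supermajority.quorum_inter hq hq'
  exact ⟨i, hi, (F.adm.unforgeable h hh i hi.1 t _ (hm i) hk).2,
    (F.adm.unforgeable h' hh' i hi.1 t' _ (hm' i) hk').2⟩

theorem Fair.exists_caster (F : Fair S O R) {h : Node} (hh : h ∈ S.honest) {t : ℝ}
    {m : Node → Msg Node} (hm : ∀ i, (m i).sender = some i)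
    (hq : Quorum S fun i => Knows R h t (m i)) :
    ∃ i ∈ S.honestCkpts, ∃ x ≤ t, Casts S O R i x (m i) :=
  (F.exists_common_caster hh hh hm hm hq hq).imp fun _ hi => ⟨hi.1, hi.2.1⟩

theorem Fair.softQuorum_voter (F : Fair S O R) {h : Node} (hh : h ∈ S.honest) {t : ℝ} {n p : ℕ}
    {v : Chain} (hq : SoftQuorum S R h t n p v) :
    ∃ j ∈ S.honestCkpts, ∃ t' ≤ t, SoftVotes S R j n p v t' :=
  let ⟨j, hj, t', ht', _, hv⟩ := F.exists_caster hh (fun _ => rfl) hq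
  ⟨j, hj, t', ht', hv⟩

theorem Fair.certQuorum_voter (F : Fair S O R) {h : Node} (hh : h ∈ S.honest) {t : ℝ} {n p : ℕ}
    {v : Chain} (hq : CertQuorum S R h t n p v) :
    ∃ j ∈ S.honestCkpts, ∃ t' ≤ t, CertVotes S R j n p v t' :=
  let ⟨j, hj, t', ht', _, hv⟩ := F.exists_caster hh (fun _ => rfl) hq
  ⟨j, hj, t', ht', hv⟩

theorem Fair.nextQuorum_voter (F : Fair S O R) {h : Node} (hh : h ∈ S.honest) {t : ℝ} {n p : ℕ}
    {w : Option Chain} (hq : NextQuorum S R h t n p w) :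
    ∃ j ∈ S.honestCkpts, ∃ t' ≤ t, NextVotes S R j n p w t' :=
  let ⟨j, hj, t', ht', _, hv⟩ := F.exists_caster hh (fun _ => rfl) hq
  ⟨j, hj, t', ht', hv⟩

theorem Fair.softQuorum_unique (F : Fair S O R) {h h' : Node} (hh : h ∈ S.honest)
    (hh' : h' ∈ S.honest) {t t' : ℝ} {n p : ℕ} {v v' : Chain}
    (hq : SoftQuorum S R h t n p v) (hq' : SoftQuorum S R h' t' n p v') : v = v' := by
  obtain ⟨j, -, ⟨-, -, -, -, -, -, hv⟩, ⟨-, -, -, -, -, -, hv'⟩⟩ :=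
    F.exists_common_caster hh hh' (fun _ => rfl) (fun _ => rfl) hq hq'
  exact Option.some.inj (hv.symm.trans hv')

theorem NextVotes.exists_start {i : Node} {n p : ℕ} {w : Option Chain} {t : ℝ}
    (h : NextVotes S R i n p w t) :
    ∃ s : ℝ, R.start i n p = (s : WithTop ℝ) ∧ s + 4 * S.Δ ≤ t := by
  obtain ⟨-, s, hs, ⟨ht, -⟩ | ⟨ht, -⟩⟩ := h
  · exact ⟨s, hs, ht.ge⟩
  · exact ⟨s, hs, ht.le⟩

theorem NextVotes.softQuorum_or_startVal {i : Node} {n p : ℕ} {v : Chain} {t : ℝ}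
    (h : NextVotes S R i n p (some v) t) :
    SoftQuorum S R i t n p v ∨
      ∃ s : ℝ, R.start i n p = (s : WithTop ℝ) ∧ t = s + 4 * S.Δ ∧
        (∀ v', ¬ HasCertVoted S R i n p v') ∧ ¬ PrevNext S R i t n p none ∧
        R.startVal i n p = some v := by
  obtain ⟨-, s, hs, ⟨ht, h⟩ | ⟨-, h⟩⟩ := h
  · rcases h with ⟨v', ⟨t', -, s', hs', -, ht', hq⟩, hv⟩ | ⟨-, -, h⟩ | ⟨hcert, hbot, h⟩
    · obtain rfl := WithTop.coe_inj.1 (hs.symm.trans hs')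
      obtain rfl := Option.some.inj hv
      exact Or.inl (hq.mono (ht'.trans ht.ge))
    · exact absurd h (Option.some_ne_none v)
    · exact Or.inr ⟨s, hs, ht, hcert, hbot, h.symm⟩
  · rcases h with ⟨v', hq, hv⟩ | ⟨-, -, h⟩
    · obtain rfl := Option.some.inj hv
      exact Or.inl hq
    · exact absurd h (Option.some_ne_none v)

theorem NextVotes.not_hasCertVoted {i : Node} {n p : ℕ} {t : ℝ}
    (h : NextVotes S R i n p none t) (v : Chain) : ¬ HasCertVoted S R i n p v := by
  obtain ⟨-, s, -, ⟨-, h⟩ | ⟨-, h⟩⟩ := h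
  · rcases h with ⟨v', -, hv⟩ | ⟨hcert, -, -⟩ | ⟨hcert, -, -⟩
    · exact absurd hv.symm (Option.some_ne_none v')
    · exact hcert v
    · exact hcert v
  · rcases h with ⟨v', -, hv⟩ | ⟨-, hcert, -⟩
    · exact absurd hv.symm (Option.some_ne_none v')
    · exact hcert v

theorem Fair.nextQuorum_none_of_nextVotes_none (F : Fair S O R) {i : Node}
    (hi : i ∈ S.honestCkpts) {n p : ℕ} {t : ℝ} (h : NextVotes S R i n (p + 1) none t) :
    NextQuorum S R i t n p none := by
  obtain ⟨-, s, hs, ⟨ht, h⟩ | ⟨-, h⟩⟩ := h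
  · rcases h with ⟨v', -, hv⟩ | ⟨-, hbot, -⟩ | ⟨-, -, hval⟩
    · exact absurd hv.symm (Option.some_ne_none v')
    · exact prevNext_succ_iff.1 hbot
    · have hstart := (F.adm.startVal_rule i hi.1 hi.2 n (p + 1) s hs).2 p rfl
      rw [← hval] at hstart
      exact hstart.mono (by linarith [F.Δ_pos])
  · rcases h with ⟨v', -, hv⟩ | ⟨hbot, -, -⟩
    · exact absurd hv.symm (Option.some_ne_none v')
    · exact prevNext_succ_iff.1 hbot

theorem Run.Admissible.prevNext_of_startVal (A : R.Admissible S O) {i : Node}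
    (hi : i ∈ S.honestCkpts) {n p : ℕ} {s : ℝ} {v : Chain}
    (hs : R.start i n p = (s : WithTop ℝ)) (hv : R.startVal i n p = some v) :
    PrevNext S R i s n p (some v) := by
  obtain ⟨hzero, hsucc⟩ := A.startVal_rule i hi.1 hi.2 n p s hs
  cases p with
  | zero => exact absurd (hv.symm.trans (hzero rfl)) (Option.some_ne_none v)
  | succ q => exact ⟨q, rfl, hv ▸ hsucc q rfl⟩

theorem Run.Admissible.softVotes_cases (A : R.Admissible S O) {i : Node}
    (hi : i ∈ S.honestCkpts) {n p : ℕ} {v : Chain} {t : ℝ} (h : SoftVotes S R i n p v t) :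
    ∃ s : ℝ, R.start i n p = (s : WithTop ℝ) ∧ t = s + 2 * S.Δ ∧
    ((Fresh S R i t n p ∧ Knows R i t (Msg.proposal n p (O.leader n p) v) ∧
        (ValidValue S R i s t n v ∨ PrevNext S R i t n p (some v))) ∨
      (¬ Fresh S R i t n p ∧ PrevNext S R i t n p (some v))) := by
  obtain ⟨s, hs, rfl, hv⟩ := h
  obtain ⟨s', hs', -, h⟩ := (A.softVal_rule i hi.1 hi.2 n p).1 v hv
  obtain rfl := WithTop.coe_inj.1 (hs.symm.trans hs')
  exact ⟨s, hs, rfl, h⟩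

/-! ### Agreement -/

/-- The value that a starting period inherits is unambiguous: honest nodes cannot see next-votes
for two different chains in the preceding period. -/
def InheritsUnique (S : Setting Node) (R : Run Node) (n p : ℕ) : Prop :=
  ∀ h ∈ S.honest, ∀ h' ∈ S.honest, ∀ t t' v v', PrevNext S R h t n p (some v) →
    PrevNext S R h' t' n p (some v') → v = v'

theorem InheritsUnique.eq_of_nextVotes_of_softVotes {n p : ℕ} (hU : InheritsUnique S R n p)
    (F : Fair S O R) {j h' : Node} (hj : j ∈ S.honestCkpts) (hh' : h' ∈ S.honest) {x x' t' : ℝ}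
    {v v' : Chain} (hnext : NextVotes S R j n p (some v) x) (hsoft : SoftVotes S R j n p v' x')
    (hq' : SoftQuorum S R h' t' n p v') : v = v' := by
  rcases hnext.softQuorum_or_startVal with hq | ⟨s, hs, hx, -, hbot, hval⟩
  · exact F.softQuorum_unique hj.1 hh' hq hq'
  have hv := F.adm.prevNext_of_startVal hj hs hval
  obtain ⟨s', hs', hx', ⟨hfresh, -⟩ | ⟨-, hv'⟩⟩ := F.adm.softVotes_cases hj hsoft
  · obtain rfl := WithTop.coe_inj.1 (hs.symm.trans hs')
    rcases hfresh with rfl | hbot'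
    · exact absurd hv not_prevNext_zero
    · exact absurd (hbot'.mono (by linarith [F.Δ_pos])) hbot
  · exact hU j hj.1 j hj.1 _ _ _ _ hv hv'

theorem InheritsUnique.eq_of_nextQuorum_of_softQuorum {n p : ℕ} (hU : InheritsUnique S R n p)
    (F : Fair S O R) {h h' : Node} (hh : h ∈ S.honest) (hh' : h' ∈ S.honest) {t t' : ℝ}
    {v v' : Chain} (hq : NextQuorum S R h t n p (some v)) (hq' : SoftQuorum S R h' t' n p v') :
    v = v' := by
  obtain ⟨j, hj, ⟨x, -, -, hnext⟩, ⟨x', -, -, hsoft⟩⟩ :=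
    F.exists_common_caster hh hh' (fun _ => rfl) (fun _ => rfl) hq hq'
  exact hU.eq_of_nextVotes_of_softVotes F hj hh' hnext hsoft hq'

theorem InheritsUnique.eq_of_nextQuorums {n p : ℕ} (hU : InheritsUnique S R n p) (F : Fair S O R)
    {h h' : Node} (hh : h ∈ S.honest) (hh' : h' ∈ S.honest) {t t' : ℝ} {v v' : Chain}
    (hq : NextQuorum S R h t n p (some v)) (hq' : NextQuorum S R h' t' n p (some v')) :
    v = v' := by
  obtain ⟨j, hj, ⟨x, -, -, hnext⟩, ⟨x', -, -, hnext'⟩⟩ :=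
    F.exists_common_caster hh hh' (fun _ => rfl) (fun _ => rfl) hq hq'
  rcases hnext.softQuorum_or_startVal with hsoft | ⟨-, -, -, -, -, hval⟩
  · exact (hU.eq_of_nextQuorum_of_softQuorum F hh' hj.1 hq' hsoft).symm
  rcases hnext'.softQuorum_or_startVal with hsoft' | ⟨-, -, -, -, -, hval'⟩
  · exact hU.eq_of_nextQuorum_of_softQuorum F hh hj.1 hq hsoft'
  · exact Option.some.inj (hval.symm.trans hval')

theorem Fair.inheritsUnique (F : Fair S O R) (n p : ℕ) : InheritsUnique S R n p := by
  induction p with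
  | zero => exact fun _ _ _ _ _ _ _ _ hv _ => absurd hv not_prevNext_zero
  | succ p ih =>
    exact fun h hh h' hh' t t' v v' hv hv' =>
      ih.eq_of_nextQuorums F hh hh' (prevNext_succ_iff.1 hv) (prevNext_succ_iff.1 hv')

/-- Period `p` of iteration `n` is locked on `v`: honest nodes can see quorums of next-votes for
no other value, `⊥` included. -/
def Locked (S : Setting Node) (R : Run Node) (n p : ℕ) (v : Chain) : Prop :=
  ∀ h ∈ S.honest, ∀ t w, NextQuorum S R h t n p w → w = some v

theorem Locked.eq_of_softQuorum {n p : ℕ} {v v' : Chain} (hL : Locked S R n p v)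
    (F : Fair S O R) {h : Node} (hh : h ∈ S.honest) {t : ℝ}
    (hq : SoftQuorum S R h t n (p + 1) v') : v' = v := by
  obtain ⟨i, hi, x, -, hv⟩ := F.softQuorum_voter hh hq
  obtain ⟨-, -, -, ⟨hfresh | hbot, -⟩ | ⟨-, hprev⟩⟩ := F.adm.softVotes_cases hi hv
  · exact absurd hfresh p.succ_ne_zero
  · exact absurd (hL i hi.1 x _ (prevNext_succ_iff.1 hbot)).symm (Option.some_ne_none v)
  · exact Option.some.inj (hL i hi.1 x _ (prevNext_succ_iff.1 hprev))

theorem Locked.succ {n p : ℕ} {v : Chain} (hL : Locked S R n p v) (F : Fair S O R) :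
    Locked S R n (p + 1) v := by
  intro h hh t w hq
  obtain ⟨j, hj, x, -, hnext⟩ := F.nextQuorum_voter hh hq
  cases w with
  | none => exact hL j hj.1 x _ (F.nextQuorum_none_of_nextVotes_none hj hnext)
  | some v' =>
    rcases hnext.softQuorum_or_startVal with hsoft | ⟨s, hs, -, -, -, hval⟩
    · rw [hL.eq_of_softQuorum F hj.1 hsoft]
    · exact hL j hj.1 s _ (prevNext_succ_iff.1 (F.adm.prevNext_of_startVal hj hs hval))

theorem Locked.of_le {n p q : ℕ} {v : Chain} (hL : Locked S R n p v) (F : Fair S O R)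
    (hpq : p ≤ q) : Locked S R n q v :=
  Nat.le_induction hL (fun _ _ ih => ih.succ F) q hpq

theorem Fair.locked_of_certQuorum (F : Fair S O R) {n p : ℕ} {g : Node} (hg : g ∈ S.honest)
    {x : ℝ} {v : Chain} (hc : CertQuorum S R g x n p v) : Locked S R n p v := by
  intro h hh t w hq
  obtain ⟨j, hj, ⟨z, -, -, hnext⟩, ⟨y, -, -, hcert⟩⟩ :=
    F.exists_common_caster hh hg (fun _ => rfl) (fun _ => rfl) hq hc
  cases w with
  | none => exact absurd ⟨y, hcert⟩ (hnext.not_hasCertVoted v)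
  | some v' =>
    rcases hnext.softQuorum_or_startVal with hsoft | ⟨-, -, -, hnone, -⟩
    · obtain ⟨-, s, -, -, -, hsoft'⟩ := hcert
      rw [F.softQuorum_unique hj.1 hj.1 hsoft hsoft']
    · exact absurd ⟨y, hcert⟩ (hnone v)

theorem Fair.certQuorum_unique_of_le (F : Fair S O R) {n p q : ℕ} {g h : Node}
    (hg : g ∈ S.honest) (hh : h ∈ S.honest) {x y : ℝ} {v v' : Chain}
    (hc : CertQuorum S R g x n p v) (hc' : CertQuorum S R h y n q v') (hpq : p ≤ q) : v = v' := by
  obtain ⟨i, hi, t, -, -, s, -, -, -, hq⟩ := F.certQuorum_voter hg hc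
  obtain ⟨j, hj, t', -, -, s', -, -, -, hq'⟩ := F.certQuorum_voter hh hc'
  rcases hpq.eq_or_lt with rfl | hlt
  · exact F.softQuorum_unique hi.1 hj.1 hq hq'
  · obtain ⟨q, rfl⟩ := Nat.exists_eq_add_of_lt hlt
    exact (((F.locked_of_certQuorum hg hc).of_le F (p.le_add_right q)).eq_of_softQuorum
      F hj.1 hq').symm

theorem Fair.certified_unique (F : Fair S O R) {n : ℕ} {g h : Node} (hg : g ∈ S.honest)
    (hh : h ∈ S.honest) {x y : ℝ} {v v' : Chain} (hc : Certified S R g x n v)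
    (hc' : Certified S R h y n v') : v = v' := by
  obtain ⟨p, hp⟩ := hc
  obtain ⟨q, hq⟩ := hc'
  rcases le_total p q with hpq | hqp
  · exact F.certQuorum_unique_of_le hg hh hp hq hpq
  · exact (F.certQuorum_unique_of_le hh hg hq hp hqp).symm

end Agreement

section Timeline

variable {Node : Type u} {S : Setting Node} {O : Oracle Node} {R : Run Node}

/-! ### Order of periods and iterations -/

theorem exists_eq_coe_of_le_coe {x : WithTop ℝ} {t : ℝ} (h : x ≤ (t : WithTop ℝ)) :
    ∃ s : ℝ, x = (s : WithTop ℝ) ∧ s ≤ t := by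
  lift x to ℝ using ne_top_of_le_ne_top WithTop.coe_ne_top h
  exact ⟨x, rfl, WithTop.coe_le_coe.1 h⟩

theorem ready_succ_iff {i : Node} {n q : ℕ} {t : ℝ} :
    Ready S R i n (q + 1) t ↔ ∃ w, NextQuorum S R i t n q w := by
  cases n <;> rfl

theorem Run.Admissible.ready_of_start (A : R.Admissible S O) {i : Node} (hi : i ∈ S.honestCkpts)
    {n p : ℕ} {t : ℝ} (h : R.start i n p = (t : WithTop ℝ)) : Ready S R i n p t :=
  ((A.start_rule i hi.1 hi.2 n p t).1 h).1.1

/-- Some honest checkpointer has started period `p` of iteration `n` by time `t`. -/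
def Started (S : Setting Node) (R : Run Node) (n p : ℕ) (t : ℝ) : Prop :=
  ∃ i ∈ S.honestCkpts, R.start i n p ≤ (t : WithTop ℝ)

theorem Started.mono {n p : ℕ} {t t' : ℝ} (h : Started S R n p t) (htt : t ≤ t') :
    Started S R n p t' :=
  h.imp fun _ hi => ⟨hi.1, hi.2.trans (WithTop.coe_le_coe.2 htt)⟩

theorem Started.exists_eq {n p : ℕ} {t : ℝ} (h : Started S R n p t) :
    ∃ i ∈ S.honestCkpts, ∃ s : ℝ, R.start i n p = (s : WithTop ℝ) ∧ s ≤ t :=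
  h.imp fun _ hi => ⟨hi.1, exists_eq_coe_of_le_coe hi.2⟩

theorem started_of_start_eq {i : Node} (hi : i ∈ S.honestCkpts) {n p : ℕ} {s t : ℝ}
    (hs : R.start i n p = (s : WithTop ℝ)) (hst : s ≤ t) : Started S R n p t :=
  ⟨i, hi, hs ▸ WithTop.coe_le_coe.2 hst⟩

theorem Fair.started_of_nextQuorum (F : Fair S O R) {h : Node} (hh : h ∈ S.honest) {n p : ℕ}
    {t : ℝ} {w : Option Chain} (hq : NextQuorum S R h t n p w) :
    Started S R n p (t - 4 * S.Δ) := by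
  obtain ⟨j, hj, t', ht', hnext⟩ := F.nextQuorum_voter hh hq
  obtain ⟨s, hs, hle⟩ := hnext.exists_start
  exact started_of_start_eq hj hs (by linarith)

theorem Fair.started_of_certQuorum (F : Fair S O R) {h : Node} (hh : h ∈ S.honest) {n p : ℕ}
    {t : ℝ} {v : Chain} (hq : CertQuorum S R h t n p v) : Started S R n p (t - 2 * S.Δ) := by
  obtain ⟨j, hj, t', ht', -, s, hs, hle, -⟩ := F.certQuorum_voter hh hq
  exact started_of_start_eq hj hs (by linarith)

theorem Fair.started_pred (F : Fair S O R) {n p : ℕ} {t : ℝ} (h : Started S R n (p + 1) t) :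
    Started S R n p (t - 4 * S.Δ) := by
  obtain ⟨i, hi, s, hs, hst⟩ := h.exists_eq
  obtain ⟨w, hw⟩ := ready_succ_iff.1 (F.adm.ready_of_start hi hs)
  exact (F.started_of_nextQuorum hi.1 hw).mono (by linarith)

theorem Fair.started_sub (F : Fair S O R) {n p q : ℕ} (hpq : p ≤ q) {t : ℝ}
    (h : Started S R n q t) : Started S R n p (t - 4 * S.Δ * (q - p)) := by
  induction q, hpq using Nat.le_induction generalizing t with
  | base => simpa using h
  | succ q _ ih =>
    convert ih (F.started_pred h) using 1
    push_cast
    ring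

theorem Fair.started_of_le (F : Fair S O R) {n p q : ℕ} (hpq : p ≤ q) {t : ℝ}
    (h : Started S R n q t) : Started S R n p t := by
  have hgap : (0 : ℝ) ≤ 4 * S.Δ * (q - p) :=
    mul_nonneg (by linarith [F.Δ_pos]) (sub_nonneg.2 (Nat.cast_le.2 hpq))
  exact (F.started_sub hpq h).mono (by linarith)

theorem Fair.decided_of_started_succ (F : Fair S O R) {n p : ℕ} {t : ℝ}
    (h : Started S R (n + 1) p t) : Decided S R n (t - S.e) := by
  obtain ⟨i, hi, s, hs, hst⟩ := (F.started_of_le p.zero_le h).exists_eq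
  obtain ⟨v, hv⟩ := F.adm.ready_of_start hi hs
  exact ⟨i, hi.1, v, hv.mono (by linarith)⟩

theorem Fair.decided_pred (F : Fair S O R) {n : ℕ} {t : ℝ} (h : Decided S R (n + 1) t) :
    Decided S R n (t - S.e) := by
  obtain ⟨g, hg, v, p, hc⟩ := h
  exact F.decided_of_started_succ ((F.started_of_certQuorum hg hc).mono (by linarith [F.Δ_pos]))

theorem Fair.decided_sub (F : Fair S O R) {m n : ℕ} (hmn : m ≤ n) {t : ℝ}
    (h : Decided S R n t) : Decided S R m (t - (n - m) * S.e) := by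
  induction n, hmn using Nat.le_induction generalizing t with
  | base => simpa using h
  | succ n _ ih =>
    convert ih (F.decided_pred h) using 1
    push_cast
    ring

theorem Fair.decided_of_le (F : Fair S O R) {m n : ℕ} (hmn : m ≤ n) {t : ℝ}
    (h : Decided S R n t) : Decided S R m t := by
  have hgap : (0 : ℝ) ≤ (n - m) * S.e :=
    mul_nonneg (sub_nonneg.2 (Nat.cast_le.2 hmn)) F.e_pos.le
  exact (F.decided_sub hmn h).mono (by linarith)

theorem Fair.decided_of_started_of_lt (F : Fair S O R) {n n' p : ℕ} (hn : n < n') {t : ℝ}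
    (h : Started S R n' p t) : Decided S R n t := by
  obtain ⟨d, rfl⟩ := Nat.exists_eq_add_of_lt hn
  exact F.decided_of_le (n.le_add_right d)
    ((F.decided_of_started_succ h).mono (by linarith [F.e_pos]))

theorem Fair.nonneg_of_quorum (F : Fair S O R) {h : Node} {t : ℝ} {m : Node → Msg Node}
    (hq : Quorum S fun i => Knows R h t (m i)) : 0 ≤ t := by
  obtain ⟨i, -, hk⟩ := F.supermajority.exists_of_quorum hq
  exact WithTop.coe_le_coe.1 ((F.adm.recv_nonneg h _).trans hk)

theorem Fair.decided_nonneg (F : Fair S O R) {n : ℕ} {t : ℝ} (h : Decided S R n t) : 0 ≤ t :=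
  let ⟨_, _, _, _, hc⟩ := h
  F.nonneg_of_quorum hc

theorem Fair.le_of_decided (F : Fair S O R) {n : ℕ} {t : ℝ} (h : Decided S R n t) :
    n * S.e ≤ t := by
  have hnonneg := F.decided_nonneg (F.decided_sub n.zero_le h)
  push_cast at hnonneg
  linarith

theorem Fair.le_of_started (F : Fair S O R) {n p : ℕ} {t : ℝ} (h : Started S R n p t) :
    n * S.e + 4 * S.Δ * p ≤ t := by
  obtain ⟨i, hi, s, hs, hst⟩ := (F.started_sub p.zero_le h).exists_eq
  have hfirst : n * S.e ≤ s := by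
    cases n with
    | zero =>
      have hready : 0 ≤ s := F.adm.ready_of_start hi hs
      simpa using hready
    | succ n =>
      have hdecided :=
        F.le_of_decided (F.decided_of_started_succ (started_of_start_eq hi hs le_rfl))
      push_cast
      linarith
  push_cast at hst
  linarith

/-! ### Existence of starting times -/

theorem isClosed_setOf_knows (h : Node) (m : Msg Node) : IsClosed {t : ℝ | Knows R h t m} := by
  unfold Knows
  cases R.recv h m with
  | top => simp
  | coe x =>
    simp only [WithTop.coe_le_coe]
    exact isClosed_Ici

theorem isClosed_setOf_quorum {X : Type*} [TopologicalSpace X] {Q : Node → X → Prop}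
    (hQ : ∀ i, IsClosed {x | Q i x}) : IsClosed {x | Quorum S (Q · x)} := by
  classical
  have hunion : {x | Quorum S (Q · x)} =
      ⋃ J ∈ S.ckpt.powerset.filter (2 * S.ckpt.card ≤ 3 * ·.card), ⋂ i ∈ J, {x | Q i x} := by
    ext x
    simp only [Quorum, Set.mem_ofPred_eq, Set.mem_iUnion, Finset.mem_filter,
      Finset.mem_powerset, Set.mem_iInter, exists_prop]
    refine ⟨fun hq => ⟨S.ckpt.filter (Q · x), ⟨Finset.filter_subset _ _, by convert hq⟩,
      fun i hi => (Finset.mem_filter.1 hi).2⟩, ?_⟩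
    rintro ⟨J, ⟨hJ, hcard⟩, hk⟩
    exact hcard.trans (Nat.mul_le_mul_left 3
      (Finset.card_le_card fun i hi => Finset.mem_filter.2 ⟨hJ hi, hk i hi⟩))
  rw [hunion]
  exact isClosed_biUnion_finset fun J _ => isClosed_biInter fun i _ => hQ i

theorem isClosed_setOf_exists_of_unique {X α : Type*} [TopologicalSpace X] {P : α → X → Prop}
    (hP : ∀ a, IsClosed {x | P a x}) (huniq : ∀ a b x y, P a x → P b y → a = b) :
    IsClosed {x | ∃ a, P a x} := by
  rcases {x | ∃ a, P a x}.eq_empty_or_nonempty with hempty | ⟨x, a, hax⟩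
  · rw [hempty]
    exact isClosed_empty
  · convert hP a using 3 with y
    exact ⟨fun ⟨b, hb⟩ => huniq b a y x hb hax ▸ hb, fun ha => ⟨a, ha⟩⟩

theorem Fair.mul_lt_of_certQuorum (F : Fair S O R) {i : Node} (hi : i ∈ S.honest) {n p : ℕ}
    {t : ℝ} {v : Chain} (hc : CertQuorum S R i t n p v) : 4 * S.Δ * p < t := by
  have hne : 0 ≤ (n : ℝ) * S.e := mul_nonneg n.cast_nonneg F.e_pos.le
  linarith [F.le_of_started (F.started_of_certQuorum hi hc), F.Δ_pos]

theorem Fair.isClosed_setOf_certified (F : Fair S O R) {i : Node} (hi : i ∈ S.honest) (n : ℕ) :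
    IsClosed {t : ℝ | ∃ v, Certified S R i t n v} := by
  have hunion : {t : ℝ | ∃ v, Certified S R i t n v} =
      ⋃ p : ℕ, {t : ℝ | ∃ v, CertQuorum S R i t n p v} := by
    ext t
    simp only [Set.mem_ofPred_eq, Set.mem_iUnion, Certified]
    exact exists_comm
  rw [hunion]
  refine LocallyFinite.isClosed_iUnion (fun x => ⟨Set.Iio (x + 1), Iio_mem_nhds (by linarith),
    ?_⟩) fun p => isClosed_setOf_exists_of_unique
      (fun v => isClosed_setOf_quorum fun j => isClosed_setOf_knows i (Msg.cert n p j v))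
      fun v v' x y hx hy => F.certified_unique hi hi ⟨p, hx⟩ ⟨p, hy⟩
  have hΔ : 0 < 4 * S.Δ := by linarith [F.Δ_pos]
  refine (Set.finite_lt_nat ⌈(x + 1) / (4 * S.Δ)⌉₊).subset ?_
  rintro p ⟨t, ⟨v, hv⟩, ht⟩
  refine Nat.lt_ceil.2 ((lt_div_iff₀' hΔ).2 ?_)
  exact (F.mul_lt_of_certQuorum hi hv).trans ht

theorem Fair.isClosed_setOf_ready (F : Fair S O R) {i : Node} (hi : i ∈ S.honest) (n p : ℕ) :
    IsClosed {t : ℝ | Ready S R i n p t} := by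
  cases p with
  | zero =>
    cases n with
    | zero => exact isClosed_Ici
    | succ n =>
      exact (F.isClosed_setOf_certified hi n).preimage (continuous_id.sub continuous_const)
  | succ q =>
    have hcases : {t : ℝ | Ready S R i n (q + 1) t} =
        {t | NextQuorum S R i t n q none} ∪ {t | ∃ v, NextQuorum S R i t n q (some v)} := by
      ext t
      simp only [Set.mem_ofPred_eq, ready_succ_iff, Set.mem_union, Option.exists]
    have hclosed (w : Option Chain) : IsClosed {t | NextQuorum S R i t n q w} :=
      isClosed_setOf_quorum fun j => isClosed_setOf_knows i (Msg.next n q j w)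
    rw [hcases]
    exact (hclosed none).union (isClosed_setOf_exists_of_unique (fun v => hclosed (some v))
      fun v v' x y hx hy => (F.inheritsUnique n q).eq_of_nextQuorums F hi hi hx hy)

theorem Fair.ready_nonneg (F : Fair S O R) {i : Node} {n p : ℕ} {t : ℝ}
    (h : Ready S R i n p t) : 0 ≤ t := by
  cases p with
  | zero =>
    cases n with
    | zero => exact h
    | succ n =>
      obtain ⟨v, p, hc⟩ := h
      linarith [F.nonneg_of_quorum hc, F.e_pos]
  | succ q =>
    obtain ⟨w, hw⟩ := ready_succ_iff.1 h
    exact F.nonneg_of_quorum hw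

theorem Fair.exists_start_of_ready (F : Fair S O R) {i : Node} (hi : i ∈ S.honestCkpts)
    {n p : ℕ} {x : ℝ} (hr : Ready S R i n p x) (hd : ¬ Decided S R n x) :
    ∃ p' ≥ p, R.start i n p' ≤ (x : WithTop ℝ) := by
  have hleast := (F.isClosed_setOf_ready hi.1 n p).isLeast_csInf ⟨x, hr⟩
    ⟨0, fun t ht => F.ready_nonneg ht⟩
  set t := sInf {t : ℝ | Ready S R i n p t}
  have htx : t ≤ x := hleast.2 hr
  by_cases hlater : ∃ n' p', Later n p n' p' ∧ R.start i n' p' ≤ (t : WithTop ℝ)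
  · obtain ⟨n', p', hl | ⟨rfl, hl⟩, hs⟩ := hlater
    · exact absurd ((F.decided_of_started_of_lt hl ⟨i, hi, hs⟩).mono htx) hd
    · exact ⟨p', hl.le, hs.trans (WithTop.coe_le_coe.2 htx)⟩
  · push Not at hlater
    have hs : R.start i n p = (t : WithTop ℝ) := (F.adm.start_rule i hi.1 hi.2 n p t).2
      ⟨hleast, fun n' p' hl => not_le.2 (hlater n' p' hl),
        fun ⟨y, hy, v, hv⟩ => hd ⟨i, hi.1, v, hv.mono (hy.le.trans htx)⟩⟩
    exact ⟨p, le_rfl, hs ▸ WithTop.coe_le_coe.2 htx⟩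

theorem Fair.start_le_of_ready (F : Fair S O R) {i : Node} (hi : i ∈ S.honestCkpts)
    {n p : ℕ} {x : ℝ} (hr : Ready S R i n p x) (hd : ¬ Decided S R n x)
    (hnext : ¬ Started S R n (p + 1) x) : R.start i n p ≤ (x : WithTop ℝ) := by
  obtain ⟨p', hp', hs⟩ := F.exists_start_of_ready hi hr hd
  rcases hp'.eq_or_lt with rfl | hlt
  · exact hs
  · exact absurd (F.started_of_le hlt ⟨i, hi, hs⟩) hnext

theorem Fair.inPeriod_of_not_started (F : Fair S O R) {i : Node} (hi : i ∈ S.honestCkpts)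
    {n p : ℕ} {t : ℝ} (hs : R.start i n p ≤ (t : WithTop ℝ)) (hd : ¬ Decided S R n t)
    (hnext : ∀ z < t, ¬ Started S R n (p + 1) z) : InPeriod S R i n p t := by
  refine ⟨hs, ?_, ?_⟩
  · rintro n' p' (hl | ⟨rfl, hl⟩) hlt
    · exact hd (F.decided_of_started_of_lt hl ⟨i, hi, hlt.le⟩)
    · obtain ⟨s', hs', -⟩ := exists_eq_coe_of_le_coe hlt.le
      exact hnext s' (WithTop.coe_lt_coe.1 (hs' ▸ hlt))
        (F.started_of_le hl (started_of_start_eq hi hs' le_rfl))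
  · rintro ⟨y, hy, v, hv⟩
    exact hd ⟨i, hi.1, v, hv.mono hy.le⟩

end Timeline

section Periods

variable {Node : Type u} {S : Setting Node} {O : Oracle Node} {R : Run Node}

/-! ### Duration of periods after stabilization -/

/-- All honest checkpointers have started period `p` of iteration `n` by time `x`, and none of
them leaves it before time `y`. -/
structure Gathered (S : Setting Node) (R : Run Node) (n p : ℕ) (x y : ℝ) : Prop where
  start_le : ∀ i ∈ S.honestCkpts, R.start i n p ≤ (x : WithTop ℝ)
  not_started_succ : ∀ z < y, ¬ Started S R n (p + 1) z
  not_decided : ¬ Decided S R n y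

theorem Gathered.exists_start {n p : ℕ} {x y : ℝ} (G : Gathered S R n p x y) {i : Node}
    (hi : i ∈ S.honestCkpts) : ∃ s : ℝ, R.start i n p = (s : WithTop ℝ) ∧ s ≤ x :=
  exists_eq_coe_of_le_coe (G.start_le i hi)

theorem Gathered.inPeriod {n p : ℕ} {x y : ℝ} (G : Gathered S R n p x y) (F : Fair S O R)
    {i : Node} (hi : i ∈ S.honestCkpts) {t : ℝ} (hs : R.start i n p ≤ (t : WithTop ℝ))
    (hty : t ≤ y) : InPeriod S R i n p t :=
  F.inPeriod_of_not_started hi hs (fun hd => G.not_decided (hd.mono hty))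
    fun z hz => G.not_started_succ z (hz.trans_le hty)

theorem Fair.startVal_of_not_prevNext_none (F : Fair S O R) {i : Node} (hi : i ∈ S.honestCkpts)
    {n p : ℕ} {s t : ℝ} (hs : R.start i n (p + 1) = (s : WithTop ℝ)) (hst : s ≤ t)
    (hbot : ¬ PrevNext S R i t n (p + 1) none) :
    ∃ v, R.startVal i n (p + 1) = some v ∧ PrevNext S R i s n (p + 1) (some v) := by
  cases hv : R.startVal i n (p + 1) with
  | none =>
    have hquorum := (F.adm.startVal_rule i hi.1 hi.2 n (p + 1) s hs).2 p rfl
    exact absurd (prevNext_succ_iff.2 ((hv ▸ hquorum).mono hst)) hbot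
  | some v => exact ⟨v, rfl, F.adm.prevNext_of_startVal hi hs hv⟩

theorem Fair.startVal_eq_of_not_prevNext_none (F : Fair S O R) {i j : Node}
    (hi : i ∈ S.honestCkpts) (hj : j ∈ S.honestCkpts) {n p : ℕ} {s s' t : ℝ}
    (hs : R.start i n p = (s : WithTop ℝ)) (hs' : R.start j n p = (s' : WithTop ℝ)) (hst : s ≤ t)
    (hst' : s' ≤ t) (hbot : ¬ PrevNext S R i t n p none) (hbot' : ¬ PrevNext S R j t n p none) :
    R.startVal i n p = R.startVal j n p := by
  cases p with
  | zero =>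
    rw [(F.adm.startVal_rule i hi.1 hi.2 n 0 s hs).1 rfl,
      (F.adm.startVal_rule j hj.1 hj.2 n 0 s' hs').1 rfl]
  | succ q =>
    obtain ⟨v, hv, hprev⟩ := F.startVal_of_not_prevNext_none hi hs hst hbot
    obtain ⟨v', hv', hprev'⟩ := F.startVal_of_not_prevNext_none hj hs' hst' hbot'
    rw [hv, hv', F.inheritsUnique n (q + 1) i hi.1 j hj.1 _ _ _ _ hprev hprev']

theorem Gathered.nextVotes_of_hasCertVoted {n p : ℕ} {x y : ℝ} (G : Gathered S R n p x y)
    (F : Fair S O R) (hx : R.gst ≤ x) (hxy : x + 5 * S.Δ ≤ y) {i j : Node}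
    (hi : i ∈ S.honestCkpts) (hj : j ∈ S.honestCkpts) {v : Chain} (hv : HasCertVoted S R i n p v) :
    NextVotes S R j n p (some v) (x + 5 * S.Δ) := by
  have hΔ := F.Δ_pos
  obtain ⟨t, -, s, hs, -, ht, hq⟩ := hv
  obtain ⟨s', hs', hsx⟩ := G.exists_start hi
  obtain rfl := WithTop.coe_inj.1 (hs.symm.trans hs')
  obtain ⟨sj, hsj, hsjx⟩ := G.exists_start hj
  refine ⟨G.inPeriod F hj (hsj ▸ WithTop.coe_le_coe.2 (by linarith)) hxy, sj, hsj,
    Or.inr ⟨by linarith, Or.inl ⟨v, ?_, rfl⟩⟩⟩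
  exact hq.relay F.adm hi.1 hj.1 (by linarith) (by linarith)

theorem Gathered.nextVotes_none {n p : ℕ} {x y : ℝ} (G : Gathered S R n p x y) (F : Fair S O R)
    (hx : R.gst ≤ x) (hxy : x + 5 * S.Δ ≤ y) {i j : Node} (hi : i ∈ S.honestCkpts)
    (hj : j ∈ S.honestCkpts) (hbot : PrevNext S R i (x + 4 * S.Δ) n p none)
    (hcert : ∀ v, ¬ HasCertVoted S R j n p v) : NextVotes S R j n p none (x + 5 * S.Δ) := by
  have hΔ := F.Δ_pos
  obtain ⟨s, hs, hsx⟩ := G.exists_start hj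
  refine ⟨G.inPeriod F hj (hs ▸ WithTop.coe_le_coe.2 (by linarith)) hxy, s, hs,
    Or.inr ⟨by linarith, Or.inr ⟨?_, hcert, rfl⟩⟩⟩
  exact hbot.relay F.adm hi.1 hj.1 (by linarith) (by linarith)

theorem Gathered.nextVotes_startVal {n p : ℕ} {x y : ℝ} (G : Gathered S R n p x y)
    (F : Fair S O R) (hxy : x + 4 * S.Δ ≤ y) {j : Node} (hj : j ∈ S.honestCkpts)
    (hbot : ¬ PrevNext S R j (x + 4 * S.Δ) n p none) (hcert : ∀ v, ¬ HasCertVoted S R j n p v) :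
    ∃ t ≤ x + 4 * S.Δ, NextVotes S R j n p (R.startVal j n p) t := by
  obtain ⟨s, hs, hsx⟩ := G.exists_start hj
  have hle : s + 4 * S.Δ ≤ x + 4 * S.Δ := by linarith
  exact ⟨s + 4 * S.Δ, hle, G.inPeriod F hj (hs ▸ WithTop.coe_le_coe.2 (by linarith [F.Δ_pos]))
    (hle.trans hxy), s, hs,
    Or.inl ⟨rfl, Or.inr (Or.inr ⟨hcert, fun h => hbot (h.mono hle), rfl⟩)⟩⟩

theorem Gathered.exists_common_nextVote {n p : ℕ} {x y : ℝ} (G : Gathered S R n p x y)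
    (F : Fair S O R) (hx : R.gst ≤ x) (hxy : x + 5 * S.Δ ≤ y) :
    ∃ w, ∀ j ∈ S.honestCkpts, ∃ t ≤ x + 5 * S.Δ, NextVotes S R j n p w t := by
  have hΔ := F.Δ_pos
  by_cases hcert : ∃ i ∈ S.honestCkpts, ∃ v, HasCertVoted S R i n p v
  · obtain ⟨i, hi, v, hv⟩ := hcert
    exact ⟨some v, fun j hj => ⟨_, le_rfl, G.nextVotes_of_hasCertVoted F hx hxy hi hj hv⟩⟩
  push Not at hcert
  by_cases hbot : ∃ i ∈ S.honestCkpts, PrevNext S R i (x + 4 * S.Δ) n p none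
  · obtain ⟨i, hi, hbot⟩ := hbot
    exact ⟨none, fun j hj => ⟨_, le_rfl, G.nextVotes_none F hx hxy hi hj hbot (hcert j hj)⟩⟩
  push Not at hbot
  obtain ⟨i, hi⟩ := F.supermajority.nonempty
  obtain ⟨s, hs, hsx⟩ := G.exists_start hi
  refine ⟨R.startVal i n p, fun j hj => ?_⟩
  obtain ⟨s', hs', hsx'⟩ := G.exists_start hj
  rw [F.startVal_eq_of_not_prevNext_none hi hj hs hs' (by linarith) (by linarith) (hbot i hi)
    (hbot j hj)]
  exact (G.nextVotes_startVal F (by linarith) hj (hbot j hj) (hcert j hj)).imp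
    fun t ht => ⟨by linarith [ht.1], ht.2⟩

theorem Fair.started_succ_of_nextVotes (F : Fair S O R) {n p : ℕ} {z : ℝ} {w : Option Chain}
    (hz : R.gst ≤ z) (hw : ∀ j ∈ S.honestCkpts, ∃ t ≤ z, NextVotes S R j n p w t)
    (hd : ¬ Decided S R n (z + S.Δ)) : Started S R n (p + 1) (z + S.Δ) := by
  obtain ⟨i, hi⟩ := F.supermajority.nonempty
  have hq : NextQuorum S R i (z + S.Δ) n p w := by
    refine F.supermajority.quorum_of_forall fun j hj => ?_
    obtain ⟨t, ht, hnext⟩ := hw j hj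
    exact (F.adm.own_messages j hj.1 hj.2 t (Msg.next n p j w) ⟨rfl, hnext⟩).relay F.adm hj.1 hi.1
      (by linarith) (by linarith)
  obtain ⟨p', hp', hs⟩ := F.exists_start_of_ready hi (ready_succ_iff.2 ⟨w, hq⟩) hd
  exact F.started_of_le hp' ⟨i, hi, hs⟩

theorem Fair.ready_of_started_succ (F : Fair S O R) {n q : ℕ} {x : ℝ}
    (h : Started S R n (q + 1) x) (hx : R.gst ≤ x) {i : Node} (hi : i ∈ S.honest) :
    Ready S R i n (q + 1) (x + S.Δ) := by
  obtain ⟨j, hj, s, hs, hsx⟩ := h.exists_eq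
  obtain ⟨w, hw⟩ := ready_succ_iff.1 (F.adm.ready_of_start hj hs)
  exact ready_succ_iff.2 ⟨w, hw.relay F.adm hj.1 hi (by linarith) (by linarith)⟩

theorem ready_zero_mono {i : Node} {n : ℕ} {t t' : ℝ} (h : Ready S R i n 0 t) (htt : t ≤ t') :
    Ready S R i n 0 t' := by
  cases n with
  | zero => exact le_trans (α := ℝ) h htt
  | succ n => exact h.imp fun v hv => hv.mono (by linarith)

theorem Fair.gathered_of_ready (F : Fair S O R) {n p : ℕ} {x y : ℝ} (hxy : x < y)
    (hr : ∀ i ∈ S.honestCkpts, Ready S R i n p x) (hnext : ∀ z < y, ¬ Started S R n (p + 1) z)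
    (hd : ¬ Decided S R n y) : Gathered S R n p x y where
  start_le i hi := F.start_le_of_ready hi (hr i hi) (fun h => hd (h.mono hxy.le)) (hnext x hxy)
  not_started_succ := hnext
  not_decided := hd

theorem Fair.started_succ (F : Fair S O R) {n p : ℕ} {x : ℝ} (hx : R.gst ≤ x)
    (hready : ∀ i ∈ S.honestCkpts, Ready S R i n 0 x) (hs : Started S R n p x)
    (hd : ¬ Decided S R n (x + 7 * S.Δ)) : Started S R n (p + 1) (x + 7 * S.Δ) := by
  have hΔ := F.Δ_pos
  by_contra hnext
  have hr : ∀ i ∈ S.honestCkpts, Ready S R i n p (x + S.Δ) := by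
    intro i hi
    cases p with
    | zero => exact ready_zero_mono (hready i hi) (by linarith)
    | succ q => exact F.ready_of_started_succ hs hx hi.1
  have G : Gathered S R n p (x + S.Δ) (x + 7 * S.Δ) :=
    F.gathered_of_ready (by linarith) hr (fun z hz h => hnext (h.mono hz.le)) hd
  obtain ⟨w, hw⟩ := G.exists_common_nextVote F (by linarith) (by linarith)
  exact hnext ((F.started_succ_of_nextVotes (by linarith) hw
    fun h => hd (h.mono (by linarith))).mono (by linarith))

theorem Fair.started_add (F : Fair S O R) {n p : ℕ} {x : ℝ} (hx : R.gst ≤ x)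
    (hready : ∀ i ∈ S.honestCkpts, Ready S R i n 0 x) (hs : Started S R n p x) (d : ℕ)
    (hd : ¬ Decided S R n (x + 7 * S.Δ * d)) : Started S R n (p + d) (x + 7 * S.Δ * d) := by
  have hΔ := F.Δ_pos
  induction d with
  | zero => simpa using hs
  | succ d ih =>
    have hgap : 0 ≤ 7 * S.Δ * (d : ℝ) := by positivity
    have hstep : x + 7 * S.Δ * ((d + 1 : ℕ) : ℝ) = x + 7 * S.Δ * d + 7 * S.Δ := by
      push_cast
      ring
    rw [hstep] at hd ⊢
    exact F.started_succ (by linarith) (fun i hi => ready_zero_mono (hready i hi) (by linarith))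
      (ih fun h => hd (h.mono (by linarith))) hd

/-! ### Periods with an honest leader -/

theorem Started.exists_isLeast {n p : ℕ} {t : ℝ} (h : Started S R n p t) :
    ∃ s, IsLeast {y | Started S R n p y} s := by
  classical
  obtain ⟨i, hi, hit⟩ := h
  obtain ⟨j, hj, hmin⟩ := Finset.exists_min_image (S.ckpt.filter (· ∈ S.honest))
    (R.start · n p) ⟨i, Finset.mem_filter.2 ⟨hi.2, hi.1⟩⟩
  rw [Finset.mem_filter] at hj
  obtain ⟨s, hs, -⟩ := exists_eq_coe_of_le_coe
    ((hmin i (Finset.mem_filter.2 ⟨hi.2, hi.1⟩)).trans hit)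
  refine ⟨s, started_of_start_eq ⟨hj.2, hj.1⟩ hs le_rfl, ?_⟩
  rintro y ⟨l, hl, hly⟩
  exact WithTop.coe_le_coe.1 (hs ▸ (hmin l (Finset.mem_filter.2 ⟨hl.2, hl.1⟩)).trans hly)

theorem Fair.gathered_of_isLeast (F : Fair S O R) {n q : ℕ} {s : ℝ}
    (hs : IsLeast {y | Started S R n (q + 1) y} s) (hgst : R.gst ≤ s)
    (hd : ¬ Decided S R n (s + 4 * S.Δ)) :
    Gathered S R n (q + 1) (s + S.Δ) (s + 4 * S.Δ) :=
  F.gathered_of_ready (by linarith [F.Δ_pos]) (fun _ hi => F.ready_of_started_succ hs.1 hgst hi.1)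
    (fun z hz h => by linarith [hs.2 (F.started_pred h)]) hd

theorem Run.Admissible.proposal_cases (A : R.Admissible S O) {i : Node} (hi : i ∈ S.honest)
    {n p : ℕ} (hl : O.leader n p ∈ S.honest) {s t : ℝ} {v : Chain}
    (hs : R.start (O.leader n p) n p = (s : WithTop ℝ))
    (hk : Knows R i t (Msg.proposal n p (O.leader n p) v)) :
    (Fresh S R (O.leader n p) s n p ∧ v = R.chain (O.leader n p) s) ∨
      (¬ Fresh S R (O.leader n p) s n p ∧ PrevNext S R (O.leader n p) s n p (some v)) := by
  obtain ⟨-, t', -, -, -, hs', hcases⟩ := A.unforgeable i hi _ hl _ _ rfl hk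
  obtain rfl := WithTop.coe_inj.1 (hs.symm.trans hs')
  exact hcases

theorem Fair.softVotes_eq_of_leader_not_fresh (F : Fair S O R) {n p : ℕ}
    (hl : O.leader n p ∈ S.honest) {s : ℝ} {v : Chain}
    (hs : R.start (O.leader n p) n p = (s : WithTop ℝ))
    (hfresh : ¬ Fresh S R (O.leader n p) s n p)
    (hv : PrevNext S R (O.leader n p) s n p (some v)) {i : Node} (hi : i ∈ S.honestCkpts)
    {t : ℝ} {v' : Chain} (hv' : SoftVotes S R i n p v' t) : v' = v := by
  obtain ⟨-, -, -, ⟨-, hk, -⟩ | ⟨-, hprev⟩⟩ := F.adm.softVotes_cases hi hv'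
  · rcases F.adm.proposal_cases hi.1 hl hs hk with ⟨hf, -⟩ | ⟨-, hprev⟩
    · exact absurd hf hfresh
    · exact F.inheritsUnique n p _ hl _ hl _ _ _ _ hprev hv
  · exact F.inheritsUnique n p _ hi.1 _ hl _ _ _ _ hprev hv

theorem Run.Admissible.exists_softVote (A : R.Admissible S O) {i : Node}
    (hi : i ∈ S.honestCkpts) {n p : ℕ} {s : ℝ} {v : Chain}
    (hs : R.start i n p = (s : WithTop ℝ)) (hv : SoftEligible S O R i n p v) :
    ∃ v', SoftVotes S R i n p v' (s + 2 * S.Δ) := by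
  cases hv' : R.softVal i n p with
  | none => exact absurd hv ((A.softVal_rule i hi.1 hi.2 n p).2 hv' v)
  | some v' => exact ⟨v', s, hs, rfl, hv'⟩

theorem Fair.softVotes_of_leader_not_fresh (F : Fair S O R) {n q : ℕ} {s sl : ℝ} {v : Chain}
    (hgst : R.gst ≤ s) (hs : IsLeast {y | Started S R n (q + 1) y} s)
    (hd : ¬ Decided S R n (s + 4 * S.Δ)) (hl : O.leader n (q + 1) ∈ S.honestCkpts)
    (hsl : R.start (O.leader n (q + 1)) n (q + 1) = (sl : WithTop ℝ))
    (hfresh : ¬ Fresh S R (O.leader n (q + 1)) sl n (q + 1))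
    (hv : PrevNext S R (O.leader n (q + 1)) sl n (q + 1) (some v)) {i : Node}
    (hi : i ∈ S.honestCkpts) : ∃ t ≤ s + 3 * S.Δ, SoftVotes S R i n (q + 1) v t := by
  have hΔ := F.Δ_pos
  have G := F.gathered_of_isLeast hs hgst hd
  obtain ⟨si, hsi, hsis⟩ := G.exists_start hi
  have hssi : s ≤ si := hs.2 (started_of_start_eq hi hsi le_rfl)
  have hsls : sl ≤ s + S.Δ := WithTop.coe_le_coe.1 (hsl ▸ G.start_le _ hl)
  have hproposal : Knows R i (si + 2 * S.Δ) (Msg.proposal n (q + 1) (O.leader n (q + 1)) v) :=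
    (F.adm.own_messages _ hl.1 hl.2 sl (Msg.proposal n (q + 1) (O.leader n (q + 1)) v)
      ⟨rfl, rfl, hsl, Or.inr ⟨hfresh, hv⟩⟩).relay F.adm hl.1 hi.1 (by linarith) (by linarith)
  have hprev : PrevNext S R i (si + 2 * S.Δ) n (q + 1) (some v) :=
    hv.relay F.adm hl.1 hi.1 (by linarith) (by linarith)
  have hel : SoftEligible S O R i n (q + 1) v := by
    refine ⟨si, hsi, G.inPeriod F hi (hsi ▸ WithTop.coe_le_coe.2 (by linarith)) (by linarith), ?_⟩
    by_cases hf : Fresh S R i (si + 2 * S.Δ) n (q + 1)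
    · exact Or.inl ⟨hf, hproposal, Or.inr hprev⟩
    · exact Or.inr ⟨hf, hprev⟩
  obtain ⟨v', hv'⟩ := F.adm.exists_softVote hi hsi hel
  obtain rfl := F.softVotes_eq_of_leader_not_fresh hl.1 hsl hfresh hv hi hv'
  exact ⟨si + 2 * S.Δ, by linarith, hv'⟩

theorem Fair.decided_of_softVotes (F : Fair S O R) {n q : ℕ} {s : ℝ} {v : Chain}
    (hgst : R.gst ≤ s) (hs : IsLeast {y | Started S R n (q + 1) y} s)
    (hd : ¬ Decided S R n (s + 4 * S.Δ))
    (hv : ∀ i ∈ S.honestCkpts, ∃ t ≤ s + 3 * S.Δ, SoftVotes S R i n (q + 1) v t) :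
    Decided S R n (s + 5 * S.Δ) := by
  have hΔ := F.Δ_pos
  have G := F.gathered_of_isLeast hs hgst hd
  have hcert : ∀ i ∈ S.honestCkpts, Knows R i (s + 4 * S.Δ) (Msg.cert n (q + 1) i v) := by
    intro i hi
    obtain ⟨si, hsi, hsis⟩ := G.exists_start hi
    have hssi : s ≤ si := hs.2 (started_of_start_eq hi hsi le_rfl)
    refine F.adm.own_messages i hi.1 hi.2 _ _ ⟨rfl,
      G.inPeriod F hi (hsi ▸ WithTop.coe_le_coe.2 (by linarith)) le_rfl, si, hsi, by linarith,
      by linarith, F.supermajority.quorum_of_forall fun j hj => ?_⟩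
    obtain ⟨t, ht, hvote⟩ := hv j hj
    exact (F.adm.own_messages j hj.1 hj.2 t (Msg.soft n (q + 1) j v) ⟨rfl, hvote⟩).relay F.adm
      hj.1 hi.1 (by linarith) (by linarith)
  obtain ⟨i, hi⟩ := F.supermajority.nonempty
  exact ⟨i, hi.1, v, q + 1, F.supermajority.quorum_of_forall fun j hj =>
    (hcert j hj).relay F.adm hj.1 hi.1 (by linarith) (by linarith)⟩

/-- If the leader could not propose its own chain, it would repeat the only value that has a
quorum of next-votes, and then all honest checkpointers would vote for that value. -/
theorem Fair.leader_prevNext_none (F : Fair S O R) {n q : ℕ} {s : ℝ} (hgst : R.gst ≤ s)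
    (hs : IsLeast {y | Started S R n (q + 1) y} s) (hd : ¬ Decided S R n (s + 5 * S.Δ))
    (hl : O.leader n (q + 1) ∈ S.honestCkpts) :
    ∃ sl : ℝ, R.start (O.leader n (q + 1)) n (q + 1) = (sl : WithTop ℝ) ∧ s ≤ sl ∧
      sl ≤ s + S.Δ ∧ PrevNext S R (O.leader n (q + 1)) sl n (q + 1) none := by
  have hd' : ¬ Decided S R n (s + 4 * S.Δ) := fun h => hd (h.mono (by linarith [F.Δ_pos]))
  obtain ⟨sl, hsl, hsls⟩ := (F.gathered_of_isLeast hs hgst hd').exists_start hl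
  refine ⟨sl, hsl, hs.2 (started_of_start_eq hl hsl le_rfl), hsls, ?_⟩
  by_contra hbot
  have hfresh : ¬ Fresh S R (O.leader n (q + 1)) sl n (q + 1) :=
    fun hf => hf.elim (Nat.succ_ne_zero q) hbot
  obtain ⟨v, -, hv⟩ := F.startVal_of_not_prevNext_none hl hsl le_rfl hbot
  exact hd (F.decided_of_softVotes hgst hs hd' fun i hi =>
    F.softVotes_of_leader_not_fresh hgst hs hd' hl hsl hfresh hv hi)

/-! ### Origin of certified values -/

theorem ValidChain.mono {t t' : ℝ} {c : Chain} (h : ValidChain O R t c) (htt : t ≤ t') :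
    ValidChain O R t' c :=
  ⟨h.1, h.2.1, fun b hb => ⟨(h.2.2 b hb).1, (h.2.2 b hb).2.imp_right fun h => h.trans htt⟩⟩

theorem Run.Admissible.validChain_chain (A : R.Admissible S O) {h : Node} (hh : h ∈ S.honest)
    {t : ℝ} (ht : 0 ≤ t) : ValidChain O R t (R.chain h t) :=
  A.recv_valid h hh t _ (A.chain_rule h hh t ht).1

theorem mem_of_ckptBlock_eq {v : Chain} {B : Block} (h : ckptBlock S v = some B) : B ∈ v :=
  List.mem_of_mem_take (i := v.length - S.k) (List.mem_of_getLast? h)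

/-- The `k`-deep block of `v` is in a chain that was held by an honest checkpointer at the start
of a period `≥ q` of iteration `n`, at least `Δ` before time `t`. -/
def Endorsed (S : Setting Node) (O : Oracle Node) (R : Run Node) (n q : ℕ) (t : ℝ) (v : Chain) :
    Prop :=
  ∀ B, ckptBlock S v = some B → ∃ i ∈ S.honestCkpts, ∃ p ≥ q, ∃ s : ℝ,
    R.start i n p = (s : WithTop ℝ) ∧ s + S.Δ ≤ t ∧ B ∈ R.chain i s ∧
      ValidChain O R (s + 2 * S.Δ) v

theorem Endorsed.mono {n q : ℕ} {t t' : ℝ} {v : Chain} (h : Endorsed S O R n q t v)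
    (htt : t ≤ t') : Endorsed S O R n q t' v := by
  intro B hB
  obtain ⟨i, hi, p, hp, s, hs, hle, hv⟩ := h B hB
  exact ⟨i, hi, p, hp, s, hs, hle.trans htt, hv⟩

/-- Every value that is soft-voted by an honest checkpointer or next-voted by a quorum in period
`p` of iteration `n` has been endorsed in a period `≥ q`. -/
structure EndorsesVotes (S : Setting Node) (O : Oracle Node) (R : Run Node) (n q p : ℕ) :
    Prop where
  soft : ∀ j ∈ S.honestCkpts, ∀ t v, SoftVotes S R j n p v t → Endorsed S O R n q t v
  next : ∀ h ∈ S.honest, ∀ t v, NextQuorum S R h t n p (some v) → Endorsed S O R n q t v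

theorem Fair.endorsesVotes_of_softVotes (F : Fair S O R) {n q p : ℕ}
    (hsoft : ∀ j ∈ S.honestCkpts, ∀ t v, SoftVotes S R j n p v t → Endorsed S O R n q t v)
    (hstart : ∀ j ∈ S.honestCkpts, ∀ s : ℝ, R.start j n p = (s : WithTop ℝ) → ∀ v,
      R.startVal j n p = some v → PrevNext S R j (s + 4 * S.Δ) n p none ∨
        Endorsed S O R n q s v) :
    EndorsesVotes S O R n q p where
  soft := hsoft
  next h hh t v hq := by
    obtain ⟨j, hj, t', ht', hnext⟩ := F.nextQuorum_voter hh hq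
    rcases hnext.softQuorum_or_startVal with hq' | ⟨s, hs, rfl, -, hbot, hv⟩
    · obtain ⟨i, hi, t'', ht'', hvote⟩ := F.softQuorum_voter hj.1 hq'
      exact (hsoft i hi t'' v hvote).mono (ht''.trans ht')
    · rcases hstart j hj s hs v hv with hbot' | hend
      · exact absurd hbot' hbot
      · exact hend.mono (by linarith [F.Δ_pos])

theorem Fair.endorsed_of_softVotes (F : Fair S O R) {n q p : ℕ} (hqp : q ≤ p) {j : Node}
    (hj : j ∈ S.honestCkpts) {t : ℝ} {v : Chain} (hv : SoftVotes S R j n p v t)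
    (hprev : PrevNext S R j t n p (some v) → Endorsed S O R n q t v) : Endorsed S O R n q t v := by
  obtain ⟨s, hs, rfl, ⟨-, hk, ⟨⟨B', hB', hmem⟩, -⟩ | h⟩ | ⟨-, h⟩⟩ := F.adm.softVotes_cases hj hv
  · intro B hB
    obtain rfl := Option.some.inj (hB.symm.trans hB')
    exact ⟨j, hj, p, hqp, s, hs, by linarith [F.Δ_pos], hmem,
      F.adm.recv_valid j hj.1 _ v ⟨_, hk, rfl⟩⟩
  · exact hprev h
  · exact hprev h

theorem Fair.endorsesVotes_zero (F : Fair S O R) (n : ℕ) : EndorsesVotes S O R n 0 0 := by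
  refine F.endorsesVotes_of_softVotes (fun j hj t v hv =>
    F.endorsed_of_softVotes le_rfl hj hv fun h => absurd h not_prevNext_zero) ?_
  intro j hj s hs v hv
  exact absurd (F.adm.prevNext_of_startVal hj hs hv) not_prevNext_zero

theorem EndorsesVotes.succ {n q p : ℕ} (E : EndorsesVotes S O R n q p) (F : Fair S O R)
    (hqp : q ≤ p) : EndorsesVotes S O R n q (p + 1) :=
  F.endorsesVotes_of_softVotes
    (fun j hj t v hv => F.endorsed_of_softVotes (hqp.trans p.le_succ) hj hv
      fun h => E.next j hj.1 t v (prevNext_succ_iff.1 h))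
    fun j hj s hs v hv =>
      Or.inr (E.next j hj.1 s v (prevNext_succ_iff.1 (F.adm.prevNext_of_startVal hj hs hv)))

theorem EndorsesVotes.of_le {n q p : ℕ} (E : EndorsesVotes S O R n q q) (F : Fair S O R)
    (hqp : q ≤ p) : EndorsesVotes S O R n q p :=
  Nat.le_induction E (fun _ hp ih => ih.succ F hp) p hqp

theorem EndorsesVotes.endorsed {n q p : ℕ} (E : EndorsesVotes S O R n q p) (F : Fair S O R)
    {g : Node} (hg : g ∈ S.honest) {t : ℝ} {v : Chain} (hc : CertQuorum S R g t n p v) :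
    Endorsed S O R n q t v := by
  obtain ⟨j, hj, t', ht', -, s, -, -, -, hq⟩ := F.certQuorum_voter hg hc
  obtain ⟨i, hi, t'', ht'', hv⟩ := F.softQuorum_voter hj.1 hq
  exact (E.soft i hi t'' v hv).mono (ht''.trans ht')

theorem Fair.endorsed_of_certified (F : Fair S O R) {n : ℕ} {g : Node} (hg : g ∈ S.honest)
    {t : ℝ} {v : Chain} (hc : Certified S R g t n v) : Endorsed S O R n 0 t v :=
  let ⟨p, hp⟩ := hc
  ((F.endorsesVotes_zero n).of_le F p.zero_le).endorsed F hg hp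

theorem Fair.endorsesVotes_of_honest_leader (F : Fair S O R) {n q : ℕ} {s sl : ℝ}
    (hgst : R.gst ≤ s) (hs : IsLeast {y | Started S R n (q + 1) y} s)
    (hl : O.leader n (q + 1) ∈ S.honestCkpts)
    (hsl : R.start (O.leader n (q + 1)) n (q + 1) = (sl : WithTop ℝ)) (hssl : s ≤ sl)
    (hsls : sl ≤ s + S.Δ) (hbot : PrevNext S R (O.leader n (q + 1)) sl n (q + 1) none) :
    EndorsesVotes S O R n (q + 1) (q + 1) := by
  have hΔ := F.Δ_pos
  have hbot' {i : Node} (hi : i ∈ S.honestCkpts) {s' : ℝ}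
      (hs' : R.start i n (q + 1) = (s' : WithTop ℝ)) :
      PrevNext S R i (s' + 2 * S.Δ) n (q + 1) none := by
    have hle : s ≤ s' := hs.2 (started_of_start_eq hi hs' le_rfl)
    exact hbot.relay F.adm hl.1 hi.1 (by linarith) (by linarith)
  refine F.endorsesVotes_of_softVotes (fun i hi t v hv B hB => ?_) fun i hi s' hs' v _ =>
    Or.inl ((hbot' hi hs').mono (by linarith))
  obtain ⟨s', hs', rfl, ⟨-, hk, -⟩ | ⟨hfresh, -⟩⟩ := F.adm.softVotes_cases hi hv
  · rcases F.adm.proposal_cases hi.1 hl.1 hsl hk with ⟨-, rfl⟩ | ⟨hfresh, -⟩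
    · have hle : s ≤ s' := hs.2 (started_of_start_eq hi hs' le_rfl)
      have hpos : 0 ≤ sl := by linarith [F.adm.gst_nonneg]
      exact ⟨_, hl, q + 1, le_rfl, sl, hsl, by linarith, mem_of_ckptBlock_eq hB,
        (F.adm.validChain_chain hl.1 hpos).mono (by linarith)⟩
    · exact absurd (Or.inr hbot) hfresh
  · exact absurd (Or.inr (hbot' hi hs')) hfresh

theorem Fair.endorsed_of_honest_leader (F : Fair S O R) {n q : ℕ} {s : ℝ} (hgst : R.gst ≤ s)
    (hs : IsLeast {y | Started S R n (q + 1) y} s) (hd : ¬ Decided S R n (s + 5 * S.Δ))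
    (hl : O.leader n (q + 1) ∈ S.honestCkpts) {g : Node} (hg : g ∈ S.honest) {t : ℝ} {v : Chain}
    (hc : Certified S R g t n v) : Endorsed S O R n (q + 1) t v := by
  obtain ⟨sl, hsl, hssl, hsls, hbot⟩ := F.leader_prevNext_none hgst hs hd hl
  obtain ⟨p, hp⟩ := hc
  have hqp : q + 1 ≤ p := by
    by_contra! hlt
    have hlocked := (F.locked_of_certQuorum hg hp).of_le F (Nat.lt_succ_iff.1 hlt)
    exact Option.some_ne_none v (hlocked _ hl.1 sl none (prevNext_succ_iff.1 hbot)).symm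
  exact ((F.endorsesVotes_of_honest_leader hgst hs hl hsl hssl hsls hbot).of_le F hqp).endorsed
    F hg hp

/-! ### Freshness of certified values -/

theorem exists_not_and_add_of_monotone {P : ℝ → Prop} (hP : Monotone P) {a t δ : ℝ} (hδ : 0 < δ)
    (ha : ¬ P a) (ht : P t) : ∃ y ≥ a, ¬ P y ∧ P (y + δ) := by
  by_contra! hstep
  have hnot (j : ℕ) : ¬ P (a + j * δ) := by
    induction j with
    | zero => simpa using ha
    | succ j ih =>
      have hle : a ≤ a + j * δ := le_add_of_nonneg_right (by positivity)
      convert hstep _ hle ih using 2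
      push_cast
      ring
  obtain ⟨j, hj⟩ := exists_nat_gt ((t - a) / δ)
  rw [div_lt_iff₀ hδ] at hj
  exact hnot j (hP (by linarith) ht)

theorem decided_monotone (n : ℕ) : Monotone (Decided S R n) := fun _ _ hle h => h.mono hle

theorem Fair.exists_last_started (F : Fair S O R) {n : ℕ} {y : ℝ} (h : Started S R n 0 y) :
    ∃ p, Started S R n p y ∧ ¬ Started S R n (p + 1) y := by
  by_contra! hstep
  have hall (p : ℕ) : Started S R n p y := Nat.rec h hstep p
  have hΔ : 0 < 4 * S.Δ := by linarith [F.Δ_pos]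
  obtain ⟨p, hp⟩ := exists_nat_gt (y / (4 * S.Δ))
  rw [div_lt_iff₀' hΔ] at hp
  have hne : 0 ≤ (n : ℝ) * S.e := mul_nonneg n.cast_nonneg F.e_pos.le
  linarith [F.le_of_started (hall p)]

theorem Fair.exists_isLeast_honest_leader (F : Fair S O R) {n M : ℕ} (hM : 1 ≤ M) {y : ℝ}
    (hgst : R.gst ≤ y) (hready : ∀ i ∈ S.honestCkpts, Ready S R i n 0 y)
    (hd : ¬ Decided S R n (y + 7 * S.Δ * M))
    (hlead : ∀ p : ℕ, 4 * S.Δ * p ≤ y + 7 * S.Δ * M →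
      ∃ q, p ≤ q ∧ q < p + M ∧ O.leader n q ∈ S.honestCkpts) :
    ∃ q s, O.leader n (q + 1) ∈ S.honestCkpts ∧ IsLeast {y | Started S R n (q + 1) y} s ∧
      y < s ∧ s ≤ y + 7 * S.Δ * M := by
  have hΔ := F.Δ_pos
  have hgap : 0 ≤ 7 * S.Δ * (M : ℝ) := by positivity
  obtain ⟨i, hi⟩ := F.supermajority.nonempty
  obtain ⟨p', -, hp'⟩ := F.exists_start_of_ready hi (hready i hi)
    fun h => hd (h.mono (by linarith))
  obtain ⟨p, hp, hp_succ⟩ := F.exists_last_started (F.started_of_le p'.zero_le ⟨i, hi, hp'⟩)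
  have hlate := F.started_add hgst hready hp M hd
  have hlate' := F.le_of_started (F.started_of_le (Nat.add_le_add_left hM p) hlate)
  have hne : 0 ≤ (n : ℝ) * S.e := mul_nonneg n.cast_nonneg F.e_pos.le
  obtain ⟨q, hpq, hqM, hl⟩ := hlead (p + 1) (by linarith)
  obtain ⟨q, rfl⟩ := Nat.exists_eq_succ_of_ne_zero (Nat.ne_of_gt ((Nat.succ_pos p).trans_le hpq))
  have hq := F.started_of_le (show q + 1 ≤ p + M by omega) hlate
  obtain ⟨s, hs⟩ := hq.exists_isLeast
  refine ⟨q, s, hl, hs, ?_, hs.2 hq⟩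
  by_contra! hsy
  exact hp_succ (F.started_of_le hpq (hs.1.mono hsy))

/-- While the iteration is undecided, a new honest leader shows up every `M` periods and then
every certified value stems from a chain held after its period started; apply this to the last
such leader before the decision. -/
theorem Fair.certified_fresh (F : Fair S O R) {n M : ℕ} (hM : 1 ≤ M) {σ : ℝ} (hσ : R.gst ≤ σ)
    (hready : ∀ i ∈ S.honestCkpts, Ready S R i n 0 σ) {g : Node} (hg : g ∈ S.honest) {t : ℝ}
    {v : Chain} (hc : Certified S R g t n v)
    (hlead : ∀ p : ℕ, 4 * S.Δ * p ≤ t → ∃ q, p ≤ q ∧ q < p + M ∧ O.leader n q ∈ S.honestCkpts)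
    {B : Block} (hB : ckptBlock S v = some B) :
    Decided S R n (σ + 7 * S.Δ * (M + 1)) ∨
      ∃ i ∈ S.honest, ∃ s : ℝ, σ ≤ s ∧ s + S.Δ ≤ t ∧ B ∈ R.chain i s ∧
        Decided S R n (s + 7 * S.Δ * (M + 1)) := by
  have hΔ := F.Δ_pos
  refine or_iff_not_imp_left.2 fun hdσ => ?_
  have hdt : Decided S R n t := ⟨g, hg, v, hc⟩
  obtain ⟨x, hσx, hdx, hdx'⟩ := exists_not_and_add_of_monotone (decided_monotone n) hΔ hdσ hdt
  have hxt : x < t := by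
    by_contra! htx
    exact hdx (hdt.mono htx)
  obtain ⟨q, s, hl, hs, hys, hsx⟩ := F.exists_isLeast_honest_leader
    (y := x + S.Δ - 7 * S.Δ * (M + 1)) hM (by linarith)
    (fun i hi => ready_zero_mono (hready i hi) (by linarith))
    (fun h => hdx (h.mono (by linarith))) fun p hp => hlead p (by linarith)
  obtain ⟨i, hi, p, hp, s', hs', hst, hmem, -⟩ := F.endorsed_of_honest_leader (by linarith) hs
    (fun h => hdx (h.mono (by linarith))) hl hg hc B hB
  have hss' : s ≤ s' := hs.2 (F.started_of_le hp (started_of_start_eq hi hs' le_rfl))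
  exact ⟨i, hi.1, s', by linarith, hst, hmem, hdx'.mono (by linarith)⟩

end Periods

section Positions

variable {Node : Type u} {S : Setting Node} {O : Oracle Node} {R : Run Node}

/-! ### Positions of blocks -/

theorem ValidChain.getElem?_zero {t : ℝ} {C : Chain} (h : ValidChain O R t C) :
    C[0]? = some Block.genesis := by
  rw [← List.head?_eq_getElem?, h.1]

theorem ValidChain.parent_eq {t : ℝ} {C : Chain} (h : ValidChain O R t C) {i : ℕ} {b : Block}
    (hb : C[i + 1]? = some b) : b ≠ Block.genesis ∧ C[i]? = some (R.parent b) := by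
  obtain ⟨hlt, rfl⟩ := List.getElem?_eq_some_iff.1 hb
  obtain ⟨hne, hpar⟩ := List.isChain_iff_getElem.1 h.2.1 i hlt
  exact ⟨hne, by rw [List.getElem?_eq_getElem (by omega), hpar]⟩

theorem ValidChain.take_eq_take {t t' : ℝ} {C C' : Chain} (h : ValidChain O R t C)
    (h' : ValidChain O R t' C') {i j : ℕ} {b : Block} (hb : C[i]? = some b)
    (hb' : C'[j]? = some b) : i = j ∧ C.take (i + 1) = C'.take (i + 1) := by
  induction i generalizing j b with
  | zero =>
    obtain rfl := Option.some.inj (h.getElem?_zero.symm.trans hb)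
    cases j with
    | zero => exact ⟨rfl, by simp [List.take_add_one, h.getElem?_zero, h'.getElem?_zero]⟩
    | succ j => exact absurd rfl (h'.parent_eq hb').1
  | succ i ih =>
    cases j with
    | zero =>
      obtain rfl := Option.some.inj (h'.getElem?_zero.symm.trans hb')
      exact absurd rfl (h.parent_eq hb).1
    | succ j =>
      obtain ⟨rfl, htake⟩ := ih (h.parent_eq hb).2 (h'.parent_eq hb').2
      exact ⟨rfl, by rw [List.take_add_one, List.take_add_one (l := C'), htake, hb, hb']⟩

/-- `b` is at position `i` of some blockchain. The position does not depend on the blockchain, see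
`BlockAt.unique`. -/
def BlockAt (O : Oracle Node) (R : Run Node) (b : Block) (i : ℕ) : Prop :=
  ∃ t C, ValidChain O R t C ∧ C[i]? = some b

theorem ValidChain.blockAt {t : ℝ} {C : Chain} (h : ValidChain O R t C) {i : ℕ} {b : Block}
    (hb : C[i]? = some b) : BlockAt O R b i :=
  ⟨t, C, h, hb⟩

theorem BlockAt.unique {b : Block} {i j : ℕ} (h : BlockAt O R b i) (h' : BlockAt O R b j) :
    i = j := by
  obtain ⟨t, C, hC, hb⟩ := h
  obtain ⟨t', C', hC', hb'⟩ := h'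
  exact (hC.take_eq_take hC' hb hb').1

theorem BlockAt.eq_zero_iff {b : Block} {i : ℕ} (h : BlockAt O R b i) :
    i = 0 ↔ b = Block.genesis := by
  obtain ⟨t, C, hC, hb⟩ := h
  constructor
  · rintro rfl
    exact Option.some.inj (hb.symm.trans hC.getElem?_zero)
  · rintro rfl
    exact (hC.take_eq_take hC hb hC.getElem?_zero).1

theorem Run.Admissible.pairwise_time_lt (A : R.Admissible S O) {t : ℝ} {C : Chain}
    (h : ValidChain O R t C) : C.Pairwise (fun b b' => b.time < b'.time) := by
  have : Trans (fun b b' : Block => b.time < b'.time) (fun b b' : Block => b.time < b'.time)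
      (fun b b' : Block => b.time < b'.time) := ⟨lt_trans⟩
  rw [← List.isChain_iff_pairwise]
  refine h.2.1.imp_of_mem_imp fun b b' _ hb' hbb' => ?_
  rw [← hbb'.2]
  exact (A.parent_mined b' hbb'.1 (h.2.2 b' hb').1).2

theorem Run.Admissible.time_lt (A : R.Admissible S O) {t : ℝ} {C : Chain}
    (h : ValidChain O R t C) {i j : ℕ} {b b' : Block} (hb : C[i]? = some b)
    (hb' : C[j]? = some b') (hij : i < j) : b.time < b'.time := by
  obtain ⟨hi, rfl⟩ := List.getElem?_eq_some_iff.1 hb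
  obtain ⟨hj, rfl⟩ := List.getElem?_eq_some_iff.1 hb'
  exact List.pairwise_iff_getElem.1 (A.pairwise_time_lt h) i j hi hj hij

theorem Run.Admissible.time_pos (A : R.Admissible S O) {t : ℝ} {C : Chain}
    (h : ValidChain O R t C) {b : Block} (hb : b ∈ C) (hne : b ≠ Block.genesis) : 0 < b.time := by
  obtain ⟨i, hi⟩ := List.mem_iff_getElem?.1 hb
  exact A.time_lt h h.getElem?_zero hi (Nat.pos_of_ne_zero fun h0 =>
    hne ((h.blockAt hi).eq_zero_iff.1 h0))

theorem Run.Admissible.time_nonneg (A : R.Admissible S O) {t : ℝ} {C : Chain}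
    (h : ValidChain O R t C) {b : Block} (hb : b ∈ C) : 0 ≤ b.time := by
  rcases eq_or_ne b Block.genesis with rfl | hne
  · exact le_rfl
  · exact (A.time_pos h hb hne).le

theorem Run.Admissible.mem_of_time_le (A : R.Admissible S O) {t t' : ℝ} {C C' : Chain}
    (h : ValidChain O R t C) (h' : ValidChain O R t' C') {b b' : Block} (hb : b ∈ C)
    (hb' : b ∈ C') (hbC : b' ∈ C) (hle : b'.time ≤ b.time) : b' ∈ C' := by
  obtain ⟨i, hi⟩ := List.mem_iff_getElem?.1 hb
  obtain ⟨i', hi'⟩ := List.mem_iff_getElem?.1 hb'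
  obtain ⟨j, hj⟩ := List.mem_iff_getElem?.1 hbC
  have hji : j ≤ i := by
    by_contra! hij
    exact absurd (A.time_lt h hi hj hij) hle.not_gt
  have hprefix : C.take (i + 1) <+: C' :=
    (h.take_eq_take h' hi hi').2 ▸ List.take_prefix _ _
  refine hprefix.subset (List.mem_of_getElem? (i := j) ?_)
  rw [List.getElem?_take_of_lt (by omega), hj]

/-! ### Numbers of mined blocks -/

/-- The blocks mined in the interval `(x, z]`. -/
def minedBlocks (O : Oracle Node) (x z : ℝ) : Set Block :=
  {b | b ≠ Block.genesis ∧ Mined O b ∧ b.time ∈ Set.Ioc x z}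

/-- The number of blocks mined in the interval `(x, z]`. -/
noncomputable def mined (O : Oracle Node) (x z : ℝ) : ℕ := (minedBlocks O x z).ncard

theorem Block.honest_injective : Function.Injective Block.honest := fun _ _ h => by
  injection h

theorem Block.adversarial_injective : Function.Injective Block.adversarial := fun _ _ h => by
  injection h

theorem minedBlocks_eq_union (x z : ℝ) : minedBlocks O x z =
    Block.honest '' (O.honestTimes ∩ Set.Ioc x z) ∪
      Block.adversarial '' (O.advTimes ∩ Set.Ioc x z) := by
  ext b
  cases b <;> simp [minedBlocks, Mined, Block.time]

theorem minedBlocks_finite {x z : ℝ} (hH : (O.honestTimes ∩ Set.Ioc x z).Finite)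
    (hA : (O.advTimes ∩ Set.Ioc x z).Finite) : (minedBlocks O x z).Finite := by
  rw [minedBlocks_eq_union]
  exact (hH.image _).union (hA.image _)

theorem mined_le (x z : ℝ) : mined O x z ≤
    (O.honestTimes ∩ Set.Ioc x z).ncard + (O.advTimes ∩ Set.Ioc x z).ncard := by
  rw [mined, minedBlocks_eq_union]
  refine (Set.ncard_union_le _ _).trans_eq ?_
  rw [Set.ncard_image_of_injective _ Block.honest_injective,
    Set.ncard_image_of_injective _ Block.adversarial_injective]

theorem minedBlocks_eq_empty {x z : ℝ} (h : z ≤ x) : minedBlocks O x z = ∅ :=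
  Set.eq_empty_of_forall_notMem fun _ hb => (hb.2.2.1.trans_le hb.2.2.2).not_ge h

theorem mined_mono {x x' z z' : ℝ} (hfin : (minedBlocks O x' z').Finite) (hx : x' ≤ x)
    (hz : z ≤ z') : mined O x z ≤ mined O x' z' :=
  Set.ncard_le_ncard (fun _ hb => ⟨hb.1, hb.2.1, Set.Ioc_subset_Ioc hx hz hb.2.2⟩) hfin

theorem Block.ne_genesis_of_time_pos {b : Block} (h : 0 < b.time) : b ≠ Block.genesis := by
  rintro rfl
  exact lt_irrefl _ h

theorem ValidChain.mem_minedBlocks {t : ℝ} {C : Chain} (h : ValidChain O R t C) {x z : ℝ}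
    (hx : 0 ≤ x) {b : Block} (hb : b ∈ C) (hxb : x < b.time) (hbz : b.time ≤ z) :
    b ∈ minedBlocks O x z :=
  ⟨b.ne_genesis_of_time_pos (hx.trans_lt hxb), (h.2.2 b hb).1, hxb, hbz⟩

theorem ValidChain.time_le {t : ℝ} {C : Chain} (h : ValidChain O R t C) (ht : 0 ≤ t) {b : Block}
    (hb : b ∈ C) : b.time ≤ t := by
  rcases (h.2.2 b hb).2 with rfl | hle
  · exact ht
  · exact hle

theorem Run.Admissible.length_le_mined (A : R.Admissible S O) {t : ℝ} {C : Chain}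
    (h : ValidChain O R t C) {L : List Block} (hL : L.Sublist C) {x z : ℝ} (hx : 0 ≤ x)
    (hfin : (minedBlocks O x z).Finite) (htime : ∀ b ∈ L, x < b.time ∧ b.time ≤ z) :
    L.length ≤ mined O x z := by
  classical
  have hnodup : L.Nodup :=
    ((A.pairwise_time_lt h).sublist hL).imp fun hlt heq => hlt.ne (congrArg Block.time heq)
  rw [← List.toFinset_card_of_nodup hnodup, ← Set.ncard_coe_finset]
  refine Set.ncard_le_ncard (fun b hb => ?_) hfin
  rw [Finset.mem_coe, List.mem_toFinset] at hb
  exact h.mem_minedBlocks hx (hL.subset hb) (htime b hb).1 (htime b hb).2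

end Positions

section Growth

variable {Node : Type u} {S : Setting Node} {O : Oracle Node} {R : Run Node} {W T₀ N : ℝ}

/-! ### Growth of the chains of honest nodes -/

/-- Values certified by iteration `m` up to time `N` have been held by honest nodes at most `W`
before the iteration was decided. -/
def Recent (S : Setting Node) (R : Run Node) (W N : ℝ) (m : ℕ) : Prop :=
  ∀ g ∈ S.honest, ∀ t ≤ N, ∀ v, Certified S R g t m v → ∀ B, ckptBlock S v = some B →
    ∃ i ∈ S.honest, ∃ s : ℝ, s + S.Δ ≤ t ∧ B ∈ R.chain i s ∧ Decided S R m (s + W)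

/-- No iteration is decided shortly before or within `W + Δ` after time `u`. -/
def Quiet (S : Setting Node) (R : Run Node) (W u : ℝ) : Prop :=
  ∀ n, Decided S R n (u + (W + S.Δ)) → Decided S R n (u - 2 * S.Δ)

/-- From time `T₀` on, newly certified values are recent. -/
structure Settled (S : Setting Node) (O : Oracle Node) (R : Run Node) (W T₀ N : ℝ) : Prop
    extends Fair S O R where
  gst_le : R.gst ≤ T₀
  W_nonneg : 0 ≤ W
  recent : ∀ m, Decided S R m N → Decided S R m T₀ ∨ Recent S R W N m

theorem Fair.extendsLast_of_last (F : Fair S O R) {g : Node} (hg : g ∈ S.honest) {t : ℝ} {m : ℕ}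
    {v : Chain} (hc : Certified S R g t m v)
    (hmax : ∀ n' v', Certified S R g t n' v' → n' ≤ m) {B : Block} (hB : ckptBlock S v = some B)
    {c : Chain} (hc_mem : B ∈ c) : ExtendsLast S R g t c := by
  intro n v' hc' hmax' B' hB'
  obtain rfl : n = m := le_antisymm (hmax n v' hc') (hmax' m v hc)
  rw [F.certified_unique hg hg hc' hc, hB] at hB'
  rwa [← Option.some.inj hB']

theorem Fair.mem_chain_of_last (F : Fair S O R) {g h : Node} (hg : g ∈ S.honest)
    (hh : h ∈ S.honest) {t u : ℝ} (hu : R.gst + S.Δ ≤ u) {m : ℕ}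
    (hd : Decided S R m (u - S.Δ)) {v : Chain} (hc : Certified S R g t m v)
    (hmax : ∀ n' v', Certified S R g t n' v' → n' ≤ m)
    (hknown : ∀ n' v', Certified S R h u n' v' → Certified S R g t n' v') {B : Block}
    (hB : ckptBlock S v = some B) : B ∈ R.chain h u := by
  obtain ⟨v', hv'⟩ := hd.relay F.adm hh (t' := u) (by linarith) hu
  rw [F.certified_unique hg hh hc hv'] at hB
  exact (F.adm.chain_rule h hh u (by linarith [F.adm.gst_nonneg, F.Δ_pos])).2.1 m v' hv'
    (fun n' v'' h'' => hmax n' v'' (hknown n' v'' h'')) B hB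

/-- If the last checkpoint is not in the chain of `h`, then it is in a more recent honest chain,
to which the induction hypothesis applies. -/
theorem Settled.length_le_of_le_add_mul (E : Settled S O R W T₀ N) {u : ℝ}
    (hu : T₀ + 2 * S.Δ ≤ u) (hquiet : Quiet S R W u) {h : Node} (hh : h ∈ S.honest) (j : ℕ)
    {g : Node} (hg : g ∈ S.honest) {t : ℝ} (hut : u + S.Δ ≤ t) (htN : t ≤ N)
    (htj : t ≤ u + j * S.Δ) : (R.chain h u).length ≤ (R.chain g t).length := by
  have hΔ := E.Δ_pos
  have hT₀ := E.gst_le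
  have hgst := E.adm.gst_nonneg
  induction j generalizing g t with
  | zero =>
    rw [Nat.cast_zero, zero_mul] at htj
    linarith
  | succ j ih =>
    obtain ⟨-, -, hlong⟩ := E.adm.chain_rule g hg t (by linarith)
    by_cases hext : ExtendsLast S R g t (R.chain h u)
    · exact hlong _ ((E.adm.chain_rule h hh u (by linarith)).1.relay E.adm hh hg hut
        (by linarith)) hext
    simp only [ExtendsLast, not_forall] at hext
    obtain ⟨m, v, hc, hmax, B, hB, hmem⟩ := hext
    have hnd : ¬ Decided S R m (u - 2 * S.Δ) := fun hd => hmem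
      (E.mem_chain_of_last hg hh (by linarith) (hd.mono (by linarith)) hc hmax
        (fun _ _ hc' => hc'.relay E.adm hh hg hut (by linarith)) hB)
    have hrec : Recent S R W N m := (E.recent m ⟨g, hg, v, hc.mono htN⟩).resolve_left
      fun hd => hnd (hd.mono (by linarith))
    obtain ⟨i, hi, s, hst, hBi, hds⟩ := hrec g hg t htN v hc B hB
    have hus : u + S.Δ ≤ s := by
      by_contra! hsu
      exact hnd (hquiet m (hds.mono (by linarith)))
    push_cast at htj
    refine (ih hi hus (by linarith) (by linarith)).trans (hlong _ ?_ ?_)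
    · exact (E.adm.chain_rule i hi s (by linarith)).1.relay E.adm hi hg hst (by linarith)
    · exact E.extendsLast_of_last hg hc hmax hB hBi

theorem Settled.length_le (E : Settled S O R W T₀ N) {u : ℝ} (hu : T₀ + 2 * S.Δ ≤ u)
    (hquiet : Quiet S R W u) {h g : Node} (hh : h ∈ S.honest) (hg : g ∈ S.honest) {t : ℝ}
    (hut : u + S.Δ ≤ t) (htN : t ≤ N) : (R.chain h u).length ≤ (R.chain g t).length := by
  obtain ⟨j, hj⟩ := exists_nat_gt ((t - u) / S.Δ)
  rw [div_lt_iff₀ E.Δ_pos] at hj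
  exact E.length_le_of_le_add_mul hu hquiet hh j hg hut htN (by linarith)

/-! ### Blocks at convergence opportunities -/

/-- `τ` is the mining time of an honest block that is isolated and mined in a quiet time. -/
structure GoodTime (S : Setting Node) (O : Oracle Node) (R : Run Node) (W T₀ N τ : ℝ) :
    Prop where
  mem : τ ∈ O.honestTimes
  isolated : ∀ τ' ∈ O.honestTimes, τ' ≠ τ → S.Δ < |τ' - τ|
  quiet : Quiet S R W τ
  late : T₀ + 2 * S.Δ ≤ τ
  le : τ ≤ N

theorem Settled.blockAt_miner (E : Settled S O R W T₀ N) {τ : ℝ} (hτ : GoodTime S O R W T₀ N τ)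
    {y : ℝ} (hy : y < τ) :
    ∃ s, y < s ∧ s < τ ∧ BlockAt O R (Block.honest τ) (R.chain (R.miner τ) s).length ∧
      (R.chain (R.miner τ) s).length < (R.chain (R.miner τ) τ).length := by
  have hΔ := E.Δ_pos
  have hpos : R.gst + 2 * S.Δ ≤ τ := by linarith [E.gst_le, hτ.late]
  have hgst := E.adm.gst_nonneg
  have hm := E.adm.miner_honest τ hτ.mem
  obtain ⟨c, hev, -, hk⟩ := E.adm.mining_rule τ hτ.mem
  have hkc : KnowsChain R (R.miner τ) τ (c ++ [Block.honest τ]) := ⟨_, hk, rfl⟩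
  have hnear : ∀ᶠ s in 𝓝[<] τ, s ∈ Set.Ioo (max y (τ - S.Δ)) τ :=
    Ioo_mem_nhdsLT (max_lt hy (by linarith))
  obtain ⟨s, rfl, hys, hsτ⟩ := (hev.and hnear).exists
  rw [max_lt_iff] at hys
  refine ⟨s, hys.1, hsτ, (E.adm.recv_valid _ hm τ _ hkc).blockAt (by simp), ?_⟩
  have hle := (E.adm.chain_rule _ hm τ (by linarith)).2.2 _ hkc fun n v hc hmax B hB => ?_
  · rwa [List.length_append, List.length_singleton] at hle
  have hd : Decided S R n (τ - 2 * S.Δ) :=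
    hτ.quiet n ⟨_, hm, v, hc.mono (by linarith [E.W_nonneg])⟩
  exact List.mem_append_left _ (E.mem_chain_of_last hm hm (by linarith)
    (hd.mono (by linarith)) hc hmax (fun _ _ hc' => hc'.mono hsτ.le) hB)

theorem Settled.exists_blockAt (E : Settled S O R W T₀ N) {τ : ℝ}
    (hτ : GoodTime S O R W T₀ N τ) :
    ∃ i, BlockAt O R (Block.honest τ) i ∧
      ∀ g ∈ S.honest, ∀ t, τ + S.Δ ≤ t → t ≤ N → i < (R.chain g t).length := by
  obtain ⟨s, -, -, hat, hlt⟩ := E.blockAt_miner hτ (sub_one_lt τ)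
  exact ⟨_, hat, fun g hg t ht htN =>
    hlt.trans_le (E.length_le hτ.late hτ.quiet (E.adm.miner_honest τ hτ.mem) hg ht htN)⟩

theorem Settled.blockAt_lt_length (E : Settled S O R W T₀ N) {τ : ℝ}
    (hτ : GoodTime S O R W T₀ N τ) {i : ℕ} (hi : BlockAt O R (Block.honest τ) i) {g : Node}
    (hg : g ∈ S.honest) {t : ℝ} (ht : τ + S.Δ ≤ t) (htN : t ≤ N) : i < (R.chain g t).length := by
  obtain ⟨i', hi', hlt⟩ := E.exists_blockAt hτ
  exact hi.unique hi' ▸ hlt g hg t ht htN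

theorem Settled.blockAt_lt_blockAt (E : Settled S O R W T₀ N) {τ τ' : ℝ}
    (hτ : GoodTime S O R W T₀ N τ) (hτ' : GoodTime S O R W T₀ N τ') (hlt : τ < τ') {i j : ℕ}
    (hi : BlockAt O R (Block.honest τ) i) (hj : BlockAt O R (Block.honest τ') j) : i < j := by
  have hsep := hτ.isolated τ' hτ'.mem hlt.ne'
  rw [abs_of_pos (by linarith)] at hsep
  obtain ⟨s, hτs, hsτ', hat, -⟩ := E.blockAt_miner hτ' (y := τ + S.Δ) (by linarith)
  rw [hj.unique hat]
  exact E.blockAt_lt_length hτ hi (E.adm.miner_honest τ' hτ'.mem) hτs.le (hsτ'.le.trans hτ'.le)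

theorem Settled.eq_of_blockAt (E : Settled S O R W T₀ N) {τ τ' : ℝ}
    (hτ : GoodTime S O R W T₀ N τ) (hτ' : GoodTime S O R W T₀ N τ') {i : ℕ}
    (hi : BlockAt O R (Block.honest τ) i) (hi' : BlockAt O R (Block.honest τ') i) : τ = τ' := by
  rcases lt_trichotomy τ τ' with h | h | h
  · exact absurd (E.blockAt_lt_blockAt hτ hτ' h hi hi') (lt_irrefl _)
  · exact h
  · exact absurd (E.blockAt_lt_blockAt hτ' hτ h hi' hi) (lt_irrefl _)

/-- The mining times `τ ∈ (x, z]` of honest blocks that are isolated and mined in a quiet time. -/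
def goodTimes (S : Setting Node) (O : Oracle Node) (R : Run Node) (W T₀ N x z : ℝ) : Set ℝ :=
  {τ ∈ Set.Ioc x z | GoodTime S O R W T₀ N τ}

/-- If each good block is matched by another block at its position, then at most half of the
blocks are good, since that other block cannot be good. -/
theorem Settled.two_mul_ncard_goodTimes_le (E : Settled S O R W T₀ N) {x y z : ℝ} (hyz : y ≤ z)
    (hfin : (minedBlocks O x z).Finite)
    (hmatch : ∀ τ ∈ goodTimes S O R W T₀ N x y, ∃ b ∈ minedBlocks O x z, ∃ i,
      BlockAt O R (Block.honest τ) i ∧ BlockAt O R b i ∧ b ≠ Block.honest τ) :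
    2 * (goodTimes S O R W T₀ N x y).ncard ≤ mined O x z := by
  set G := goodTimes S O R W T₀ N x y
  have hsub : Block.honest '' G ⊆ minedBlocks O x z := by
    rintro _ ⟨τ, hτ, rfl⟩
    exact ⟨Block.noConfusion, hτ.2.mem, hτ.1.1, hτ.1.2.trans hyz⟩
  have : Nonempty Block := ⟨Block.genesis⟩
  choose! f hfmem i hi hfi hne using hmatch
  have hle : G.ncard ≤ (minedBlocks O x z \ Block.honest '' G).ncard := by
    refine Set.ncard_le_ncard_of_injOn f (fun τ hτ => ⟨hfmem τ hτ, ?_⟩) (fun τ hτ τ' hτ' h => ?_)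
      (hfin.subset Set.sdiff_subset)
    · rintro ⟨τ', hτ', hf⟩
      rw [E.eq_of_blockAt hτ'.2 hτ.2 (hf ▸ hfi τ hτ) (hi τ hτ)] at hf
      exact hne τ hτ hf.symm
    · have hii' : i τ = i τ' := (h ▸ hfi τ hτ).unique (hfi τ' hτ')
      exact E.eq_of_blockAt hτ.2 hτ'.2 (hi τ hτ) (hii' ▸ hi τ' hτ')
  have hcard := Set.ncard_sdiff_add_ncard_of_subset hsub hfin
  rw [Set.ncard_image_of_injective _ Block.honest_injective] at hcard
  rw [mined, ← hcard]
  omega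

end Growth

section Dominance

variable {Node : Type u} {S : Setting Node} {O : Oracle Node} {R : Run Node} {W T₀ N T₁ ℓ : ℝ}

/-! ### Common prefix and chain quality from dominance of good blocks -/

/-- In intervals of length at least `ℓ` that end after time `T₁` and start at time `0` or at a good
time, more than half of the blocks are good. -/
structure Dominant (S : Setting Node) (O : Oracle Node) (R : Run Node) (W T₀ N T₁ ℓ : ℝ) : Prop
    extends Settled S O R W T₀ N where
  finite_minedBlocks : ∀ x z, (minedBlocks O x z).Finite
  mined_lt : ∀ x z, (x = 0 ∨ GoodTime S O R W T₀ N x) → x + ℓ ≤ z → T₁ ≤ z → z ≤ N →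
    mined O x z < 2 * (goodTimes S O R W T₀ N x (z - 2 * S.Δ)).ncard

theorem exists_eq_or_mem_forall_le {α : Type*} [LinearOrder α] {s : Set α} (hs : s.Finite)
    (d : α) : ∃ x, (x = d ∨ x ∈ s) ∧ ∀ y ∈ s, y ≤ x := by
  rcases s.eq_empty_or_nonempty with rfl | hne
  · exact ⟨d, Or.inl rfl, fun _ hy => hy.elim⟩
  · obtain ⟨x, hx, hmax⟩ := Set.exists_max_image s id hs hne
    exact ⟨x, Or.inr hx, hmax⟩

theorem exists_eq_or_mem_forall_ge {α : Type*} [LinearOrder α] {s : Set α} (hs : s.Finite)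
    (d : α) : ∃ x, (x = d ∨ x ∈ s) ∧ ∀ y ∈ s, x ≤ y :=
  exists_eq_or_mem_forall_le (α := αᵒᵈ) hs d

theorem finite_setOf_goodTime_mem {s : Set Block} (hs : s.Finite) :
    {τ | GoodTime S O R W T₀ N τ ∧ Block.honest τ ∈ s}.Finite :=
  (hs.preimage Block.honest_injective.injOn).subset fun _ h => h.2

theorem Settled.nonneg_of_goodTime (E : Settled S O R W T₀ N) {x : ℝ}
    (hx : x = 0 ∨ GoodTime S O R W T₀ N x) : 0 ≤ x := by
  rcases hx with rfl | hx
  · exact le_rfl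
  · linarith [E.adm.gst_nonneg, E.gst_le, E.Δ_pos, hx.late]

theorem Settled.lt_time_of_blockAt (E : Settled S O R W T₀ N) {t : ℝ} {C : Chain}
    (hC : ValidChain O R t C) {x τ : ℝ} (hx : x = 0 ∨ GoodTime S O R W T₀ N x)
    (hxC : x = 0 ∨ Block.honest x ∈ C) (hτ : GoodTime S O R W T₀ N τ) (hxτ : x < τ) {i : ℕ}
    (hi : BlockAt O R (Block.honest τ) i) {b : Block} (hb : C[i]? = some b) : x < b.time := by
  rcases eq_or_ne x 0 with rfl | hx0
  · refine E.adm.time_pos hC (List.mem_of_getElem? hb) fun h => ?_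
    exact Block.noConfusion (hi.eq_zero_iff.1 ((hC.blockAt hb).eq_zero_iff.2 h))
  · obtain ⟨j, hj⟩ := List.mem_iff_getElem?.1 (hxC.resolve_left hx0)
    exact E.adm.time_lt hC hj hb
      (E.blockAt_lt_blockAt (hx.resolve_left hx0) hτ hxτ (hC.blockAt hj) hi)

theorem Settled.exists_getElem?_of_blockAt (E : Settled S O R W T₀ N) {h : Node}
    (hh : h ∈ S.honest) {t z : ℝ} (ht : 0 ≤ t) (htN : t ≤ N)
    (hz : (t ≤ z ∧ z ≤ t + S.Δ) ∨
      (GoodTime S O R W T₀ N z ∧ Block.honest z ∈ R.chain h t)) {τ : ℝ}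
    (hτ : GoodTime S O R W T₀ N τ) (hτz : τ ≤ z - 2 * S.Δ) {i : ℕ}
    (hi : BlockAt O R (Block.honest τ) i) : ∃ b, (R.chain h t)[i]? = some b ∧ b.time ≤ z := by
  have hΔ := E.Δ_pos
  have hC := E.adm.validChain_chain hh ht
  rcases hz with ⟨htz, hzt⟩ | ⟨hz, hmem⟩
  · have hlt := E.blockAt_lt_length hτ hi hh (t := t) (by linarith) htN
    exact ⟨_, List.getElem?_eq_getElem hlt, (hC.time_le ht (List.getElem_mem hlt)).trans htz⟩
  · obtain ⟨j, hj⟩ := List.mem_iff_getElem?.1 hmem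
    have hij := E.blockAt_lt_blockAt hτ hz (by linarith) hi (hC.blockAt hj)
    have hlt := hij.trans (List.getElem?_eq_some_iff.1 hj).1
    have hi := List.getElem?_eq_getElem hlt
    exact ⟨_, hi, (E.adm.time_lt hC hi hj hij).le⟩

/-- Since the good blocks cannot all be matched, one of them is the only block mined in `(x, z]` at
its position; every chain that covers the interval contains it. -/
theorem Dominant.exists_goodTime (D : Dominant S O R W T₀ N T₁ ℓ) {x z : ℝ}
    (hx : x = 0 ∨ GoodTime S O R W T₀ N x) (hxz : x + ℓ ≤ z) (hT : T₁ ≤ z) (hzN : z ≤ N) :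
    ∃ τ ∈ goodTimes S O R W T₀ N x (z - 2 * S.Δ), ∀ h ∈ S.honest, ∀ t, 0 ≤ t → t ≤ N →
      (x = 0 ∨ Block.honest x ∈ R.chain h t) →
      ((t ≤ z ∧ z ≤ t + S.Δ) ∨ (GoodTime S O R W T₀ N z ∧ Block.honest z ∈ R.chain h t)) →
      Block.honest τ ∈ R.chain h t := by
  by_contra! hcon
  refine (D.mined_lt x z hx hxz hT hzN).not_ge (D.two_mul_ncard_goodTimes_le
    (by linarith [D.Δ_pos]) (D.finite_minedBlocks x z) fun τ hτ => ?_)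
  obtain ⟨h, hh, t, ht, htN, hxC, hz, hmem⟩ := hcon τ hτ
  have hC := D.adm.validChain_chain hh ht
  obtain ⟨i, hi, -⟩ := D.exists_blockAt hτ.2
  obtain ⟨b, hb, hbz⟩ := D.exists_getElem?_of_blockAt hh ht htN hz hτ.2 hτ.1.2 hi
  have hbC := List.mem_of_getElem? hb
  refine ⟨b, hC.mem_minedBlocks (D.nonneg_of_goodTime hx) hbC
    (D.lt_time_of_blockAt hC hx hxC hτ.2 hτ.1.1 hi hb) hbz, i, hi, hC.blockAt hb, ?_⟩
  rintro rfl
  exact hmem hbC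

theorem Dominant.mem_chain_of_le_add (D : Dominant S O R W T₀ N T₁ ℓ) {s t : ℝ} (hs : 0 ≤ s)
    (hst : s ≤ t) (hts : t ≤ s + S.Δ) (htN : t ≤ N) (htT : T₁ ≤ t) {i j : Node}
    (hi : i ∈ S.honest) (hj : j ∈ S.honest) {B : Block} (hB : B ∈ R.chain i s)
    (hBt : B.time + ℓ ≤ t) : B ∈ R.chain j t := by
  have hΔ := D.Δ_pos
  have hC := D.adm.validChain_chain hi hs
  have hC' := D.adm.validChain_chain hj (hs.trans hst)
  by_contra hnot
  obtain ⟨x, hx, hmax⟩ := exists_eq_or_mem_forall_le (finite_setOf_goodTime_mem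
    (S := S) (O := O) (R := R) (W := W) (T₀ := T₀) (N := N)
    (s := {b | b ∈ R.chain i s ∧ b ∈ R.chain j t})
    ((List.finite_toSet (R.chain i s)).subset fun _ h => h.1)) 0
  have hxB : x ≤ B.time := by
    rcases hx with rfl | hx
    · exact D.adm.time_nonneg hC hB
    · by_contra! hlt
      exact hnot (D.adm.mem_of_time_le hC hC' hx.2.1 hx.2.2 hB hlt.le)
  obtain ⟨τ, hτ, hmem⟩ := D.exists_goodTime (hx.imp_right And.left)
    (by linarith : x + ℓ ≤ t) htT htN
  have hτC := hmem i hi s hs (hst.trans htN) (hx.imp_right fun h => h.2.1) (Or.inl ⟨hst, hts⟩)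
  have hτC' := hmem j hj t (hs.trans hst) htN (hx.imp_right fun h => h.2.2)
    (Or.inl ⟨le_rfl, by linarith⟩)
  exact hτ.1.1.not_ge (hmax τ ⟨hτ.2, hτC, hτC'⟩)

theorem Dominant.mem_chain_of_le_add_mul (D : Dominant S O R W T₀ N T₁ ℓ) {t₁ : ℝ} (ht₁ : 0 ≤ t₁)
    (hT : T₁ ≤ t₁) {i : Node} (hi : i ∈ S.honest) {B : Block} (hB : B ∈ R.chain i t₁)
    (hBt : B.time + ℓ ≤ t₁) (n : ℕ) {j : Node} (hj : j ∈ S.honest) {t : ℝ} (h1 : t₁ ≤ t)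
    (h2 : t ≤ t₁ + n * S.Δ) (htN : t ≤ N) : B ∈ R.chain j t := by
  have hΔ := D.Δ_pos
  induction n generalizing j t with
  | zero =>
    obtain rfl : t₁ = t := le_antisymm h1 (by simpa using h2)
    exact D.mem_chain_of_le_add ht₁ le_rfl (by linarith) htN hT hi hj hB hBt
  | succ n ih =>
    push_cast at h2
    have hn : 0 ≤ (n : ℝ) * S.Δ := by positivity
    have hs₁ := le_max_left t₁ (t - S.Δ)
    have hs₂ := le_max_right t₁ (t - S.Δ)
    have hst : max t₁ (t - S.Δ) ≤ t := max_le h1 (by linarith)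
    exact D.mem_chain_of_le_add (by linarith) hst (by linarith) htN (by linarith) hj hj
      (ih hj hs₁ (max_le (by linarith) (by linarith)) (hst.trans htN)) (by linarith)

theorem Dominant.mem_chain_of_le (D : Dominant S O R W T₀ N T₁ ℓ) {t₁ t₂ : ℝ} (ht₁ : 0 ≤ t₁)
    (hT : T₁ ≤ t₁) (h12 : t₁ ≤ t₂) (htN : t₂ ≤ N) {i j : Node} (hi : i ∈ S.honest)
    (hj : j ∈ S.honest) {B : Block} (hB : B ∈ R.chain i t₁) (hBt : B.time + ℓ ≤ t₁) :
    B ∈ R.chain j t₂ := by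
  obtain ⟨n, hn⟩ := exists_nat_gt ((t₂ - t₁) / S.Δ)
  rw [div_lt_iff₀ D.Δ_pos] at hn
  exact D.mem_chain_of_le_add_mul ht₁ hT hi hB hBt n hj h12 (by linarith) htN

theorem exists_getElem?_of_ckptBlock_eq {C : Chain} {B : Block} (hB : ckptBlock S C = some B) :
    ∃ m, C[m]? = some B ∧ m + 1 + S.k = C.length := by
  have hlast : (C.take (C.length - S.k)).getLast? = some B := hB
  have hpos : 0 < C.length - S.k := by
    by_contra! hle
    rw [Nat.le_zero.1 hle] at hlast
    simp at hlast
  rw [List.getLast?_eq_getElem?, List.length_take, min_eq_left (Nat.sub_le _ _),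
    List.getElem?_take_of_lt (by omega)] at hlast
  exact ⟨_, hlast, by omega⟩

theorem Run.Admissible.le_mined_of_ckptBlock_eq (A : R.Admissible S O) {t : ℝ} (ht : 0 ≤ t)
    {C : Chain} (hC : ValidChain O R t C) {B : Block} (hB : ckptBlock S C = some B)
    (hfin : (minedBlocks O B.time t).Finite) : S.k ≤ mined O B.time t := by
  obtain ⟨m, hm, hlen⟩ := exists_getElem?_of_ckptBlock_eq hB
  have hdrop : (C.drop (m + 1)).length = S.k := by
    rw [List.length_drop]
    omega
  rw [← hdrop]
  refine A.length_le_mined hC (List.drop_sublist _ _) (A.time_nonneg hC (mem_of_ckptBlock_eq hB))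
    hfin fun b hb => ⟨?_, hC.time_le ht (List.mem_of_mem_drop hb)⟩
  obtain ⟨j, hj⟩ := List.mem_iff_getElem?.1 hb
  rw [List.getElem?_drop] at hj
  exact A.time_lt hC hm hj (by omega)

theorem Dominant.common_prefix (D : Dominant S O R W T₀ N T₁ ℓ)
    (hdense : ∀ x z, 0 ≤ x → z ≤ N → S.k ≤ mined O x z → x + ℓ ≤ z) {t₁ t₂ : ℝ} (ht₁ : 0 ≤ t₁)
    (hT : S.k ≤ mined O 0 t₁ → T₁ ≤ t₁) (h12 : t₁ ≤ t₂) (htN : t₂ ≤ N) {i j : Node}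
    (hi : i ∈ S.honest) (hj : j ∈ S.honest) :
    (R.chain i t₁).rdrop S.k <+: R.chain j t₂ := by
  have hC := D.adm.validChain_chain hi ht₁
  have hC' := D.adm.validChain_chain hj (ht₁.trans h12)
  cases hB : ckptBlock S (R.chain i t₁) with
  | none =>
    rw [List.getLast?_eq_none_iff.1 hB]
    exact List.nil_prefix
  | some B =>
    have hBmem := mem_of_ckptBlock_eq hB
    have hB0 := D.adm.time_nonneg hC hBmem
    have hmined := D.adm.le_mined_of_ckptBlock_eq ht₁ hC hB (D.finite_minedBlocks _ _)
    have hT₁ := hT (hmined.trans (mined_mono (D.finite_minedBlocks _ _) hB0 le_rfl))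
    obtain ⟨m, hm, hlen⟩ := exists_getElem?_of_ckptBlock_eq hB
    obtain ⟨m', hm'⟩ := List.mem_iff_getElem?.1
      (D.mem_chain_of_le ht₁ hT₁ h12 htN hi hj hBmem (hdense _ _ hB0 (h12.trans htN) hmined))
    rw [List.rdrop, ← hlen, Nat.add_sub_cancel, (hC.take_eq_take hC' hm hm').2]
    exact List.take_prefix _ _

/-- The segment `L` lies between the last good block before it and the first good block after it,
and the good block given by dominance of the interval between these must be in `L`. -/
theorem Dominant.exists_isHonest (D : Dominant S O R W T₀ N T₁ ℓ)
    {t : ℝ} (ht : 0 ≤ t) (htN : t ≤ N) {h : Node} (hh : h ∈ S.honest) {L : List Block}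
    (hL : L <:+: R.chain h t) (hgen : ∀ b ∈ L, b ≠ Block.genesis)
    (hlong : ∀ x z, 0 ≤ x → z ≤ N → (∀ b ∈ L, x < b.time ∧ b.time ≤ z) → x + ℓ ≤ z ∧ T₁ ≤ z) :
    ∃ b ∈ L, b.IsHonest := by
  have hΔ := D.Δ_pos
  have hC := D.adm.validChain_chain hh ht
  obtain ⟨pre, post, hC_eq⟩ := hL
  have hsorted := D.adm.pairwise_time_lt hC
  simp only [← hC_eq, List.pairwise_append, List.mem_append] at hsorted
  obtain ⟨⟨-, -, hpre_lt⟩, -, hlt_post⟩ := hsorted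
  have hmemC (b : Block) : b ∈ R.chain h t ↔ (b ∈ pre ∨ b ∈ L) ∨ b ∈ post := by
    rw [← hC_eq, List.mem_append, List.mem_append]
  obtain ⟨x, hx, hx_max⟩ := exists_eq_or_mem_forall_le (finite_setOf_goodTime_mem
    (S := S) (O := O) (R := R) (W := W) (T₀ := T₀) (N := N) (List.finite_toSet pre)) 0
  obtain ⟨z, hz, hz_min⟩ := exists_eq_or_mem_forall_ge (finite_setOf_goodTime_mem
    (S := S) (O := O) (R := R) (W := W) (T₀ := T₀) (N := N) (List.finite_toSet post)) t
  have hxL : ∀ b ∈ L, x < b.time := fun b hb => by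
    rcases hx with rfl | hx
    · exact D.adm.time_pos hC ((hmemC b).2 (Or.inl (Or.inr hb))) (hgen b hb)
    · exact hpre_lt _ hx.2 b hb
  have hLz : ∀ b ∈ L, b.time ≤ z := fun b hb => by
    rcases hz with rfl | hz
    · exact hC.time_le ht ((hmemC b).2 (Or.inl (Or.inr hb)))
    · exact (hlt_post b (Or.inr hb) _ hz.2).le
  have hzN : z ≤ N := by
    rcases hz with rfl | hz
    exacts [htN, hz.1.le]
  obtain ⟨hxz, hTz⟩ := hlong x z (D.nonneg_of_goodTime (hx.imp_right And.left)) hzN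
    fun b hb => ⟨hxL b hb, hLz b hb⟩
  obtain ⟨τ, hτ, hmem⟩ := D.exists_goodTime (hx.imp_right And.left) hxz hTz hzN
  have hτC := hmem h hh t ht htN (hx.imp_right fun h => (hmemC _).2 (Or.inl (Or.inl h.2)))
    (hz.imp (fun h => ⟨h.ge, by linarith⟩) fun h => ⟨h.1, (hmemC _).2 (Or.inr h.2)⟩)
  rcases (hmemC _).1 hτC with (hpre | hL) | hpost
  · exact absurd (hx_max τ ⟨hτ.2, hpre⟩) hτ.1.1.not_ge
  · exact ⟨_, hL, trivial⟩
  · have hzτ : z ≤ τ := hz_min τ ⟨hτ.2, hpost⟩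
    linarith [hτ.1.2]

theorem Dominant.chain_quality (D : Dominant S O R W T₀ N T₁ ℓ) {k : ℕ}
    (hdense : ∀ x z, 0 ≤ x → z ≤ N → k ≤ mined O x z → x + ℓ ≤ z) {t : ℝ} (ht : 0 ≤ t)
    (htN : t ≤ N) {h : Node} (hh : h ∈ S.honest) {L : List Block} (hL : L <:+: R.chain h t)
    (hLk : L.length = k) (hgen : ∀ b ∈ L, b ≠ Block.genesis)
    (hT : ∀ z ≤ N, (∀ b ∈ L, b.time ≤ z) → k ≤ mined O 0 z → T₁ ≤ z) :
    ∃ b ∈ L, b.IsHonest := by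
  refine D.exists_isHonest ht htN hh hL hgen fun x z hx hzN hxLz => ?_
  have hmined : k ≤ mined O x z := hLk ▸ D.adm.length_le_mined (D.adm.validChain_chain hh ht)
    hL.sublist hx (D.finite_minedBlocks x z) hxLz
  exact ⟨hdense x z hx hzN hmined, hT z hzN (fun b hb => (hxLz b hb).2)
    (hmined.trans (mined_mono (D.finite_minedBlocks 0 z) hx le_rfl))⟩

end Dominance

section Typical

variable {Node : Type u} {S : Setting Node} {O : Oracle Node} {R : Run Node} {W T₀ N : ℝ}
  {κ b M : ℕ} {y ρ : ℝ}

/-! ### Dominance of good blocks in typical outcomes -/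

/-- Convergence opportunity: among the points of `H`, exactly one lies in `((j + 1) Δ, (j + 2) Δ]`
and none in the two adjacent slots. -/
def Converges (H : Set ℝ) (Δ : ℝ) (j : ℕ) : Prop :=
  (H ∩ Set.Ioc (j * Δ) ((j + 1 : ℕ) * Δ)).ncard = 0 ∧
  (H ∩ Set.Ioc ((j + 1 : ℕ) * Δ) ((j + 2 : ℕ) * Δ)).ncard = 1 ∧
  (H ∩ Set.Ioc ((j + 2 : ℕ) * Δ) ((j + 3 : ℕ) * Δ)).ncard = 0

open Classical in
/-- Outcomes of the oracle for which, up to slot `b`, convergence opportunities and blocks have the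
right frequencies in all intervals of at least `κ / 4` slots, and one among any `M` consecutive
leaders is honest. Convergence opportunities are counted in steps of three slots because
opportunities closer than that are not independent. -/
structure Typical (S : Setting Node) (O : Oracle Node) (κ b M : ℕ) (y ρ : ℝ) : Prop where
  finite_honest : ∀ z, (O.honestTimes ∩ Set.Iic z).Finite
  finite_adv : ∀ z, (O.advTimes ∩ Set.Iic z).Finite
  le_card_converges : ∀ a ≤ b, ∀ m ≤ b, κ ≤ 4 * m →
    y * m ≤ ((Finset.range m).filter fun i => Converges O.honestTimes S.Δ (a + 3 * i)).card
  card_le : ∀ a ≤ b, ∀ m ≤ b, κ ≤ 4 * m →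
    ((O.honestTimes ∩ Set.Ioc (a * S.Δ) ((a + m : ℕ) * S.Δ)).ncard : ℝ) +
      (O.advTimes ∩ Set.Ioc (a * S.Δ) ((a + m : ℕ) * S.Δ)).ncard ≤ ρ * m
  exists_leader : ∀ n ≤ b, ∀ p ≤ b, ∃ q, p ≤ q ∧ q < p + M ∧ O.leader n q ∈ S.honestCkpts

theorem Typical.minedBlocks_finite (hT : Typical S O κ b M y ρ) (x z : ℝ) :
    (minedBlocks O x z).Finite :=
  CLC.minedBlocks_finite
    ((hT.finite_honest z).subset (Set.inter_subset_inter_right _ Set.Ioc_subset_Iic_self))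
    ((hT.finite_adv z).subset (Set.inter_subset_inter_right _ Set.Ioc_subset_Iic_self))

theorem Typical.mined_le (hT : Typical S O κ b M y ρ) (hΔ : 0 < S.Δ) (hρ : 0 ≤ ρ) {x z len : ℝ}
    (hx : 0 ≤ x) (hzb : z ≤ b * S.Δ) (hlen : κ ≤ len) (hlb : len + 2 ≤ b)
    (hz : z ≤ x + len * S.Δ) : mined O x z ≤ ρ * (len + 2) := by
  have hlen0 : 0 ≤ len := (Nat.cast_nonneg κ).trans hlen
  rcases lt_or_ge z x with hzx | hxz
  · rw [mined, minedBlocks_eq_empty hzx.le, Set.ncard_empty, Nat.cast_zero]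
    positivity
  set a := ⌊x / S.Δ⌋₊
  set m := ⌈len⌉₊ + 1 with hm
  have hax : a * S.Δ ≤ x := (le_div_iff₀ hΔ).1 (Nat.floor_le (by positivity))
  have hxa : x < (a + 1) * S.Δ := (div_lt_iff₀ hΔ).1 (Nat.lt_floor_add_one _)
  have hlm : len + 1 ≤ m := by
    rw [hm]
    push_cast
    linarith [Nat.le_ceil len]
  have hml : (m : ℝ) ≤ len + 2 := by
    rw [hm]
    push_cast
    linarith [Nat.ceil_lt_add_one hlen0]
  have hab : a ≤ b := by exact_mod_cast le_of_mul_le_mul_right (hax.trans (hxz.trans hzb)) hΔ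
  have hmb : m ≤ b := by exact_mod_cast hml.trans hlb
  have hκm : κ ≤ 4 * m := by
    have : (κ : ℝ) ≤ 4 * m := by linarith
    exact_mod_cast this
  have hzam : z ≤ (a + m : ℕ) * S.Δ := by
    push_cast
    nlinarith
  calc (mined O x z : ℝ)
      ≤ mined O (a * S.Δ) ((a + m : ℕ) * S.Δ) := by
        exact_mod_cast mined_mono (hT.minedBlocks_finite _ _) hax hzam
    _ ≤ ρ * m := le_trans (by exact_mod_cast CLC.mined_le _ _) (hT.card_le a hab m hmb hκm)
    _ ≤ ρ * (len + 2) := mul_le_mul_of_nonneg_left hml hρ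

theorem Typical.add_le_of_le_mined (hT : Typical S O κ b M y ρ) (hΔ : 0 < S.Δ) (hρ : 0 ≤ ρ)
    {len : ℝ} (hκ : κ ≤ len) (hb : len + 2 ≤ b) {k : ℕ} (hk : ρ * (len + 2) < k) {x z : ℝ}
    (hx : 0 ≤ x) (hzb : z ≤ b * S.Δ) (h : k ≤ mined O x z) : x + len * S.Δ ≤ z := by
  by_contra! hlt
  have hle := hT.mined_le hΔ hρ hx hzb hκ hb hlt.le
  have hkm : (k : ℝ) ≤ mined O x z := by exact_mod_cast h
  linarith

/-- The points of `H` in `(x, z]` whose distance to all other points of `H` exceeds `Δ`. -/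
def isolatedTimes (H : Set ℝ) (Δ x z : ℝ) : Set ℝ :=
  {τ ∈ H ∩ Set.Ioc x z | ∀ τ' ∈ H, τ' ≠ τ → Δ < |τ' - τ|}

theorem Converges.exists_isolated {H : Set ℝ} {Δ : ℝ} (hfin : ∀ z, (H ∩ Set.Iic z).Finite)
    {j : ℕ} (h : Converges H Δ j) :
    ∃ τ ∈ H ∩ Set.Ioc ((j + 1) * Δ) ((j + 2) * Δ), ∀ τ' ∈ H, τ' ≠ τ → Δ < |τ' - τ| := by
  obtain ⟨hleft, hmid, hright⟩ := h
  have hfin' (x z : ℝ) : (H ∩ Set.Ioc x z).Finite :=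
    (hfin z).subset (Set.inter_subset_inter_right _ Set.Ioc_subset_Iic_self)
  rw [Set.ncard_eq_zero (hfin' _ _)] at hleft hright
  obtain ⟨τ, hmid⟩ := Set.ncard_eq_one.1 hmid
  push_cast at hleft hmid hright
  have hτ : τ ∈ H ∩ Set.Ioc ((j + 1) * Δ) ((j + 2) * Δ) := hmid ▸ Set.mem_singleton τ
  refine ⟨τ, hτ, fun τ' hτ' hne => ?_⟩
  by_contra! hle
  obtain ⟨hge, hle⟩ := abs_le.1 hle
  rcases le_or_gt τ' ((j + 1) * Δ) with h1 | h1
  · exact hleft.subset ⟨hτ', by linarith [hτ.2.1], h1⟩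
  rcases le_or_gt τ' ((j + 2) * Δ) with h2 | h2
  · exact hne (hmid.subset ⟨hτ', h1, h2⟩)
  · exact hright.subset ⟨hτ', h2, by linarith [hτ.2.2]⟩

theorem sum_range_three_mul (f : ℕ → ℕ) (m : ℕ) : ∑ j ∈ Finset.range (3 * m), f j =
    ∑ i ∈ Finset.range m, f (3 * i) + ∑ i ∈ Finset.range m, f (3 * i + 1) +
      ∑ i ∈ Finset.range m, f (3 * i + 2) := by
  induction m with
  | zero => rfl
  | succ m ih =>
    rw [mul_add_one, Finset.sum_range_succ, Finset.sum_range_succ, Finset.sum_range_succ, ih,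
      Finset.sum_range_succ, Finset.sum_range_succ, Finset.sum_range_succ]
    ring

open Classical in
theorem Typical.le_card_filter_converges (hT : Typical S O κ b M y ρ) {a m : ℕ} (ha : a + 2 ≤ b)
    (hm : m ≤ b) (hκ : κ ≤ 4 * m) : y * (3 * m) ≤
      ((Finset.Ico a (a + 3 * m)).filter (Converges O.honestTimes S.Δ)).card := by
  have h0 := hT.le_card_converges a (by omega) m hm hκ
  have h1 := hT.le_card_converges (a + 1) (by omega) m hm hκ
  have h2 := hT.le_card_converges (a + 2) ha m hm hκ
  rw [Finset.card_filter, Finset.sum_Ico_eq_sum_range, Nat.add_sub_cancel_left,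
    sum_range_three_mul]
  simp only [Finset.card_filter, add_right_comm a _ (3 * _), add_assoc a (3 * _)] at h0 h1 h2 ⊢
  push_cast at h0 h1 h2 ⊢
  linarith

open Classical in
theorem card_filter_converges_le {H : Set ℝ} {Δ : ℝ} (hΔ : 0 < Δ)
    (hfin : ∀ z, (H ∩ Set.Iic z).Finite) {x z : ℝ} {s : Finset ℕ}
    (hs : ∀ j ∈ s, x ≤ (j + 1) * Δ ∧ (j + 2) * Δ ≤ z) :
    (s.filter (Converges H Δ)).card ≤ (isolatedTimes H Δ x z).ncard := by
  have hfinite : (isolatedTimes H Δ x z).Finite :=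
    (hfin z).subset fun τ hτ => ⟨hτ.1.1, hτ.1.2.2⟩
  refine le_trans ?_ (Set.ncard_image_le (f := fun τ => ⌈τ / Δ⌉₊ - 2) hfinite)
  rw [← Set.ncard_coe_finset]
  refine Set.ncard_le_ncard (fun j hj => ?_) (hfinite.image _)
  obtain ⟨hjs, hconv⟩ := Finset.mem_filter.1 (Finset.mem_coe.1 hj)
  obtain ⟨τ, ⟨hτH, hjτ, hτj⟩, hiso⟩ := hconv.exists_isolated hfin
  refine ⟨τ, ⟨⟨hτH, (hs j hjs).1.trans_lt hjτ, hτj.trans (hs j hjs).2⟩, hiso⟩, ?_⟩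
  have hceil : ⌈τ / Δ⌉₊ = j + 2 := by
    rw [Nat.ceil_eq_iff (by omega), lt_div_iff₀ hΔ, div_le_iff₀ hΔ]
    push_cast
    exact ⟨hjτ, hτj⟩
  simp only [hceil, Nat.add_sub_cancel]

theorem Typical.le_ncard_isolatedTimes (hT : Typical S O κ b M y ρ) (hΔ : 0 < S.Δ) (hy : 0 ≤ y)
    {x len : ℝ} (hx : 0 ≤ x) (hb : x + len * S.Δ ≤ b * S.Δ) (hκ : κ ≤ len) (hlen : 32 ≤ len) :
    y * (len - 8) ≤ (isolatedTimes O.honestTimes S.Δ x (x + len * S.Δ - 2 * S.Δ)).ncard := by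
  set a := ⌈x / S.Δ⌉₊
  set m := ⌊(len - 5) / 3⌋₊
  have hxa : x ≤ a * S.Δ := (div_le_iff₀ hΔ).1 (Nat.le_ceil _)
  have hax : a * S.Δ < x + S.Δ := by
    have := Nat.ceil_lt_add_one (show 0 ≤ x / S.Δ by positivity)
    rwa [← sub_lt_iff_lt_add, lt_div_iff₀ hΔ, sub_mul, one_mul, sub_lt_iff_lt_add] at this
  have hm_le : (m : ℝ) ≤ (len - 5) / 3 := Nat.floor_le (by linarith)
  have hm_gt : (len - 5) / 3 < m + 1 := Nat.lt_floor_add_one _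
  have hab : a + 2 ≤ b := by
    have : ((a + 2 : ℕ) : ℝ) * S.Δ ≤ b * S.Δ := by
      push_cast
      nlinarith
    exact_mod_cast le_of_mul_le_mul_right this hΔ
  have hmb : m ≤ b := by
    have : (m : ℝ) * S.Δ ≤ b * S.Δ := by nlinarith
    exact_mod_cast le_of_mul_le_mul_right this hΔ
  have hκm : κ ≤ 4 * m := by
    have : (κ : ℝ) ≤ 4 * m := by linarith
    exact_mod_cast this
  refine (mul_le_mul_of_nonneg_left (by linarith) hy).trans
    ((hT.le_card_filter_converges hab hmb hκm).trans ?_)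
  refine Nat.cast_le.2 (card_filter_converges_le hΔ hT.finite_honest fun j hj => ?_)
  obtain ⟨haj, hjm⟩ := Finset.mem_Ico.1 hj
  have haj : (a : ℝ) ≤ j := by exact_mod_cast haj
  have hjm : (j : ℝ) + 1 ≤ a + 3 * m := by exact_mod_cast hjm
  constructor <;> nlinarith

/-! ### Isolated mining times that are not good -/

theorem card_le_of_forall_le_abs_sub {ι : Type*} {s : Finset ι} (f : ι → ℝ) {δ d : ℝ}
    (hδ : 0 < δ) (hd : 0 ≤ d) (hsep : ∀ i ∈ s, ∀ j ∈ s, i ≠ j → δ ≤ |f i - f j|)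
    (hdiam : ∀ i ∈ s, ∀ j ∈ s, f j - f i ≤ d) : s.card ≤ d / δ + 1 := by
  rcases s.eq_empty_or_nonempty with rfl | hne
  · rw [Finset.card_empty, Nat.cast_zero]
    positivity
  obtain ⟨i₀, hi₀, hmin⟩ := s.exists_min_image f hne
  have hcard : s.card ≤ (Finset.range (⌊d / δ⌋₊ + 1)).card := by
    refine Finset.card_le_card_of_injOn (fun i => ⌊(f i - f i₀) / δ⌋₊) (fun i hi => ?_)
      (fun i hi j hj hij => ?_)
    · rw [Finset.mem_coe, Finset.mem_range, Nat.lt_succ_iff]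
      exact Nat.floor_le_floor (div_le_div_of_nonneg_right (hdiam _ hi₀ _ hi) hδ.le)
    · by_contra hne
      have hi' := div_nonneg (sub_nonneg.2 (hmin i hi)) hδ.le
      have hj' := div_nonneg (sub_nonneg.2 (hmin j hj)) hδ.le
      have hlt : |(f i - f i₀) / δ - (f j - f i₀) / δ| < 1 :=
        Int.abs_sub_lt_one_of_floor_eq_floor (by
          rw [← Int.natCast_floor_eq_floor hi', ← Int.natCast_floor_eq_floor hj']
          exact congrArg _ hij)
      rw [← sub_div, sub_sub_sub_cancel_right, abs_div, abs_of_pos hδ, div_lt_one hδ] at hlt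
      exact (hsep i hi j hj hne).not_gt hlt
  rw [Finset.card_range] at hcard
  calc (s.card : ℝ) ≤ (⌊d / δ⌋₊ + 1 : ℕ) := by exact_mod_cast hcard
    _ ≤ d / δ + 1 := by
      push_cast
      linarith [Nat.floor_le (div_nonneg hd hδ.le)]

theorem card_le_of_mem_isolatedTimes {H : Set ℝ} {Δ x z d : ℝ} (hΔ : 0 < Δ) (hd : 0 ≤ d)
    {s : Finset ℝ} (hs : ∀ τ ∈ s, τ ∈ isolatedTimes H Δ x z)
    (hdiam : ∀ τ ∈ s, ∀ τ' ∈ s, τ' - τ ≤ d) : s.card ≤ d / Δ + 1 :=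
  card_le_of_forall_le_abs_sub id hΔ hd
    (fun τ hτ τ' hτ' hne => ((hs τ' hτ').2 τ (hs τ hτ).1.1 hne).le) hdiam

theorem Fair.lt_sub_of_not_decided (F : Fair S O R) {m n : ℕ} (hmn : m ≤ n) {t t' : ℝ}
    (hm : ¬ Decided S R m t) (hn : Decided S R n t') : t < t' - (n - m) * S.e := by
  by_contra! hle
  exact hm ((F.decided_sub hmn hn).mono hle)

/-- Times close to the decision of the same iteration are close to each other, and decisions are at
least `e` apart. -/
theorem Fair.card_le_of_not_quiet (F : Fair S O R) (hW : 0 ≤ W) {H : Set ℝ} {x z : ℝ}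
    (hxz : x ≤ z) {s : Finset ℝ} (hs : ∀ τ ∈ s, τ ∈ isolatedTimes H S.Δ x z)
    (hloud : ∀ τ ∈ s, ¬ Quiet S R W τ) :
    s.card ≤ (W / S.Δ + 4) * ((z - x + W + 3 * S.Δ) / S.e + 1) := by
  have hΔ := F.Δ_pos
  have he := F.e_pos
  simp only [Quiet, not_forall] at hloud
  choose! n hdec hndec using hloud
  have hfiber : ∀ m ∈ s.image n, ((s.filter (n · = m)).card : ℝ) ≤ W / S.Δ + 4 := by
    intro m _
    refine (card_le_of_mem_isolatedTimes hΔ (d := W + 3 * S.Δ) (by linarith)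
      (fun τ hτ => hs τ (Finset.mem_of_mem_filter τ hτ))
      fun τ hτ τ' hτ' => ?_).trans_eq (by field_simp; ring)
    obtain ⟨hτs, rfl⟩ := Finset.mem_filter.1 hτ
    obtain ⟨hτ's, hn⟩ := Finset.mem_filter.1 hτ'
    have hlt := F.lt_sub_of_not_decided hn.le (hndec τ' hτ's) (hdec τ hτs)
    rw [hn, sub_self, zero_mul] at hlt
    linarith
  have himage : ((s.image n).card : ℝ) ≤ (z - x + W + 3 * S.Δ) / S.e + 1 := by
    refine card_le_of_forall_le_abs_sub (fun m : ℕ => m * S.e) he (by linarith)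
      (fun m _ m' _ hne => ?_) (fun m hm m' hm' => ?_)
    · rw [← sub_mul, abs_mul, abs_of_pos he]
      refine le_mul_of_one_le_left he.le ?_
      exact_mod_cast Int.one_le_abs (sub_ne_zero.2 (Nat.cast_injective.ne hne))
    · obtain ⟨τ, hτ, rfl⟩ := Finset.mem_image.1 hm
      obtain ⟨τ', hτ', rfl⟩ := Finset.mem_image.1 hm'
      rcases le_total (n τ) (n τ') with h | h
      · linarith [F.lt_sub_of_not_decided h (hndec τ hτ) (hdec τ' hτ'), (hs τ hτ).1.2.1,
          (hs τ' hτ').1.2.2]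
      · have : (n τ' : ℝ) * S.e ≤ n τ * S.e := by gcongr
        linarith
  calc (s.card : ℝ) = ∑ m ∈ s.image n, ((s.filter (n · = m)).card : ℝ) := by
        exact_mod_cast Finset.card_eq_sum_card_image n s
    _ ≤ ∑ m ∈ s.image n, (W / S.Δ + 4) := Finset.sum_le_sum hfiber
    _ = (W / S.Δ + 4) * (s.image n).card := by rw [Finset.sum_const, nsmul_eq_mul, mul_comm]
    _ ≤ _ := by gcongr

theorem Settled.ncard_isolatedTimes_le (E : Settled S O R W T₀ N)
    (hfin : ∀ z, (O.honestTimes ∩ Set.Iic z).Finite) {x z : ℝ} (hxz : x ≤ z) (hzN : z ≤ N)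
    {d : ℝ} (hd : 0 ≤ d) (hT₀ : T₀ ≤ x + d) :
    (isolatedTimes O.honestTimes S.Δ x z).ncard ≤ (goodTimes S O R W T₀ N x z).ncard +
      (W / S.Δ + 4) * ((z - x + W + 3 * S.Δ) / S.e + 1) + (d / S.Δ + 3) := by
  classical
  have hΔ := E.Δ_pos
  have hfinite : (isolatedTimes O.honestTimes S.Δ x z).Finite :=
    (hfin z).subset fun τ hτ => ⟨hτ.1.1, hτ.1.2.2⟩
  obtain ⟨I, hI⟩ := hfinite.exists_finset_coe
  have hmem {p : ℝ → Prop} [DecidablePred p] :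
      ∀ τ ∈ I.filter p, τ ∈ isolatedTimes O.honestTimes S.Δ x z :=
    fun τ hτ => hI ▸ Finset.mem_of_mem_filter τ hτ
  have hloud := E.card_le_of_not_quiet E.W_nonneg hxz (hmem (p := (¬ Quiet S R W ·)))
    fun τ hτ => (Finset.mem_filter.1 hτ).2
  have hearly : ((I.filter (· < T₀ + 2 * S.Δ)).card : ℝ) ≤ d / S.Δ + 3 := by
    refine (card_le_of_mem_isolatedTimes hΔ (d := d + 2 * S.Δ) (by linarith) hmem
      fun τ hτ τ' hτ' => ?_).trans_eq (by field_simp; ring)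
    linarith [(hmem τ hτ).1.2.1, (Finset.mem_filter.1 hτ').2]
  have hgood : ((I.filter fun τ => Quiet S R W τ ∧ T₀ + 2 * S.Δ ≤ τ).card : ℝ) ≤
      (goodTimes S O R W T₀ N x z).ncard := by
    rw [← Set.ncard_coe_finset]
    refine Nat.cast_le.2 (Set.ncard_le_ncard (fun τ hτ => ?_)
      ((hfin z).subset fun τ hτ => ⟨hτ.2.mem, hτ.1.2⟩))
    rw [Finset.mem_coe] at hτ
    obtain ⟨⟨hτH, hτxz⟩, hiso⟩ := hmem τ hτ
    obtain ⟨-, hquiet, hlate⟩ := Finset.mem_filter.1 hτ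
    exact ⟨hτxz, hτH, hiso, hquiet, hlate, hτxz.2.trans hzN⟩
  have hcover : (I.card : ℝ) ≤ (I.filter fun τ => Quiet S R W τ ∧ T₀ + 2 * S.Δ ≤ τ).card +
      (I.filter (¬ Quiet S R W ·)).card + (I.filter (· < T₀ + 2 * S.Δ)).card := by
    norm_cast
    refine (Finset.card_le_card fun τ hτ => ?_).trans ((Finset.card_union_le _ _).trans
      (Nat.add_le_add_right (Finset.card_union_le _ _) _))
    simp only [Finset.mem_union, Finset.mem_filter, hτ, true_and, ← not_lt]
    tauto
  rw [← hI, Set.ncard_coe_finset]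
  linarith

/-- The numerical condition compares the number of blocks in an interval of `len` slots with the
number of convergence opportunities, less those that are early or close to a decision. -/
theorem Typical.dominant (hT : Typical S O κ b M y ρ) (E : Settled S O R (7 * S.Δ * (M + 2)) T₀ N)
    (hN : N ≤ (b - 5) * S.Δ) (hκ : 32 ≤ κ) (hy : 0 ≤ y) (hρ : 0 ≤ ρ) {C' : ℝ} (hC' : 0 < C')
    (hrate : ∀ len : ℝ, κ ≤ len → ρ * (len + 2) + 2 * ((7 * M + 18) *
      ((len + 7 * M + 17) * S.Δ / S.e + 1)) + 2 * (len / C' + 3) < 2 * (y * (len - 8))) :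
    Dominant S O R (7 * S.Δ * (M + 2)) T₀ N (C' * T₀) (κ * S.Δ) where
  toSettled := E
  finite_minedBlocks := hT.minedBlocks_finite
  mined_lt x z hx hxz hz hzN := by
    have hΔ := E.Δ_pos
    have he := E.e_pos
    have hx0 := E.nonneg_of_goodTime hx
    have hκ' : (32 : ℝ) ≤ κ := by exact_mod_cast hκ
    obtain ⟨len, rfl⟩ : ∃ len, z = x + len * S.Δ :=
      ⟨(z - x) / S.Δ, by rw [div_mul_cancel₀ _ hΔ.ne', add_sub_cancel]⟩
    have hκlen : κ ≤ len := le_of_mul_le_mul_right (by linarith) hΔ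
    have hlenb : len + 5 ≤ b := le_of_mul_le_mul_right (by linarith) hΔ
    have hmined := hT.mined_le hΔ hρ hx0 (by linarith) hκlen (by linarith) le_rfl
    have hiso := hT.le_ncard_isolatedTimes hΔ hy hx0 (by linarith) hκlen (by linarith)
    have hlen : 0 ≤ len := by linarith
    have hd : 0 ≤ len / C' * S.Δ := by positivity
    have hearly : T₀ ≤ x + len / C' * S.Δ := by
      rcases hx with rfl | hx
      · rw [zero_add, div_mul_eq_mul_div, le_div_iff₀ hC']
        linarith
      · linarith [hx.late]
    have hgood := E.ncard_isolatedTimes_le hT.finite_honest (x := x)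
      (z := x + len * S.Δ - 2 * S.Δ) (by nlinarith) (by linarith) hd hearly
    have hW : 7 * S.Δ * (M + 2) / S.Δ + 4 = 7 * M + 18 := by field_simp; ring
    have hloud : (x + len * S.Δ - 2 * S.Δ - x + 7 * S.Δ * (M + 2) + 3 * S.Δ) / S.e ≤
        (len + 7 * M + 17) * S.Δ / S.e := by gcongr; linarith
    rw [hW, mul_div_cancel_right₀ _ hΔ.ne'] at hgood
    have hmul := mul_le_mul_of_nonneg_left (add_le_add_left hloud 1)
      (show (0 : ℝ) ≤ 7 * M + 18 by positivity)
    have := hrate len hκlen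
    rw [← Nat.cast_lt (α := ℝ)]
    push_cast
    linarith

end Typical

section Security

variable {Node : Type u} {S : Setting Node} {O : Oracle Node} {R : Run Node}
  {κ b M : ℕ} {y ρ T C' : ℝ}

/-! ### Security in typical outcomes -/

/-- Numerical conditions under which typical outcomes are secure up to time `T`. The condition
`rate` is that of `Typical.dominant`. -/
structure Suitable (S : Setting Node) (κ b M : ℕ) (y ρ T C' : ℝ) : Prop where
  y_nonneg : 0 ≤ y
  ρ_nonneg : 0 ≤ ρ
  one_le_M : 1 ≤ M
  one_le_C' : 1 ≤ C'
  le_κ : 32 ≤ κ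
  κ_le : κ + 4 ≤ b
  Δ_le_e : S.Δ ≤ S.e
  time_le : T ≤ (b - 5) * S.Δ
  depth : ρ * (κ + 4) < S.k
  M_le : 2 * C' * (7 * M + 8) ≤ κ
  rate : ∀ len : ℝ, κ ≤ len → ρ * (len + 2) + 2 * ((7 * M + 18) *
    ((len + 7 * M + 17) * S.Δ / S.e + 1)) + 2 * (len / C' + 3) < 2 * (y * (len - 8))

theorem Suitable.add_le_of_le_mined (P : Suitable S κ b M y ρ T C') (hT : Typical S O κ b M y ρ)
    (hΔ : 0 < S.Δ) {x z : ℝ} (hx : 0 ≤ x) (hz : z ≤ T) (h : S.k ≤ mined O x z) :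
    x + (κ + 2) * S.Δ ≤ z := by
  have hκ : ((κ + 4 : ℕ) : ℝ) ≤ b := by exact_mod_cast P.κ_le
  push_cast at hκ
  have hdepth : ρ * (κ + 2 + 2) < S.k := by linarith [P.depth]
  exact hT.add_le_of_le_mined hΔ P.ρ_nonneg (by linarith) (by linarith) hdepth hx
    (by linarith [P.time_le]) h

theorem Suitable.dominant {t T₀ : ℝ} (P : Suitable S κ b M y ρ T C')
    (hT : Typical S O κ b M y ρ) (ht : t ≤ T) (E : Settled S O R (7 * S.Δ * (M + 2)) T₀ t) :
    Dominant S O R (7 * S.Δ * (M + 2)) T₀ t (C' * T₀) (κ * S.Δ) :=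
  hT.dominant E (ht.trans P.time_le) P.le_κ P.y_nonneg P.ρ_nonneg (by linarith [P.one_le_C']) P.rate

theorem Suitable.exists_leader (P : Suitable S κ b M y ρ T C') (hT : Typical S O κ b M y ρ)
    (F : Fair S O R) {n : ℕ} {t : ℝ} (htT : t ≤ T) (hd : Decided S R n t) {p : ℕ}
    (hp : 4 * S.Δ * p ≤ t) : ∃ q, p ≤ q ∧ q < p + M ∧ O.leader n q ∈ S.honestCkpts := by
  have hΔ := F.Δ_pos
  have htb : t ≤ b * S.Δ := by linarith [P.time_le]
  have hn : (n : ℝ) * S.Δ ≤ b * S.Δ :=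
    ((mul_le_mul_of_nonneg_left P.Δ_le_e n.cast_nonneg).trans (F.le_of_decided hd)).trans htb
  have hp : (p : ℝ) * S.Δ ≤ b * S.Δ := by nlinarith [mul_nonneg p.cast_nonneg hΔ.le]
  exact hT.exists_leader n (by exact_mod_cast le_of_mul_le_mul_right hn hΔ) p
    (by exact_mod_cast le_of_mul_le_mul_right hp hΔ)

theorem Suitable.decided_or_recent (P : Suitable S κ b M y ρ T C') (hT : Typical S O κ b M y ρ)
    (F : Fair S O R) {n : ℕ} {σ : ℝ} (hσ : R.gst ≤ σ)
    (hready : ∀ i ∈ S.honestCkpts, Ready S R i n 0 σ) :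
    Decided S R n (σ + 7 * S.Δ * (M + 1)) ∨ Recent S R (7 * S.Δ * (M + 2)) T n := by
  refine or_iff_not_imp_left.2 fun hnd g hg t ht v hc B hB => ?_
  obtain ⟨i, hi, s, -, hst, hBi, hd⟩ := (F.certified_fresh P.one_le_M hσ hready hg hc
    (fun _ => P.exists_leader hT F ht ⟨g, hg, v, hc⟩) hB).resolve_left hnd
  exact ⟨i, hi, s, hst, hBi, hd.mono (by linarith [F.Δ_pos])⟩

theorem Suitable.recent_succ_of_not_decided (P : Suitable S κ b M y ρ T C')
    (hT : Typical S O κ b M y ρ) (F : Fair S O R) {n : ℕ} (hn : ¬ Decided S R n R.gst) :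
    Recent S R (7 * S.Δ * (M + 2)) T (n + 1) := by
  intro g hg t ht v hc B hB
  obtain ⟨i, hi, p, -, s, hs, hst, hBi, -⟩ := F.endorsed_of_certified hg hc B hB
  have hds : Decided S R n (s - S.e) :=
    F.decided_of_started_succ (started_of_start_eq hi hs le_rfl)
  have hgs : R.gst < s - S.e := by
    by_contra! hle
    exact hn (hds.mono hle)
  have he := F.e_pos
  have hΔ := F.Δ_pos
  have hready : ∀ j ∈ S.honestCkpts, Ready S R j (n + 1) 0 (s + S.Δ) := fun j hj =>
    hds.relay F.adm hj.1 (by linarith) (by linarith)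
  rcases P.decided_or_recent hT F (by linarith) hready with hd | hrec
  · exact ⟨i, hi.1, s, hst, hBi, hd.mono (by linarith)⟩
  · exact hrec g hg t ht v hc B hB

theorem Fair.settled_gst (F : Fair S O R) {W t : ℝ} (hW : 0 ≤ W) {n : ℕ}
    (hn : Decided S R n R.gst) (hnd : ¬ Decided S R (n + 1) t) : Settled S O R W R.gst t where
  toFair := F
  gst_le := le_rfl
  W_nonneg := hW
  recent _ hm := Or.inl (F.decided_of_le (Nat.lt_succ_iff.1 (not_le.1 fun hle =>
    hnd (F.decided_of_le hle hm))) hn)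

/-- Between the endorsement of a value and the decision of the iteration no other iteration is
decided, so that the checkpoint block of the value is stable. -/
theorem Suitable.recent_succ_of_decided (P : Suitable S κ b M y ρ T C')
    (hT : Typical S O κ b M y ρ) (F : Fair S O R) {n : ℕ} (hn : Decided S R n R.gst)
    (hd : Decided S R (n + 1) (R.gst + S.e + S.Δ * (7 * M + 8)))
    (hnd : ¬ Decided S R (n + 1) ((C' + 1) * R.gst + S.Δ * (7 * M + 8))) :
    Recent S R (7 * S.Δ * (M + 2)) T (n + 1) := by
  intro g hg t ht v hc B hB
  obtain ⟨i, hi, p, -, s, hs, hst, hBi, hv⟩ := F.endorsed_of_certified hg hc B hB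
  have hds : Decided S R n (s - S.e) :=
    F.decided_of_started_succ (started_of_start_eq hi hs le_rfl)
  have hes := F.decided_nonneg hds
  have he := F.e_pos
  have hΔ := F.Δ_pos
  have hlate : C' * R.gst ≤ s := by
    by_contra! hlt
    exact hnd (hd.mono (by linarith))
  set W := 7 * S.Δ * ((M : ℝ) + 2)
  have hMΔ : 0 ≤ S.Δ * (M : ℝ) := by positivity
  have hdt : Decided S R (n + 1) t := ⟨g, hg, v, hc⟩
  by_cases hdW : Decided S R (n + 1) (s + W)
  · exact ⟨i, hi.1, s, hst, hBi, hdW⟩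
  obtain ⟨x, hsx, hdx, hdx'⟩ := exists_not_and_add_of_monotone (decided_monotone _) hΔ hdW hdt
  have hxt : x < t := by
    by_contra! htx
    exact hdx (hdt.mono htx)
  have D := P.dominant hT (hxt.le.trans ht) (F.settled_gst (by positivity) hn hdx)
  have hB0 := F.adm.time_nonneg hv (mem_of_ckptBlock_eq hB)
  have hold := P.add_le_of_le_mined hT hΔ hB0 (by linarith)
    (F.adm.le_mined_of_ckptBlock_eq (by linarith) hv hB (D.finite_minedBlocks _ _))
  refine ⟨i, hi.1, x - S.Δ, by linarith, ?_, hdx'.mono (by linarith)⟩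
  exact D.mem_chain_of_le (by linarith) hlate (by linarith) (by linarith) hi.1 hi.1 hBi
    (by linarith)

theorem Suitable.settled (P : Suitable S κ b M y ρ T C') (hT : Typical S O κ b M y ρ)
    (F : Fair S O R) :
    Settled S O R (7 * S.Δ * (M + 2)) ((C' + 1) * R.gst + S.Δ * (7 * M + 8)) T := by
  have hΔ := F.Δ_pos
  have hgst := F.adm.gst_nonneg
  have hMΔ : 0 ≤ S.Δ * (M : ℝ) := by positivity
  have hC'gst : 0 ≤ C' * R.gst := mul_nonneg (by linarith [P.one_le_C']) hgst
  refine ⟨F, by linarith, by positivity, fun m _ => or_iff_not_imp_left.2 fun hnd => ?_⟩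
  rcases m with - | n
  · exact (P.decided_or_recent (n := 0) hT F le_rfl fun _ _ => hgst).resolve_left fun hd =>
      hnd (hd.mono (by linarith))
  by_cases hn : Decided S R n R.gst
  · have hready : ∀ j ∈ S.honestCkpts, Ready S R j (n + 1) 0 (R.gst + S.Δ + S.e) := fun j hj =>
      hn.relay F.adm hj.1 (by linarith) (by linarith)
    refine (P.decided_or_recent hT F (by linarith [F.e_pos]) hready).elim (fun hd => ?_) id
    exact P.recent_succ_of_decided hT F hn (hd.mono (by linarith)) hnd
  · exact P.recent_succ_of_not_decided hT F hn

theorem lt_of_lt_slot (hΔ : 0 < S.Δ) {C t : ℝ} (hC : 1 ≤ C)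
    (h : C * gstSlot S R < slot S t) : C * R.gst < t := by
  have hlt : (slot S t : ℝ) < t / S.Δ + 1 := by
    refine Nat.ceil_lt_add_one (Nat.ceil_pos.1 (Nat.cast_pos (α := ℝ).1 ?_)).le
    exact (mul_nonneg (by linarith) (Nat.cast_nonneg _)).trans_lt h
  have hle : R.gst / S.Δ + 1 ≤ gstSlot S R := by
    rw [gstSlot]
    push_cast
    linarith [Nat.le_ceil (R.gst / S.Δ)]
  have hdiv : C * R.gst / S.Δ < t / S.Δ := by
    rw [mul_div_assoc]
    nlinarith
  rwa [div_lt_div_iff_of_pos_right hΔ] at hdiv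

theorem Suitable.le_of_le_mined (P : Suitable S κ b M y ρ T C') (hT : Typical S O κ b M y ρ)
    (hΔ : 0 < S.Δ) {C : ℝ} (hC : 2 * C' * (C' + 1) ≤ C) (hgst : 0 ≤ R.gst) {z : ℝ} (hz : z ≤ T)
    (hlt : C * R.gst < z) (h : S.k ≤ mined O 0 z) :
    C' * ((C' + 1) * R.gst + S.Δ * (7 * M + 8)) ≤ z := by
  have hκz := P.add_le_of_le_mined hT hΔ le_rfl hz h
  have hMΔ := mul_le_mul_of_nonneg_right P.M_le hΔ.le
  have hCgst := mul_le_mul_of_nonneg_right hC hgst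
  linarith

theorem Suitable.commonPrefixAfter (P : Suitable S κ b M y ρ T C') (hT : Typical S O κ b M y ρ)
    (F : Fair S O R) {C : ℝ} (hC : 2 * C' * (C' + 1) ≤ C) :
    CommonPrefixAfter S R S.k (C * gstSlot S R) T := by
  intro h₁ hh₁ h₂ hh₂ t₁ t₂ hs h12 h2T
  have hΔ := F.Δ_pos
  have hgst := F.adm.gst_nonneg
  have hC1 : 1 ≤ C := by nlinarith [P.one_le_C']
  have hlt := lt_of_lt_slot hΔ hC1 hs
  exact (P.dominant hT le_rfl (P.settled hT F)).common_prefix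
    (fun x z hx hz h => by linarith [P.add_le_of_le_mined hT hΔ hx hz h])
    ((mul_nonneg (by linarith) hgst).trans hlt.le)
    (P.le_of_le_mined hT hΔ hC hgst (h12.trans h2T) hlt) h12 h2T hh₁ hh₂

theorem Suitable.chainQualityAfter (P : Suitable S κ b M y ρ T C') (hT : Typical S O κ b M y ρ)
    (F : Fair S O R) {C : ℝ} (hC : 2 * C' * (C' + 1) ≤ C) :
    ChainQualityAfter S R S.k (C * gstSlot S R) (C * gstSlot S R) T := by
  intro h hh t hs htT L hL hLk hLb
  have hΔ := F.Δ_pos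
  have hgst := F.adm.gst_nonneg
  have hC1 : 1 ≤ C := by nlinarith [P.one_le_C']
  have hk : 0 < S.k :=
    Nat.cast_pos.1 ((mul_nonneg P.ρ_nonneg (by positivity)).trans_lt P.depth)
  obtain ⟨b₀, hb₀⟩ := List.exists_mem_of_length_pos (hLk ▸ hk)
  exact (P.dominant hT le_rfl (P.settled hT F)).chain_quality
    (fun x z hx hz h => by linarith [P.add_le_of_le_mined hT hΔ hx hz h])
    ((mul_nonneg (by linarith) hgst).trans (lt_of_lt_slot hΔ hC1 hs).le) htT hh hL hLk
    (fun b hb => (hLb b hb).1) fun z hz hLz => P.le_of_le_mined hT hΔ hC hgst hz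
      ((lt_of_lt_slot hΔ hC1 (hLb b₀ hb₀).2).trans_le (hLz b₀ hb₀))

end Security

section TailBounds

/-! ### Tail bounds -/

theorem hasSum_exp_mul_poissonMeasure (r : NNReal) (θ : ℝ) :
    HasSum (fun n : ℕ => Real.exp (-r) * r ^ n / n.factorial * Real.exp (θ * n))
      (Real.exp (r * (Real.exp θ - 1))) := by
  have h := (NormedSpace.expSeries_div_hasSum_exp ((r : ℝ) * Real.exp θ)).mul_left (Real.exp (-r))
  rw [← Real.exp_eq_exp_ℝ, ← Real.exp_add] at h
  convert! h using 1
  · ext n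
    rw [mul_comm θ, Real.exp_nat_mul]
    ring
  · ring_nf

theorem integrable_exp_mul_poissonMeasure (r : NNReal) (θ : ℝ) :
    Integrable (fun n : ℕ => Real.exp (θ * n)) (poissonMeasure r) := by
  refine integrable_poissonMeasure_iff.2 ?_
  simp only [Real.norm_eq_abs, Real.abs_exp]
  exact (hasSum_exp_mul_poissonMeasure r θ).summable

theorem mgf_natCast_poissonMeasure (r : NNReal) (θ : ℝ) :
    mgf (fun n : ℕ => (n : ℝ)) (poissonMeasure r) θ = Real.exp (r * (Real.exp θ - 1)) :=
  (integral_poissonMeasure r _).trans (hasSum_exp_mul_poissonMeasure r θ).tsum_eq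

/-- Exponent in the tail bounds for Poisson variables of rate at most `ρ`: the Chernoff bound with
parameter `min 1 (ε / (2 * (ρ + 1)))` yields it. -/
noncomputable def tailExponent (ρ ε : ℝ) : ℝ := min 1 (ε / (2 * (ρ + 1))) * ε / 2

theorem tailExponent_pos {ρ ε : ℝ} (hρ : 0 ≤ ρ) (hε : 0 < ε) : 0 < tailExponent ρ ε := by
  have : 0 < min 1 (ε / (2 * (ρ + 1))) := lt_min one_pos (by positivity)
  unfold tailExponent
  positivity

theorem tailExponent_le {ρ ε : ℝ} (hρ : 0 ≤ ρ) (hε : 0 < ε) : tailExponent ρ ε ≤ 2 * ε ^ 2 := by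
  have h : min 1 (ε / (2 * (ρ + 1))) ≤ ε :=
    (min_le_right _ _).trans (div_le_self hε.le (by linarith))
  unfold tailExponent
  nlinarith

theorem poissonMeasure_real_le_exp {r ρ ε x : ℝ} (hr : 0 ≤ r) (hrρ : r ≤ ρ) (hε : 0 < ε)
    (hx : 0 ≤ x) : (poissonMeasure (r * x).toNNReal).real {n : ℕ | (r + ε) * x ≤ n} ≤
      Real.exp (-tailExponent ρ ε * x) := by
  set θ := min 1 (ε / (2 * (ρ + 1)))
  have hρ : 0 ≤ ρ := hr.trans hrρ
  have hθ : 0 < θ := lt_min one_pos (by positivity)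
  have hθ1 : θ ≤ 1 := min_le_left _ _
  have hθε : θ * (2 * (ρ + 1)) ≤ ε := (le_div_iff₀ (by positivity)).1 (min_le_right _ _)
  have hexp : Real.exp θ - 1 ≤ θ + θ ^ 2 := by
    have := (abs_le.1 (Real.abs_exp_sub_one_sub_id_le (abs_le.2 ⟨by linarith, hθ1⟩))).2
    linarith
  have hrθ : r * θ ≤ ε / 2 := by nlinarith
  refine (measure_ge_le_exp_mul_mgf _ hθ.le (integrable_exp_mul_poissonMeasure _ _)).trans ?_
  rw [mgf_natCast_poissonMeasure, Real.coe_toNNReal _ (by positivity), ← Real.exp_add,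
    Real.exp_le_exp]
  calc -θ * ((r + ε) * x) + r * x * (Real.exp θ - 1)
      ≤ -θ * ((r + ε) * x) + r * x * (θ + θ ^ 2) := by gcongr
    _ = x * θ * (r * θ - ε) := by ring
    _ ≤ x * θ * (ε / 2 - ε) := by gcongr
    _ = -(θ * ε / 2) * x := by ring

theorem converges_iff_forall_count {Ω : Type v} (H : Ω → Set ℝ) (Δ : ℝ) (j : ℕ) (ω : Ω) :
    Converges (H ω) Δ j ↔ ∀ s : Fin 3,
      count H ((j + s : ℕ) * Δ) ((j + s + 1 : ℕ) * Δ) ω = if s = 1 then 1 else 0 := by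
  rw [Fin.forall_fin_succ, Fin.forall_fin_two]
  rfl

variable {Ω : Type v} [MeasurableSpace Ω] {μ : Measure Ω} {r ρ Δ ε : ℝ} {H A : Ω → Set ℝ}

theorem IsPoissonProcess.map_count_slots (hA : IsPoissonProcess μ r A) (hΔ : 0 ≤ Δ) (a m : ℕ) :
    μ.map (count A (a * Δ) ((a + m : ℕ) * Δ)) = poissonMeasure (r * Δ * m).toNNReal := by
  have hle : (a : ℝ) * Δ ≤ (a + m : ℕ) * Δ := by gcongr; lia
  rw [hA.law _ _ (by positivity) hle]
  push_cast
  ring_nf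

theorem IsPoissonProcess.measure_lt_count_le (hA : IsPoissonProcess μ r A) (hr : 0 ≤ r)
    (hΔ : 0 ≤ Δ) (hρ : r * Δ ≤ ρ) (hε : 0 < ε) (a m : ℕ) :
    μ {ω | (r * Δ + ε) * m < count A (a * Δ) ((a + m : ℕ) * Δ) ω} ≤
      ENNReal.ofReal (Real.exp (-tailExponent ρ ε * m)) := by
  calc μ {ω | (r * Δ + ε) * m < count A (a * Δ) ((a + m : ℕ) * Δ) ω}
      ≤ μ (count A (a * Δ) ((a + m : ℕ) * Δ) ⁻¹' {n : ℕ | (r * Δ + ε) * m ≤ n}) :=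
        measure_mono fun _ hω => le_of_lt (α := ℝ) hω
    _ = poissonMeasure (r * Δ * m).toNNReal {n : ℕ | (r * Δ + ε) * m ≤ n} := by
        rw [← hA.map_count_slots hΔ a m,
          Measure.map_apply (hA.measurable_count _ _) MeasurableSet.of_discrete]
    _ ≤ ENNReal.ofReal (Real.exp (-tailExponent ρ ε * m)) := by
        rw [← ofReal_measureReal]
        exact ENNReal.ofReal_le_ofReal
          (poissonMeasure_real_le_exp (by positivity) hρ hε m.cast_nonneg)

theorem IsPoissonProcess.measure_count_slot_eq (hH : IsPoissonProcess μ r H) (hr : 0 ≤ r)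
    (hΔ : 0 ≤ Δ) (j n : ℕ) : μ {ω | count H (j * Δ) ((j + 1 : ℕ) * Δ) ω = n} =
      ENNReal.ofReal (Real.exp (-(r * Δ)) * (r * Δ) ^ n / n.factorial) := by
  have h := poissonMeasure_singleton (r * Δ * (1 : ℕ)).toNNReal n
  rw [← hH.map_count_slots hΔ j 1, Measure.map_apply (hH.measurable_count _ _)
    (measurableSet_singleton n), Nat.cast_one, mul_one, Real.coe_toNNReal _ (by positivity)] at h
  exact h

theorem IsPoissonProcess.iIndepFun_count_slots (hH : IsPoissonProcess μ r H) (hΔ : 0 ≤ Δ) :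
    iIndepFun (fun j : ℕ => count H (j * Δ) ((j + 1 : ℕ) * Δ)) μ :=
  hH.indep_increments (fun j => j * Δ) (by simp) fun _ _ hij =>
    mul_le_mul_of_nonneg_right (Nat.cast_le.2 hij) hΔ

theorem IsPoissonProcess.measurableSet_converges (hH : IsPoissonProcess μ r H) (Δ : ℝ) (j : ℕ) :
    MeasurableSet {ω | Converges (H ω) Δ j} := by
  simp only [converges_iff_forall_count, Set.ofPred_forall]
  exact MeasurableSet.iInter fun _ => hH.measurable_count _ _ (measurableSet_singleton _)

theorem IsPoissonProcess.measure_biInter_converges (hH : IsPoissonProcess μ r H) (hr : 0 ≤ r)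
    (hΔ : 0 ≤ Δ) (a : ℕ) (F : Finset ℕ) : μ (⋂ i ∈ F, {ω | Converges (H ω) Δ (a + 3 * i)}) =
      ∏ _i ∈ F, ENNReal.ofReal (r * Δ * Real.exp (-3 * (r * Δ))) := by
  have hinj : Function.Injective fun x : ℕ × Fin 3 => a + 3 * x.1 + x.2 := by
    rintro ⟨i, s⟩ ⟨j, t⟩ h
    simp only at h
    ext <;> simp only <;> lia
  have hprod := ((hH.iIndepFun_count_slots hΔ).precomp hinj).measure_inter_preimage_eq_mul
    (F ×ˢ Finset.univ) (sets := fun x => {if x.2 = 1 then 1 else 0})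
    (fun _ _ => MeasurableSet.of_discrete)
  rw [Finset.prod_product] at hprod
  convert! hprod using 1
  · congr 1
    ext ω
    simp only [Set.mem_iInter, Set.mem_ofPred_eq, converges_iff_forall_count, Finset.mem_product,
      Finset.mem_univ, and_true, Prod.forall, Set.mem_preimage, Set.mem_singleton_iff]
    exact forall_congr' fun i => forall_comm
  · refine Finset.prod_congr rfl fun i _ => ?_
    have hslot (s : Fin 3) :=
      hH.measure_count_slot_eq hr hΔ (a + 3 * i + s) (if s = 1 then 1 else 0)
    rw [Fin.prod_univ_three]
    refine Eq.trans ?_ (congrArg₂ (· * ·) (congrArg₂ (· * ·) (hslot 0) (hslot 1)) (hslot 2)).symm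
    rw [← ENNReal.ofReal_mul (by positivity), ← ENNReal.ofReal_mul (by positivity),
      show -3 * (r * Δ) = -(r * Δ) + -(r * Δ) + -(r * Δ) by ring, Real.exp_add, Real.exp_add]
    simp [mul_comm, mul_left_comm]

theorem IsPoissonProcess.measure_converges (hH : IsPoissonProcess μ r H) (hr : 0 ≤ r) (hΔ : 0 ≤ Δ)
    (a i : ℕ) : μ {ω | Converges (H ω) Δ (a + 3 * i)} =
      ENNReal.ofReal (r * Δ * Real.exp (-3 * (r * Δ))) := by
  simpa only [Finset.mem_singleton, Set.iInter_iInter_eq_left, Finset.prod_singleton] using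
    hH.measure_biInter_converges hr hΔ a {i}

theorem IsPoissonProcess.iIndepSet_converges (hH : IsPoissonProcess μ r H) (hr : 0 ≤ r)
    (hΔ : 0 ≤ Δ) (a : ℕ) : iIndepSet (fun i => {ω | Converges (H ω) Δ (a + 3 * i)}) μ := by
  refine (iIndepSet_iff_meas_biInter fun _ => hH.measurableSet_converges _ _).2 fun F => ?_
  rw [hH.measure_biInter_converges hr hΔ a F]
  exact Finset.prod_congr rfl fun i _ => (hH.measure_converges hr hΔ a i).symm

open Classical in
theorem measureReal_card_filter_mem_lt_le {s : ℕ → Set Ω} (hs : iIndepSet s μ)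
    (hsm : ∀ i, MeasurableSet (s i)) {p : ℝ} (hp : ∀ i, μ.real (s i) = p) (hε : 0 ≤ ε) (m : ℕ) :
    μ.real {ω | (((Finset.range m).filter fun i => ω ∈ s i).card : ℝ) < (p - ε) * m} ≤
      Real.exp (-(2 * ε ^ 2) * m) := by
  have := hs.isProbabilityMeasure
  rcases m.eq_zero_or_pos with rfl | hm
  · simp
  set X : ℕ → Ω → ℝ := fun i ω => -(s i).indicator 1 ω
  have hX_mean (i : ℕ) : μ[X i] = -p := by
    rw [integral_neg, integral_indicator_one (hsm i), hp]
  have hX_indep : iIndepFun (fun i ω => X i ω - μ[X i]) μ :=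
    hs.iIndepFun_indicator.comp (fun i (x : ℝ) => -x - ∫ ω, X i ω ∂μ) fun i => by fun_prop
  have hX_mgf : ∀ i < m, HasSubgaussianMGF (fun ω => X i ω - μ[X i])
      ((‖(0 : ℝ) - (-1)‖₊ / 2) ^ 2) μ := by
    refine fun i _ => hasSubgaussianMGF_of_mem_Icc
      (measurable_one.indicator (hsm i)).neg.aemeasurable (ae_of_all _ fun ω => ?_)
    by_cases hω : ω ∈ s i <;> simp [X, hω]
  have hcard (ω : Ω) : ∑ i ∈ Finset.range m, (X i ω - μ[X i]) =
      p * m - ((Finset.range m).filter fun i => ω ∈ s i).card := by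
    simp only [hX_mean, sub_neg_eq_add, Finset.sum_add_distrib]
    simp [X, Set.indicator_apply]
    ring
  have hoeffding := HasSubgaussianMGF.measure_sum_range_ge_le_of_iIndepFun hX_indep hX_mgf
    (ε := ε * m) (by positivity)
  refine (measureReal_mono fun ω hω => ?_).trans (hoeffding.trans_eq ?_)
  · have hω : (((Finset.range m).filter fun i => ω ∈ s i).card : ℝ) < (p - ε) * m := hω
    rw [Set.mem_ofPred_eq, hcard]
    linarith
  · congr 1
    have : (m : ℝ) ≠ 0 := Nat.cast_ne_zero.2 hm.ne'
    push_cast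
    norm_num
    field_simp
    norm_num

open Classical in
theorem IsPoissonProcess.measure_card_converges_lt_le (hH : IsPoissonProcess μ r H) (hr : 0 ≤ r)
    (hΔ : 0 ≤ Δ) (hε : 0 ≤ ε) (a m : ℕ) :
    μ {ω | (((Finset.range m).filter fun i => Converges (H ω) Δ (a + 3 * i)).card : ℝ) <
        (r * Δ * Real.exp (-3 * (r * Δ)) - ε) * m} ≤
      ENNReal.ofReal (Real.exp (-(2 * ε ^ 2) * m)) := by
  have hs := hH.iIndepSet_converges hr hΔ a
  have := hs.isProbabilityMeasure
  rw [← ofReal_measureReal]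
  refine ENNReal.ofReal_le_ofReal (measureReal_card_filter_mem_lt_le hs
    (fun _ => hH.measurableSet_converges _ _) (fun i => ?_) hε m)
  rw [measureReal_def, hH.measure_converges hr hΔ, ENNReal.toReal_ofReal (by positivity)]

theorem measure_preimage_le_card_mul {ι : Type*} {X : Ω → ι} {p : ENNReal}
    (hX : ∀ i, μ {ω | X ω = i} ≤ p) (B : Finset ι) : μ (X ⁻¹' B) ≤ B.card * p := by
  have hB : X ⁻¹' B = ⋃ i ∈ B, {ω | X ω = i} := by
    ext
    simp
  rw [hB, ← nsmul_eq_mul]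
  exact (measure_biUnion_finset_le _ _).trans (Finset.sum_le_card_nsmul _ _ _ fun i _ => hX i)

theorem measure_forall_mem_le_pow {ι κ : Type*} {X : ι → Ω → κ}
    (hX : iIndepFun (m := fun _ => ⊤) X μ) {B : Set κ} {p : ENNReal}
    (hp : ∀ i, μ (X i ⁻¹' B) ≤ p) (s : Finset ι) :
    μ {ω | ∀ i ∈ s, X i ω ∈ B} ≤ p ^ s.card := by
  have hprod := hX.measure_inter_preimage_eq_mul s (sets := fun _ => B) fun _ _ => trivial
  have hset : {ω | ∀ i ∈ s, X i ω ∈ B} = ⋂ i ∈ s, X i ⁻¹' B := by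
    ext
    simp
  rw [hset, hprod]
  exact Finset.prod_le_pow_card _ _ _ fun i _ => hp i

theorem measure_corrupted_leader_le {Node : Type u} {S : Setting Node}
    (hbad : 3 * {i ∈ (S.ckpt : Set Node) | i ∉ S.honest}.ncard < S.ckpt.card) {X : Ω → S.ckpt}
    (hX : ∀ i, μ {ω | X ω = i} = (S.ckpt.card : ENNReal)⁻¹) :
    μ (X ⁻¹' {i | (i : Node) ∉ S.honest}) ≤ 3⁻¹ := by
  classical
  set bad : Finset S.ckpt := Finset.univ.filter fun i => (i : Node) ∉ S.honest
  have hcard : {i ∈ (S.ckpt : Set Node) | i ∉ S.honest}.ncard = bad.card := by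
    rw [← Finset.card_map (Function.Embedding.subtype _), ← Set.ncard_coe_finset]
    congr 1
    ext
    simp [bad, and_comm]
  rw [hcard] at hbad
  have hle : 3 * (bad.card : ENNReal) ≤ S.ckpt.card := by exact_mod_cast hbad.le
  calc μ (X ⁻¹' {i | (i : Node) ∉ S.honest}) = μ (X ⁻¹' bad) := by simp [bad]
    _ ≤ bad.card * (S.ckpt.card : ENNReal)⁻¹ := measure_preimage_le_card_mul (fun i => (hX i).le) _
    _ ≤ 3⁻¹ := by
      rw [ENNReal.le_inv_iff_mul_le, mul_right_comm, ← div_eq_mul_inv, mul_comm _ 3]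
      exact ENNReal.div_le_of_le_mul (by rwa [one_mul])

theorem measure_no_honest_leader_le {Node : Type u} {S : Setting Node}
    (hbad : 3 * {i ∈ (S.ckpt : Set Node) | i ∉ S.honest}.ncard < S.ckpt.card)
    {ld : ℕ × ℕ → Ω → S.ckpt}
    (hld : ∀ x i, μ {ω | ld x ω = i} = (S.ckpt.card : ENNReal)⁻¹)
    (hind : iIndepFun (m := fun _ => ⊤) ld μ) (n p M : ℕ) :
    μ {ω | ∀ q, p ≤ q → q < p + M → (ld (n, q) ω : Node) ∉ S.honest} ≤
      ENNReal.ofReal ((1 / 3) ^ M) := by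
  have hpow := measure_forall_mem_le_pow (hind.precomp (Prod.mk_right_injective n))
    (fun _ => measure_corrupted_leader_le hbad (hld _)) (Finset.Ico p (p + M))
  rw [Nat.card_Ico, Nat.add_sub_cancel_left] at hpow
  rw [ENNReal.ofReal_pow (by positivity), one_div, ENNReal.ofReal_inv_of_pos three_pos,
    ENNReal.ofReal_ofNat]
  simpa only [Finset.mem_Ico, and_imp, Set.mem_ofPred_eq] using hpow

end TailBounds

section Parameters

/-! ### Frequency of typical outcomes -/

variable {Node : Type u} {S : Setting Node} {Ω : Type v} [MeasurableSpace Ω] {μ : Measure Ω}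
  {r r' ε : ℝ} {H A : Ω → Set ℝ} {ld : ℕ × ℕ → Ω → S.ckpt}

theorem measure_and_le {p : Prop} {E : Set Ω} {δ : ENNReal} (h : p → μ E ≤ δ) :
    μ {ω | p ∧ ω ∈ E} ≤ δ := by
  by_cases hp : p <;> simp [hp, h]

theorem measure_exists_le_exists_le_le {E : ℕ → ℕ → Set Ω} {δ : ENNReal}
    (h : ∀ a m, μ (E a m) ≤ δ) (b : ℕ) :
    μ {ω | ∃ a ≤ b, ∃ m ≤ b, ω ∈ E a m} ≤ (b + 1) ^ 2 * δ := by
  have hE : {ω | ∃ a ≤ b, ∃ m ≤ b, ω ∈ E a m} =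
      ⋃ x ∈ Finset.range (b + 1) ×ˢ Finset.range (b + 1), E x.1 x.2 := by
    ext
    simp only [Set.mem_iUnion, Finset.mem_product, Finset.mem_range, Order.lt_add_one_iff]
    simp [and_assoc]
  rw [hE]
  refine (measure_biUnion_finset_le _ _).trans
    ((Finset.sum_le_card_nsmul _ _ _ fun x _ => h x.1 x.2).trans_eq ?_)
  simp [sq]

theorem exp_neg_mul_le_exp {c d : ℝ} (hc : 0 ≤ c) (hcd : c ≤ d) {κ m : ℕ} (h : κ ≤ 4 * m) :
    Real.exp (-d * m) ≤ Real.exp (-(c / 4) * κ) := by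
  have hκm : (κ : ℝ) ≤ 4 * m := by exact_mod_cast h
  refine Real.exp_le_exp.2 ?_
  nlinarith [mul_le_mul_of_nonneg_left hκm hc, mul_le_mul_of_nonneg_right hcd m.cast_nonneg]

open Classical in
theorem not_typical_imp {κ b M : ℕ} {y ρ : ℝ} {ω : Ω}
    (hH : IsPoissonProcess μ r H) (hA : IsPoissonProcess μ r' A)
    (hω : ¬ Typical S (oracleAt H A ld ω) κ b M y ρ) : ∃ a ≤ b, ∃ m ≤ b,
      (κ ≤ 4 * m ∧
        (((Finset.range m).filter fun i => Converges (H ω) S.Δ (a + 3 * i)).card : ℝ) < y * m) ∨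
      (κ ≤ 4 * m ∧ ρ * m < count H (a * S.Δ) ((a + m : ℕ) * S.Δ) ω +
        count A (a * S.Δ) ((a + m : ℕ) * S.Δ) ω) ∨
      ∀ q, m ≤ q → q < m + M → (ld (a, q) ω : Node) ∉ S.honest := by
  by_contra! hgood
  refine hω ⟨hH.locallyFinite ω, hA.locallyFinite ω, fun a ha m hm => (hgood a ha m hm).1,
    fun a ha m hm => (hgood a ha m hm).2.1, fun n hn p hp => ?_⟩
  obtain ⟨q, hpq, hqp, hq⟩ := (hgood n hn p hp).2.2
  exact ⟨q, hpq, hqp, hq, (ld (n, q) ω).2⟩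

theorem measure_lt_add_le {X Y : Ω → ℕ} {x x' : ℝ} {δ δ' : ENNReal}
    (hX : μ {ω | x < X ω} ≤ δ) (hY : μ {ω | x' < Y ω} ≤ δ') :
    μ {ω | x + x' < X ω + Y ω} ≤ δ + δ' := by
  refine (measure_mono fun ω hω => ?_).trans
    ((measure_union_le _ _).trans (add_le_add hX hY))
  by_contra hno
  simp only [Set.mem_union, Set.mem_ofPred_eq, not_or, not_lt] at hno hω
  linarith

theorem measure_not_typical_le (hH : IsPoissonProcess μ r H) (hA : IsPoissonProcess μ r' A)
    (hld : ∀ x i, μ {ω | ld x ω = i} = (S.ckpt.card : ENNReal)⁻¹)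
    (hind : iIndepFun (m := fun _ => ⊤) ld μ)
    (hbad : 3 * {i ∈ (S.ckpt : Set Node) | i ∉ S.honest}.ncard < S.ckpt.card)
    (hr : 0 ≤ r) (hr' : 0 ≤ r') (hΔ : 0 ≤ S.Δ) (hε : 0 < ε) (κ b M : ℕ) :
    μ {ω | ¬ Typical S (oracleAt H A ld ω) κ b M (r * S.Δ * Real.exp (-3 * (r * S.Δ)) - ε)
        ((r + r') * S.Δ + 2 * ε)} ≤
      ENNReal.ofReal ((b + 1) ^ 2 *
        (3 * Real.exp (-(tailExponent ((r + r') * S.Δ) ε / 4) * κ) + (1 / 3) ^ M)) := by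
  have hρ : 0 ≤ (r + r') * S.Δ := by positivity
  set c := tailExponent ((r + r') * S.Δ) ε
  have hc : 0 ≤ c := (tailExponent_pos hρ hε).le
  set δ := ENNReal.ofReal (Real.exp (-(c / 4) * κ))
  have hexp {d : ℝ} {m : ℕ} (hd : c ≤ d) (hm : κ ≤ 4 * m) :
      ENNReal.ofReal (Real.exp (-d * m)) ≤ δ :=
    ENNReal.ofReal_le_ofReal (exp_neg_mul_le_exp hc hd hm)
  have hrate (m : ℕ) : ((r + r') * S.Δ + 2 * ε) * m =
      (r * S.Δ + ε) * m + (r' * S.Δ + ε) * m := by ring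
  have hsum : ENNReal.ofReal ((b + 1) ^ 2 * (3 * Real.exp (-(c / 4) * κ) + (1 / 3) ^ M)) =
      (b + 1) ^ 2 * (δ + (δ + δ + ENNReal.ofReal ((1 / 3) ^ M))) := by
    rw [show 3 * Real.exp (-(c / 4) * κ) = Real.exp (-(c / 4) * κ) + (Real.exp (-(c / 4) * κ) +
      Real.exp (-(c / 4) * κ)) by ring, add_assoc, ENNReal.ofReal_mul (by positivity),
      ENNReal.ofReal_add (by positivity) (by positivity),
      ENNReal.ofReal_add (by positivity) (by positivity),
      ENNReal.ofReal_add (by positivity) (by positivity),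
      ENNReal.ofReal_pow (by positivity)]
    norm_cast
  rw [hsum]
  refine (measure_mono fun ω hω => not_typical_imp hH hA hω).trans
    (measure_exists_le_exists_le_le (fun a m => ?_) b)
  refine (measure_union_le _ _).trans (add_le_add (measure_and_le fun hm => ?_)
    ((measure_union_le _ _).trans (add_le_add (measure_and_le fun hm => ?_) ?_)))
  · exact (hH.measure_card_converges_lt_le hr hΔ hε.le a m).trans (hexp (tailExponent_le hρ hε) hm)
  · rw [hrate]
    exact measure_lt_add_le
      ((hH.measure_lt_count_le hr hΔ (by nlinarith) hε a m).trans (hexp le_rfl hm))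
      ((hA.measure_lt_count_le hr' hΔ (by nlinarith) hε a m).trans (hexp le_rfl hm))
  · exact measure_no_honest_leader_le hbad hld hind a m M

end Parameters

section Asymptotics

/-! ### Choice of the parameters -/

theorem rate_of_large {ρ y g K C' Δ e x len : ℝ} {M : ℕ} (hρ : 0 ≤ ρ) (hg : 0 < g)
    (hgap : 2 * y - ρ = g) (hK : 1 ≤ K) (hKg : 64 / g ≤ K) (hC' : 0 < C') (hCg : 8 / g ≤ C')
    (hΔ : 0 < Δ) (hx : 1 ≤ x) (hM : 7 * M + 18 ≤ 8 * x) (he : K * x * Δ ≤ e)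
    (hlarge : 2 * (2 * ρ + 16 * y + 150) < g * x) (hlen : x * x ≤ len) :
    ρ * (len + 2) + 2 * ((7 * M + 18) * ((len + 7 * M + 17) * Δ / e + 1)) + 2 * (len / C' + 3) <
      2 * (y * (len - 8)) := by
  have hlen0 : 0 ≤ len := by nlinarith
  have hKx : 0 < K * x * Δ := by positivity
  have he0 : 0 < e := hKx.trans_le he
  have hiterations : (len + 7 * M + 17) * Δ / e ≤ (len + 8 * x) / (K * x) := by
    rw [div_le_div_iff₀ he0 (by positivity)]
    calc (len + 7 * M + 17) * Δ * (K * x) = (len + 7 * M + 17) * (K * x * Δ) := by ring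
      _ ≤ (len + 8 * x) * e := mul_le_mul (by linarith) he hKx.le (by positivity)
  have hdecisions : (7 * M + 18) * ((len + 7 * M + 17) * Δ / e + 1) ≤
      8 * (len / K) + 64 * (x / K) + 8 * x :=
    calc (7 * M + 18) * ((len + 7 * M + 17) * Δ / e + 1)
        ≤ 8 * x * ((len + 8 * x) / (K * x) + 1) :=
          mul_le_mul hM (by linarith) (by positivity) (by positivity)
      _ = 8 * (len / K) + 64 * (x / K) + 8 * x := by field_simp; ring
  have hlenK : len / K ≤ g / 64 * len := by
    rw [div_le_comm₀ (by positivity) (by positivity)] at hKg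
    rw [div_eq_inv_mul]
    gcongr
    rw [inv_eq_one_div]
    linarith [show 1 / K = 64 / K / 64 by ring]
  have hxK : x / K ≤ x := div_le_self (by positivity) hK
  have hearly : len / C' ≤ g / 8 * len := by
    rw [div_le_iff₀ hg] at hCg
    rw [div_le_iff₀ hC']
    nlinarith
  have hrest : 2 * ρ + 16 * y + 6 + 144 * x < g / 2 * len := by nlinarith
  have hmain : 2 * (y * len) - ρ * len = g * len := by rw [← hgap]; ring
  linarith

theorem suitable_of_large {Node : Type u} {S : Setting Node} {κ a : ℕ} {ρ y g K C' T : ℝ}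
    (hρ : 0 ≤ ρ) (hg : 0 < g) (hgap : 2 * y - ρ = g) (hK : 1 ≤ K)
    (hKg : 64 / g ≤ K) (hC' : 1 ≤ C') (hCg : 8 / g ≤ C') (hΔ : 0 < S.Δ)
    (hk : (ρ + 1) * κ ≤ S.k) (he : K * √κ * S.Δ ≤ S.e) (hT : T ≤ (κ : ℝ) ^ a)
    (hκ : 25 ≤ √(κ : ℝ)) (hκC : 16 * C' ≤ √(κ : ℝ)) (hκρ : 4 * ρ < √(κ : ℝ))
    (hκΔ : 1 + 5 * S.Δ ≤ √(κ : ℝ) * S.Δ)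
    (hlarge : 2 * (2 * ρ + 16 * y + 150) < g * √(κ : ℝ)) :
    Suitable S κ (κ ^ (a + 2)) ⌈√(κ : ℝ)⌉₊ y ρ T C' := by
  set x := √(κ : ℝ)
  have hxx : x * x = κ := Real.mul_self_sqrt κ.cast_nonneg
  have hxκ : x ≤ κ := by nlinarith
  have hκ32 : 32 ≤ κ := by
    have : (32 : ℝ) ≤ κ := by nlinarith
    exact_mod_cast this
  have hM : 7 * (⌈x⌉₊ : ℝ) + 18 ≤ 8 * x := by linarith [Nat.ceil_lt_add_one (a := x) (by linarith)]
  have hpow : 1 ≤ κ ^ a := Nat.one_le_pow _ _ (by lia)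
  have hpow' : (1 : ℝ) ≤ (κ : ℝ) ^ a := by exact_mod_cast hpow
  constructor
  case y_nonneg => linarith
  case one_le_M => exact Nat.one_le_ceil_iff.2 (by linarith)
  case κ_le => rw [pow_add]; nlinarith [Nat.mul_le_mul_right (κ ^ 2) hpow]
  case Δ_le_e => exact le_trans (le_mul_of_one_le_left hΔ.le (by nlinarith)) he
  case time_le =>
    push_cast
    have hsq : 1 + 5 * S.Δ ≤ (κ : ℝ) ^ 2 * S.Δ := hκΔ.trans (by gcongr; nlinarith)
    rw [pow_add]
    nlinarith
  case depth => nlinarith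
  case M_le => nlinarith
  case rate =>
    exact fun len hlen => rate_of_large hρ hg hgap hK hKg (by linarith) hCg hΔ (by linarith) hM
      he hlarge (hxx.trans_le hlen)
  all_goals assumption

theorem tendsto_sqrt_natCast_atTop : Tendsto (fun κ : ℕ => √(κ : ℝ)) atTop atTop :=
  Real.tendsto_sqrt_atTop.comp tendsto_natCast_atTop_atTop

theorem eventually_suitable {ρ y g Δ : ℝ} (hρ : 0 ≤ ρ) (hg : 0 < g)
    (hgap : 2 * y - ρ = g) (hΔ : 0 < Δ) (a : ℕ) :
    ∀ᶠ κ : ℕ in atTop, ∀ (Node : Type u) (S : Setting Node), S.Δ = Δ → (ρ + 1) * κ ≤ S.k →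
      max 1 (64 / g) * √κ * Δ ≤ S.e → ∀ T : ℝ, T ≤ (κ : ℝ) ^ a →
      Suitable S κ (κ ^ (a + 2)) ⌈√(κ : ℝ)⌉₊ y ρ T (max 1 (8 / g)) := by
  have h := tendsto_sqrt_natCast_atTop
  filter_upwards [h.eventually_ge_atTop 25, h.eventually_ge_atTop (16 * max 1 (8 / g)),
    h.eventually_gt_atTop (4 * ρ), h.eventually_ge_atTop ((1 + 5 * Δ) / Δ),
    h.eventually_gt_atTop (2 * (2 * ρ + 16 * y + 150) / g)]
    with κ hκ hκC hκρ hκΔ hlarge Node S hSΔ hk he T hT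
  subst hSΔ
  rw [div_le_iff₀ hΔ] at hκΔ
  rw [div_lt_iff₀' hg] at hlarge
  exact suitable_of_large hρ hg hgap (le_max_left _ _) (le_max_right _ _) (le_max_left _ _)
    (le_max_right _ _) hΔ hk he hT hκ hκC hκρ hκΔ hlarge

theorem one_third_pow_ceil_le_exp (x : ℝ) : (1 / 3 : ℝ) ^ ⌈x⌉₊ ≤ Real.exp (-x) := by
  have hthird : (1 / 3 : ℝ) ≤ Real.exp (-1) := by
    rw [Real.exp_neg, one_div]
    exact inv_anti₀ (Real.exp_pos 1) (Real.exp_one_lt_d9.le.trans (by norm_num))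
  calc (1 / 3 : ℝ) ^ ⌈x⌉₊ ≤ Real.exp (-1) ^ ⌈x⌉₊ := by gcongr
    _ = Real.exp (-⌈x⌉₊) := by rw [← Real.exp_nat_mul]; ring_nf
    _ ≤ Real.exp (-x) := by gcongr; exact Nat.le_ceil x

theorem eventually_mul_pow_le_exp {B c : ℝ} (hB : 0 < B) (hc : 0 < c) (n : ℕ) :
    ∀ᶠ x : ℝ in atTop, B * x ^ n ≤ Real.exp (c * x) := by
  filter_upwards [(isLittleO_pow_exp_pos_mul_atTop n hc).def (inv_pos.2 hB), eventually_ge_atTop 0]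
    with x hx hx0
  rwa [Real.norm_of_nonneg (by positivity), Real.norm_of_nonneg (by positivity),
    le_inv_mul_iff₀ hB] at hx

theorem eventually_union_bound_le {c : ℝ} (hc : 0 < c) (a : ℕ) :
    ∀ᶠ κ : ℕ in atTop, (((κ ^ (a + 2) : ℕ) : ℝ) + 1) ^ 2 *
      (3 * Real.exp (-c * κ) + (1 / 3) ^ ⌈√(κ : ℝ)⌉₊) ≤ Real.exp (-(1 / 2) * √(κ : ℝ)) := by
  have h := tendsto_sqrt_natCast_atTop
  filter_upwards [h.eventually (eventually_mul_pow_le_exp (B := 16) (c := 1 / 2) (by norm_num)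
    (by norm_num) (4 * a + 8)), h.eventually_ge_atTop (1 / c), h.eventually_ge_atTop 1]
    with κ hpow hcx hx
  set x := √(κ : ℝ)
  have hxx : x ^ 2 = κ := Real.sq_sqrt κ.cast_nonneg
  have hexp : Real.exp (-c * κ) ≤ Real.exp (-x) := by
    rw [div_le_iff₀' hc] at hcx
    refine Real.exp_le_exp.2 ?_
    rw [← hxx]
    nlinarith
  have hb : (((κ ^ (a + 2) : ℕ) : ℝ) + 1) ^ 2 ≤ 4 * x ^ (4 * a + 8) := by
    have hone : (1 : ℝ) ≤ x ^ (2 * a + 4) := one_le_pow₀ hx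
    push_cast
    rw [← hxx, ← pow_mul, show 2 * (a + 2) = 2 * a + 4 by ring,
      show 4 * a + 8 = (2 * a + 4) * 2 by ring, pow_mul x (2 * a + 4)]
    nlinarith
  calc (((κ ^ (a + 2) : ℕ) : ℝ) + 1) ^ 2 * (3 * Real.exp (-c * κ) + (1 / 3) ^ ⌈x⌉₊)
      ≤ 4 * x ^ (4 * a + 8) * (4 * Real.exp (-x)) :=
        mul_le_mul hb (by linarith [one_third_pow_ceil_le_exp x]) (by positivity) (by positivity)
    _ = 16 * x ^ (4 * a + 8) * Real.exp (-x) := by ring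
    _ ≤ Real.exp (1 / 2 * x) * Real.exp (-x) := by gcongr
    _ = Real.exp (-(1 / 2) * x) := by rw [← Real.exp_add]; congr 1; ring

end Asymptotics

end CLC

theorem mainTheorem2_general (β lam Δ : ℝ) (hβ₀ : 0 ≤ β) (hβ : β < 1 / 2) (hlam : 0 < lam)
    (hΔ : 0 < Δ) (hregime : lam * Δ - ybar β lam Δ < ybar β lam Δ) :
    ∃ C > (0 : ℝ), ∃ c > (0 : ℝ), ∃ K > (0 : ℝ), ∃ K₀ > (0 : ℝ), ∀ a : ℕ, ∃ κ₀ : ℕ,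
      ∀ κ : ℕ, κ₀ ≤ κ →
      ∀ (Node : Type u) (S : Setting Node),
        S.Δ = Δ →
        K₀ * κ ≤ S.k →
        K * Real.sqrt κ * Δ ≤ S.e →
        3 * {i ∈ (S.ckpt : Set Node) | i ∉ S.honest}.ncard < S.ckpt.card →
      ∀ T : ℝ, T ≤ (κ : ℝ) ^ a →
      ∀ (Ω : Type v) [MeasurableSpace Ω] (μ : Measure Ω) (H A : Ω → Set ℝ)
        (ld : ℕ × ℕ → Ω → S.ckpt),
        IsPoissonProcess μ ((1 - β) * lam) H →
        IsPoissonProcess μ (β * lam) A →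
        (∀ x i, μ {ω | ld x ω = i} = (S.ckpt.card : ENNReal)⁻¹) →
        iIndepFun (m := fun _ => ⊤) ld μ →
        μ {ω | ∃ R : Run Node, R.Admissible S (oracleAt H A ld ω) ∧
            ¬ (CommonPrefixAfter S R S.k (C * gstSlot S R) T ∧
               ChainQualityAfter S R S.k (C * gstSlot S R) (C * gstSlot S R) T)}
          ≤ ENNReal.ofReal (Real.exp (-c * Real.sqrt κ)) := by
  set g := ybar β lam Δ - lam * Δ / 2 with hg_def
  have hg : 0 < g := by linarith
  have hlamΔ : 0 < ((1 - β) * lam + β * lam) * Δ := by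
    rw [← add_mul, sub_add_cancel, one_mul]; positivity
  set ε := g / 4 with hε_def
  have hε : 0 < ε := by positivity
  set ρ := ((1 - β) * lam + β * lam) * Δ + 2 * ε with hρ_def
  have hρ : 0 < ρ := by positivity
  have hgap : 2 * (ybar β lam Δ - ε) - ρ = g := by linarith
  refine ⟨2 * max 1 (8 / g) * (max 1 (8 / g) + 1), by positivity, 1 / 2, by norm_num,
    max 1 (64 / g), by positivity, ρ + 1, by positivity, fun a => ?_⟩
  obtain ⟨κ₀, hκ₀⟩ := eventually_atTop.1 ((eventually_suitable hρ.le hg hgap hΔ a).and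
    (eventually_union_bound_le (div_pos (tailExponent_pos hlamΔ.le hε) four_pos) a))
  refine ⟨κ₀, fun κ hκ Node S hSΔ hk he hbad T hT Ω _ μ H A ld hH hA hld hind => ?_⟩
  obtain ⟨hsuitable, hbound⟩ := hκ₀ κ hκ
  have P := hsuitable Node S hSΔ hk he T hT
  subst hSΔ
  refine le_trans (measure_mono ?_) ((measure_not_typical_le hH hA hld hind hbad
    (mul_nonneg (by linarith) hlam.le) (by positivity) hΔ.le hε κ (κ ^ (a + 2))
    ⌈√(κ : ℝ)⌉₊).trans (ENNReal.ofReal_le_ofReal hbound))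
  rintro ω ⟨R, hR, hinsecure⟩ hT
  have F : Fair S (oracleAt H A ld ω) R := ⟨hR, hbad, hΔ, hΔ.trans_le P.Δ_le_e⟩
  exact hinsecure ⟨P.commonPrefixAfter hT F le_rfl, P.chainQualityAfter hT F le_rfl⟩

theorem mainTheorem2 (β lam Δ : ℝ) (hβ₀ : 0 ≤ β) (hβ : β < 1 / 2) (hlam : 0 < lam) (hΔ : 0 < Δ)
    (hregime : lam * Δ - ybar β lam Δ < ybar β lam Δ) :
    ∃ C > (0 : ℝ), ∃ c > (0 : ℝ), ∃ K > (0 : ℝ), ∃ K₀ > (0 : ℝ), ∀ a : ℕ, ∃ κ₀ : ℕ,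
      ∀ κ : ℕ, κ₀ ≤ κ →
      ∀ (Node : Type u) [Fintype Node] (S : Setting Node),
        S.Δ = Δ →
        K₀ * κ ≤ S.k →
        K * Real.sqrt κ * Δ ≤ S.e →
        3 * {i ∈ (S.ckpt : Set Node) | i ∉ S.honest}.ncard < S.ckpt.card →
      ∀ T : ℝ, T ≤ (κ : ℝ) ^ a →
      ∀ (Ω : Type v) [MeasurableSpace Ω] (μ : Measure Ω) [IsProbabilityMeasure μ]
        (H A : Ω → Set ℝ) (ld : ℕ × ℕ → Ω → S.ckpt), IsOracle μ S β lam H A ld →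
        μ {ω | ∃ R : Run Node, R.Admissible S (oracleAt H A ld ω) ∧
            ¬ (CommonPrefixAfter S R S.k (C * gstSlot S R) T ∧
               ChainQualityAfter S R S.k (C * gstSlot S R) (C * gstSlot S R) T)}
          ≤ ENNReal.ofReal (Real.exp (-c * Real.sqrt κ)) := by
  obtain ⟨C, hC, c, hc, K, hK, K₀, hK₀, h⟩ := mainTheorem2_general β lam Δ hβ₀ hβ hlam hΔ hregime
  exact ⟨C, hC, c, hc, K, hK, K₀, hK₀, fun a => (h a).imp fun κ₀ hκ₀ κ hκ Node _ S hSΔ hk he hbad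
    T hT Ω _ μ _ H A ld hO => hκ₀ κ hκ Node S hSΔ hk he hbad T hT Ω μ H A ld hO.honest_poisson
      hO.adv_poisson hO.ld_uniform hO.ld_indep⟩
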